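/- Let $G$ be a profinite group with a strictly decreasing sequence $\mathcal G=(G_n)_{n\ge 0}$ of open normal subgroups such that $\bigcup_n G_n=G$, $\bigcap_n G_n=\{e\}$, the $G_n$ form a basis of neighbourhoods of $e$, $2\le |G_n/G_{n+1}|$ for all $n$, and $\sup_n|G_n/G_{n+1}|<\infty$ (a compact Vilenkin group of bounded order). Let $dx$ be the normalized Haar measure and $|A|$ the measure of $A$. Put $|e|_{\mathcal G}=0$ and $|x|_{\mathcal G}=|G_n|$ for $x\in G_n\setminus G_{n+1}$, and let $L^r_\alpha(G)=L^r(G,|x|_{\mathcal G}^\alpha\,dx)$ and $L^r(G)=L^r(G,dx)$. Let $\widehat G$ be the set of equivalence classes of irreducible continuous unitary representations of $G$, and put $$\widehat f(\pi)=\int_G f(x)\pi(x)^*\,dx,\qquad \mathcal F_G^{-1}\varphi(x)=\sum_{[\pi]\in\widehat G}d_\pi\operatorname{Tr}[\pi(x)\varphi(\pi)].$$ A symbol $\sigma$ assigns to each $\pi$ an operator $\sigma(\pi)$ on its space, compatibly with unitary equivalence; $\sigma\in L^\infty_{\mathrm{op}}(\widehat G)$ means $\sup_{[\pi]\in\widehat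 G}\|\sigma(\pi)\|_{\mathrm{op}}<\infty$. The Fourier multiplier is $T_\sigma f=\mathcal F_G^{-1}[\sigma\widehat f\,]$ for $f$ in the space $\mathcal D(G)$ of functions $f:G\to\mathbb C$ such that, for some $l$, $f(xy)=f(x)$ for all $x\in G$, $y\in G_l$. It is called bounded on a weighted space $L^r_\alpha(G)$ if it extends from $\mathcal D(G)$ to a bounded linear operator on that space. Let $\epsilon_k=|G_k|^{-1}\mathbb 1_{G_k}$ and $r_k=\mathcal F_G^{-1}[\widehat{\epsilon}_k\,\sigma]$. For $1<t<\infty$ with conjugate exponent $t'$, $\sigma$ satisfies condition $H(t)$ if there are $\varepsilon>0$ and $C$ such that for all $k$, all $n<l$ and all $y\in G_l$, $$\Big(\int_{G_n\setminus G_{n+1}}|r_k(xy^{-1})-r_k(x)|^t\,dx\Big)^{1/t}\le C\,|G_n|^{-(\varepsilon+1/t')}|G_l|^{\varepsilon};$$ it satisfies $H(1)$ if there is $C$ such that $\int_{G\setminus G_l}|r_k(xy^{-1})-r_k(x)|\,dx\le C$ for all $k,l$ and all $y\in G_l$. **Theorem.** Let $\sigma\in L^\infty_{\mathrm{op}}(\widehat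 G)$. (1) If $\sigma$ satisfies $H(t)$ for some $1\le t<\infty$ and $T_\sigma$ is bounded on $L^2_{\alpha_0}(G)$ for some $-1/t'<\alpha_0<1/t'$ (with $1/t'=1-1/t$), then $T_\sigma$ is bounded on $L^r_\alpha(G)$ for all $1<r<\infty$ and $-|\alpha_0|\le\alpha\le(r-1)|\alpha_0|$. (2) If $\sigma$ satisfies $H(1)$, then $T_\sigma$ is bounded on $L^r(G)$ for all $1<r<\infty$. -/

import Mathlib

open MeasureTheory
open scoped Matrix

noncomputable section

universe u

/-- A filtration making `G` a compact Vilenkin group: a strictly decreasing sequence of open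
(hence compact) subgroups `G_n`, normal in `G`, with successive indices at least `2`, with union
`G` and trivial intersection, forming a basis of neighbourhoods of the identity. -/
structure VilenkinFiltration (G : Type u) [Group G] [TopologicalSpace G] where
  /-- The subgroups `G_n`. -/
  subgroup : ℕ → Subgroup G
  isOpen : ∀ n, IsOpen (subgroup n : Set G)
  normal : ∀ n, (subgroup n).Normal
  strictAnti : StrictAnti subgroup
  two_le_index : ∀ n, 2 ≤ (subgroup (n + 1)).relIndex (subgroup n)
  iUnion_eq : (⋃ n, (subgroup n : Set G)) = Set.univ
  iInter_eq : (⋂ n, (subgroup n : Set G)) = {1}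
  hasBasis : (nhds (1 : G)).HasBasis (fun _ : ℕ => True) (fun n => (subgroup n : Set G))

/-- A continuous finite-dimensional unitary (matrix) representation of `G`. -/
structure UnitaryRep (G : Type u) [Group G] [TopologicalSpace G] where
  /-- The dimension `d_π`. -/
  dim : ℕ
  /-- The homomorphism into the unitary group. -/
  toHom : G →* Matrix.unitaryGroup (Fin dim) ℂ
  continuous_toHom : Continuous toHom

namespace UnitaryRep

variable {G : Type u} [Group G] [TopologicalSpace G]

/-- The matrix `π(x)`. -/
def mat (π : UnitaryRep G) (x : G) : Matrix (Fin π.dim) (Fin π.dim) ℂ :=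
  (π.toHom x : Matrix (Fin π.dim) (Fin π.dim) ℂ)

/-- `π` is irreducible: nonzero, without proper nonzero invariant subspaces. -/
def IsIrreducible (π : UnitaryRep G) : Prop :=
  0 < π.dim ∧ ∀ W : Submodule ℂ (Fin π.dim → ℂ),
    (∀ x : G, ∀ v ∈ W, π.mat x *ᵥ v ∈ W) → W = ⊥ ∨ W = ⊤

/-- `U` is a unitary intertwiner from `π` to `π'`, i.e. `π'(x) = U π(x) U*`. -/
def IsIntertwiner (π π' : UnitaryRep G) (U : Matrix (Fin π'.dim) (Fin π.dim) ℂ) : Prop :=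
  Uᴴ * U = 1 ∧ U * Uᴴ = 1 ∧ ∀ x, π'.mat x = U * π.mat x * Uᴴ

/-- Unitary equivalence of irreducible representations. -/
instance irrepSetoid (G : Type u) [Group G] [TopologicalSpace G] :
    Setoid {π : UnitaryRep G // π.IsIrreducible} where
  r π π' := ∃ U, IsIntertwiner π.1 π'.1 U
  iseqv :=
    { refl := fun π => ⟨1, by simp [IsIntertwiner]⟩
      symm := by
        rintro π π' ⟨U, h1, h2, h3⟩
        refine ⟨Uᴴ, by simpa using h2, by simpa using h1, fun x => ?_⟩
        rw [h3 x, Matrix.conjTranspose_conjTranspose]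
        calc π.1.mat x = (Uᴴ * U) * π.1.mat x * (Uᴴ * U) := by simp [h1]
          _ = Uᴴ * (U * π.1.mat x * Uᴴ) * U := by simp only [Matrix.mul_assoc]
      trans := by
        rintro π π' π'' ⟨U, h1, h2, h3⟩ ⟨V, k1, k2, k3⟩
        refine ⟨V * U, ?_, ?_, fun x => ?_⟩
        · rw [Matrix.conjTranspose_mul]
          calc Uᴴ * Vᴴ * (V * U) = Uᴴ * (Vᴴ * V) * U := by simp only [Matrix.mul_assoc]
            _ = 1 := by simp [k1, h1]
        · rw [Matrix.conjTranspose_mul]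
          calc V * U * (Uᴴ * Vᴴ) = V * (U * Uᴴ) * Vᴴ := by simp only [Matrix.mul_assoc]
            _ = 1 := by simp [k2, h2]
        · rw [k3 x, h3 x, Matrix.conjTranspose_mul]
          simp only [Matrix.mul_assoc] }

end UnitaryRep

/-- The unitary dual: classes of irreducible unitary representations up to unitary
equivalence. -/
def UnitaryDual (G : Type u) [Group G] [TopologicalSpace G] : Type u :=
  Quotient (UnitaryRep.irrepSetoid G)

/-- A representative of a class in the unitary dual. -/
def UnitaryDual.rep {G : Type u} [Group G] [TopologicalSpace G] (ξ : UnitaryDual G) :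
    UnitaryRep G :=
  (Quotient.out ξ).1

/-- A symbol: a map `π ↦ σ(π) ∈ L(H_π)`, compatible with unitary equivalence of irreducible
representations. (Its values at reducible representations play no role.) -/
structure FourierSymbol (G : Type u) [Group G] [TopologicalSpace G] where
  /-- The matrix `σ(π)`. -/
  toFun : (π : UnitaryRep G) → Matrix (Fin π.dim) (Fin π.dim) ℂ
  equivariant : ∀ π π' : UnitaryRep G, π.IsIrreducible → π'.IsIrreducible →
    ∀ U, UnitaryRep.IsIntertwiner π π' U → toFun π' = U * toFun π * Uᴴ

/-- `σ ∈ L^∞_op`: the operator norms (on Euclidean space) of `σ(π)`, `π` irreducible, are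
bounded. -/
def FourierSymbol.IsBounded {G : Type u} [Group G] [TopologicalSpace G]
    (σ : FourierSymbol G) : Prop :=
  ∃ C : ℝ, ∀ π : UnitaryRep G, π.IsIrreducible →
    ‖Matrix.toEuclideanCLM (𝕜 := ℂ) (σ.toFun π)‖ ≤ C

section Fourier

variable {G : Type u} [Group G] [TopologicalSpace G] [MeasurableSpace G]

/-- The group Fourier transform `∫ f(x) π(x)* dx` (computed entrywise). -/
def groupFourier (μ : Measure G) (f : G → ℂ) (π : UnitaryRep G) :
    Matrix (Fin π.dim) (Fin π.dim) ℂ :=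
  Matrix.of fun i j => ∫ x, f x * (π.mat x)ᴴ i j ∂μ

/-- The inverse Fourier transform `∑_{[ξ]} d_ξ Tr[ξ(x) φ(ξ)]`. -/
def groupFourierInv (φ : (π : UnitaryRep G) → Matrix (Fin π.dim) (Fin π.dim) ℂ) (x : G) : ℂ :=
  ∑' ξ : UnitaryDual G, (ξ.rep.dim : ℂ) * (ξ.rep.mat x * φ ξ.rep).trace

/-- The Fourier multiplier `T_σ f(x) = ∑_{[ξ]} d_ξ Tr[ξ(x) σ(ξ) f̂(ξ)]`. -/
def fourierMultiplier (μ : Measure G) (σ : FourierSymbol G) (f : G → ℂ) : G → ℂ :=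
  groupFourierInv fun π => σ.toFun π * groupFourier μ f π

namespace VilenkinFiltration

variable (V : VilenkinFiltration G)

/-- The indices `|G_n / G_{n+1}|` are bounded. -/
def IsOrderBounded {G : Type u} [Group G] [TopologicalSpace G]
    (V : VilenkinFiltration G) : Prop :=
  ∃ B : ℕ, ∀ n, (V.subgroup (n + 1)).relIndex (V.subgroup n) ≤ B

/-- The Haar measure `|G_n|`. -/
def vol (μ : Measure G) (n : ℕ) : ℝ := μ.real (V.subgroup n : Set G)

/-- The shell `G_n \ G_{n+1}`. -/
def shell {G : Type u} [Group G] [TopologicalSpace G] (V : VilenkinFiltration G) (n : ℕ) : Set G :=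
  (V.subgroup n : Set G) \ (V.subgroup (n + 1) : Set G)

open Classical in
/-- `|x| = |G_n|` if `x ∈ G_n \ G_{n+1}`, and `|e| = 0`. -/
def modulus (μ : Measure G) (x : G) : ℝ :=
  if h : ∃ n, x ∈ V.shell n then V.vol μ (Nat.find h) else 0

/-- The weighted measure `μ_α = |x|^α dx`. -/
def weighted (μ : Measure G) (α : ℝ) : Measure G :=
  μ.withDensity fun x => ENNReal.ofReal (V.modulus μ x ^ α)

/-- The space `D(G)` of smooth (locally constant) functions. -/
def smooth {G : Type u} [Group G] [TopologicalSpace G]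
    (V : VilenkinFiltration G) : Set (G → ℂ) :=
  {f | ∃ l, ∀ x, ∀ y ∈ V.subgroup l, f (x * y) = f x}

/-- The normalized indicator function `|G_k|⁻¹ 1_{G_k}`. -/
def normIndicator (μ : Measure G) (k : ℕ) : G → ℂ :=
  (V.subgroup k : Set G).indicator fun _ => ((V.vol μ k : ℝ) : ℂ)⁻¹

/-- The truncated kernel: the inverse Fourier transform of the product of the Fourier transform of
the normalized indicator of `G_k` with `σ`. -/
def truncKernel (μ : Measure G) (σ : FourierSymbol G) (k : ℕ) : G → ℂ :=
  groupFourierInv fun π => groupFourier μ (V.normIndicator μ k) π * σ.toFun π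

/-- Condition `H(t)`, `1 ≤ t < ∞`, with constants uniform in `k`, `l` (and `n < l`). The number
`1 - 1 / t` is `1 / t'` for the conjugate exponent `t'`. The integrands are locally constant, hence
integrable. -/
def ConditionH (μ : Measure G) (σ : FourierSymbol G) (t : ℝ) : Prop :=
  (1 < t ∧ ∃ ε : ℝ, 0 < ε ∧ ∃ C : ℝ, ∀ k n l : ℕ, n < l → ∀ y ∈ V.subgroup l,
    (∫ x in V.shell n,
        ‖V.truncKernel μ σ k (x * y⁻¹) - V.truncKernel μ σ k x‖ ^ t ∂μ) ^ (1 / t)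
      ≤ C * (V.vol μ n ^ (-(ε + (1 - 1 / t))) * V.vol μ l ^ ε)) ∨
  (t = 1 ∧ ∃ C : ℝ, ∀ k l : ℕ, ∀ y ∈ V.subgroup l,
    ∫ x in (V.subgroup l : Set G)ᶜ,
        ‖V.truncKernel μ σ k (x * y⁻¹) - V.truncKernel μ σ k x‖ ∂μ ≤ C)

/-- `T_σ` is bounded on `L^r(ν)`: all smooth functions lie in `L^r(ν)`, and `T_σ`, defined on
smooth functions, extends to a bounded linear operator on `L^r(ν)`. -/
def IsBoundedMultiplier (μ : Measure G) (σ : FourierSymbol G) (r : ℝ) (ν : Measure G) : Prop :=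
  ∃ S : Lp ℂ (ENNReal.ofReal r) ν →ₗ[ℂ] Lp ℂ (ENNReal.ofReal r) ν,
    (∃ C : ℝ, ∀ f, ‖S f‖ ≤ C * ‖f‖) ∧
    ∀ f ∈ V.smooth, ∃ hf : MemLp f (ENNReal.ofReal r) ν,
      (S (hf.toLp f) : G → ℂ) =ᵐ[ν] fourierMultiplier μ σ f

end VilenkinFiltration

end Fourier

end

/-!
On a function `f` of level `k`, meaning `f (x * y) = f x` for `y ∈ G_k`, the multiplier `T_σ` is
the convolution `f ↦ f * r_k`: an irreducible representation that is nontrivial on the normal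
subgroup `G_k` has no `G_k`-fixed vector, so only the finitely many classes trivial on `G_k`
contribute to either side. Both `f` and `r_k` descend to the finite group `G / G_k`, and everything
reduces to estimates for convolution matrices on finite groups with a chain of normal subgroups,
with constants depending only on those of the hypotheses (`NormalChain.exists_unweighted_bound` and
`NormalChain.exists_weighted_bound`). Functions of some level are dense in `L^r` of a finite
measure, so uniform estimates extend to all of `L^r` (`isBoundedMultiplier_of_integral_le`).

The inputs on the finite groups are the following.

* The `L²` bound. By Schur orthogonality the normalized matrix coefficients are orthonormal, so that
  Parseval's identity and Bessel's inequality give `‖T_σ f‖₂ ≤ sup ‖σ‖ ‖f‖₂` on functions of level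
  `k`.
* Hörmander's condition. Condition `H(t)` implies `H(1)` by Hölder's inequality and a geometric
  series over the shells. Averaging over `y ∈ G_l`, `H(1)` says that `r_k` is close in mean, off
  `G_l`, to its averages over the cosets of `G_l`; since `G_l` is normal, its left and right cosets
  agree, and this gives Hörmander's condition for the convolution matrix and for its transpose.
* The unweighted bound. The Calderón–Zygmund decomposition gives the weak type `(1, 1)` inequality,
  the Marcinkiewicz interpolation argument gives `1 < p < 2`, and duality gives `2 < p < ∞`.
* The weighted bound, for `-1/t' < α < (r - 1)/t'`. The weight is constant on shells, so the part of
  the operator that maps a shell to itself is controlled by the unweighted bound. Between different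
  shells the kernel is controlled by its size: on the shell of level `n` it differs little in `L^t`
  from its averages over cosets of `G_{n+1}`, and these are bounded by a multiple of `1 / |G_{n+1}|`
  because they are the image under `T_σ` of a normalized indicator function. Schur's test with a
  power of the modulus as test function then applies (`NormalChain.ShellBound.weighted_bound`).

For `t > 1` the weighted bound covers the range `-|α₀| ≤ α ≤ (r - 1) |α₀|` because `|α₀| < 1/t'`.
For `t = 1` no `α₀` satisfies `-1/t' < α₀ < 1/t'`.
-/

/-! ### Block trees and the Calderón–Zygmund decomposition -/

/-- Chebyshev's inequality for a finite sum. -/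
lemma Finset.mul_card_filter_le_sum {X : Type*} {s : Finset X} {F : X → ℝ} (hF : ∀ x ∈ s, 0 ≤ F x)
    (c : ℝ) : c * ((s.filter fun x => c < F x).card : ℝ) ≤ ∑ x ∈ s, F x := by
  calc c * ((s.filter fun x => c < F x).card : ℝ) = ∑ x ∈ s.filter fun x => c < F x, c := by
        simp [mul_comm]
    _ ≤ ∑ x ∈ s.filter fun x => c < F x, F x :=
        Finset.sum_le_sum fun x hx => (Finset.mem_filter.1 hx).2.le
    _ ≤ ∑ x ∈ s, F x :=
        Finset.sum_le_sum_of_subset_of_nonneg (Finset.filter_subset _ _) fun x hx _ => hF x hx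

/-- A finite tree of partitions of `X`: at each level `n` the blocks `block n x` partition `X`,
level `n + 1` refines level `n`, level `0` is the trivial partition, and the level `depth` consists
of singletons. It is the finite model of the partitions of a group into the cosets of a decreasing
chain of subgroups. -/
structure BlockTree (X : Type*) [Fintype X] where
  /-- The block of level `n` containing `x`. -/
  block : ℕ → X → Finset X
  /-- A level at which all blocks are singletons. -/
  depth : ℕ
  mem_block : ∀ n x, x ∈ block n x
  block_eq : ∀ {n x y}, y ∈ block n x → block n y = block n x
  block_succ_subset : ∀ n x, block (n + 1) x ⊆ block n x
  block_zero : ∀ x, block 0 x = Finset.univ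
  block_depth : ∀ x, block depth x = {x}

namespace BlockTree

variable {X : Type*} [Fintype X] (𝒯 : BlockTree X)

lemma block_anti {m n : ℕ} (h : m ≤ n) (x : X) : 𝒯.block n x ⊆ 𝒯.block m x := by
  induction h with
  | refl => exact subset_rfl
  | step _ ih => exact (𝒯.block_succ_subset _ x).trans ih

lemma card_block_pos (n : ℕ) (x : X) : (0 : ℝ) < (𝒯.block n x).card := by
  exact_mod_cast Finset.card_pos.mpr ⟨x, 𝒯.mem_block n x⟩

/-- The average of `f` over the block of level `n` containing `x`. -/
noncomputable def average {E : Type*} [AddCommGroup E] [Module ℝ E] (f : X → E) (n : ℕ)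
    (x : X) : E :=
  ((𝒯.block n x).card : ℝ)⁻¹ • ∑ y ∈ 𝒯.block n x, f y

/-- A stopping time: the level `τ x` is constant on the block of level `τ x` of `x`. The blocks
`block (τ x) x` then form a partition of `X`. -/
def IsStopping (τ : X → ℕ) : Prop := ∀ x, ∀ y ∈ 𝒯.block (τ x) x, τ y = τ x

variable {𝒯}

lemma norm_average_le {f : X → ℂ} (n : ℕ) (x : X) :
    ‖𝒯.average f n x‖ ≤ 𝒯.average (fun y => ‖f y‖) n x := by
  unfold average
  rw [norm_smul, norm_inv, Real.norm_natCast, smul_eq_mul]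
  gcongr
  exact norm_sum_le _ _

lemma average_const (c : ℝ) (n : ℕ) (x : X) : 𝒯.average (fun _ => c) n x = c := by
  have := (𝒯.card_block_pos n x).ne'
  simp [average, this]

lemma average_depth {E : Type*} [AddCommGroup E] [Module ℝ E] (f : X → E) (x : X) :
    𝒯.average f 𝒯.depth x = f x := by
  simp [average, 𝒯.block_depth]

lemma average_congr {E : Type*} [AddCommGroup E] [Module ℝ E] (f : X → E) {n : ℕ} {x y : X}
    (h : y ∈ 𝒯.block n x) : 𝒯.average f n y = 𝒯.average f n x := by
  simp only [average, 𝒯.block_eq h]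

/-- Averaging over the partition given by a stopping time is a symmetric operator. -/
lemma IsStopping.sum_average_mul {𝕜 : Type*} [Field 𝕜] [Algebra ℝ 𝕜] {τ : X → ℕ}
    (hτ : 𝒯.IsStopping τ) (f g : X → 𝕜) :
    ∑ x, 𝒯.average f (τ x) x * g x = ∑ x, f x * 𝒯.average g (τ x) x := by
  classical
  have key : ∀ x y, y ∈ 𝒯.block (τ x) x → x ∈ 𝒯.block (τ y) y ∧
      (𝒯.block (τ y) y).card = (𝒯.block (τ x) x).card := fun x y h => by
    rw [hτ x y h, 𝒯.block_eq h]
    exact ⟨𝒯.mem_block _ _, rfl⟩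
  have h1 : ∀ x, 𝒯.average f (τ x) x * g x =
      ∑ y, if y ∈ 𝒯.block (τ x) x then ((𝒯.block (τ x) x).card : ℝ)⁻¹ • (f y * g x) else 0 := by
    intro x
    rw [average, smul_mul_assoc, Finset.sum_mul, Finset.smul_sum, ← Finset.sum_filter]
    simp
  have h2 : ∀ y, f y * 𝒯.average g (τ y) y =
      ∑ x, if x ∈ 𝒯.block (τ y) y then ((𝒯.block (τ y) y).card : ℝ)⁻¹ • (f y * g x) else 0 := by
    intro x
    rw [average, mul_smul_comm, Finset.mul_sum, Finset.smul_sum, ← Finset.sum_filter]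
    simp
  simp_rw [h1, h2]
  rw [Finset.sum_comm]
  refine Finset.sum_congr rfl fun y _ => Finset.sum_congr rfl fun x _ => ?_
  by_cases h : y ∈ 𝒯.block (τ x) x
  · rw [if_pos h, if_pos (key x y h).1, (key x y h).2]
  · rw [if_neg h, if_neg fun h' => h (key y x h').1]

lemma IsStopping.sum_average {τ : X → ℕ} (hτ : 𝒯.IsStopping τ) (f : X → ℝ) :
    ∑ x, 𝒯.average f (τ x) x = ∑ x, f x := by
  simpa [average_const] using hτ.sum_average_mul f fun _ => (1 : ℝ)

lemma IsStopping.average_average {E : Type*} [AddCommGroup E] [Module ℝ E] {τ : X → ℕ}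
    (hτ : 𝒯.IsStopping τ) (f : X → E) (x : X) :
    𝒯.average (fun y => 𝒯.average f (τ y) y) (τ x) x = 𝒯.average f (τ x) x := by
  have h : ∀ y ∈ 𝒯.block (τ x) x, 𝒯.average f (τ y) y = 𝒯.average f (τ x) x := fun y hy => by
    rw [hτ x y hy, average_congr f hy]
  have hc := (𝒯.card_block_pos (τ x) x).ne'
  rw [average, Finset.sum_congr rfl h, Finset.sum_const, ← Nat.cast_smul_eq_nsmul ℝ, smul_smul,
    inv_mul_cancel₀ hc, one_smul]

/-- The stopping time of the Calderón–Zygmund decomposition at height `c`: the first level at which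
the average of `|f|` exceeds `c`. -/
lemma exists_stopping {B : ℝ} (hB : 1 ≤ B)
    (hdbl : ∀ n x, ((𝒯.block n x).card : ℝ) ≤ B * (𝒯.block (n + 1) x).card)
    (f : X → ℂ) {c : ℝ} (hc : 0 < c) (hf : ∑ x, ‖f x‖ ≤ c * Fintype.card X) :
    ∃ (τ : X → ℕ) (Ω : Finset X), 𝒯.IsStopping τ ∧
      (∀ x, ‖𝒯.average f (τ x) x‖ ≤ B * c) ∧
      (∀ x ∉ Ω, 𝒯.average f (τ x) x = f x) ∧
      (∀ y ∈ Ω, 𝒯.block (τ y) y ⊆ Ω) ∧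
      c * Ω.card ≤ ∑ x, ‖f x‖ := by
  classical
  -- `Ω` is the set where some average exceeds `c`; off `Ω` the time is set to the last level, where
  -- averaging does nothing.
  let p : X → ℕ → Prop := fun x n => c < 𝒯.average (fun y => ‖f y‖) n x
  let τ : X → ℕ := fun x => if h : ∃ n, p x n then Nat.find h else 𝒯.depth
  let Ω : Finset X := Finset.univ.filter fun x => ∃ n, p x n
  have hτ1 : ∀ x (h : ∃ n, p x n), τ x = Nat.find h := fun x h => dif_pos h
  have hτ2 : ∀ x, (¬ ∃ n, p x n) → τ x = 𝒯.depth := fun x h => dif_neg h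
  have hpc : ∀ x y n m, m ≤ n → y ∈ 𝒯.block n x → (p y m ↔ p x m) := by
    intro x y n m hmn hy
    simp only [p]
    rw [average_congr _ (𝒯.block_anti hmn x hy)]
  have hst : ∀ x, ∀ y ∈ 𝒯.block (τ x) x, τ y = τ x ∧ ((∃ n, p y n) ↔ ∃ n, p x n) := by
    intro x y hy
    by_cases h : ∃ n, p x n
    · rw [hτ1 x h] at hy ⊢
      have hy' : p y (Nat.find h) := (hpc x y _ _ le_rfl hy).2 (Nat.find_spec h)
      have hey : ∃ n, p y n := ⟨_, hy'⟩
      refine ⟨?_, by simp [h, hey]⟩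
      rw [hτ1 y hey, Nat.find_eq_iff]
      exact ⟨hy', fun m hm hpm => Nat.find_min h hm ((hpc x y _ _ hm.le hy).1 hpm)⟩
    · rw [hτ2 x h, 𝒯.block_depth, Finset.mem_singleton] at hy
      subst hy
      exact ⟨rfl, Iff.rfl⟩
  have hstopping : 𝒯.IsStopping τ := fun x y hy => (hst x y hy).1
  refine ⟨τ, Ω, hstopping, fun x => ?_, fun x hx => ?_, fun y hy x hx => ?_, ?_⟩
  · by_cases h : ∃ n, p x n
    · -- The average over the parent block is at most `c`, and the parent is at most `B` times
      -- larger. A parent exists because the average over the whole space is at most `c`.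
      refine (norm_average_le _ _).trans ?_
      rw [hτ1 x h]
      have h0 : Nat.find h ≠ 0 := by
        intro h0
        have := Nat.find_spec h
        rw [h0] at this
        have hX : (0 : ℝ) < Fintype.card X := by exact_mod_cast Fintype.card_pos_iff.2 ⟨x⟩
        simp only [p, average, 𝒯.block_zero, Finset.card_univ, smul_eq_mul] at this
        rw [lt_inv_mul_iff₀ hX, mul_comm] at this
        linarith
      obtain ⟨m, hm⟩ := Nat.exists_eq_succ_of_ne_zero h0
      have hpm : ¬ p x m := Nat.find_min h (by omega)
      rw [hm, Nat.succ_eq_add_one]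
      simp only [p, not_lt] at hpm
      refine le_trans ?_ (mul_le_mul_of_nonneg_left hpm (by linarith))
      simp only [average, smul_eq_mul]
      have c1 := 𝒯.card_block_pos m x
      have c2 := 𝒯.card_block_pos (m + 1) x
      have hsum : ∑ y ∈ 𝒯.block (m + 1) x, ‖f y‖ ≤ ∑ y ∈ 𝒯.block m x, ‖f y‖ :=
        Finset.sum_le_sum_of_subset_of_nonneg (𝒯.block_succ_subset m x) fun _ _ _ => norm_nonneg _
      have hinv : ((𝒯.block (m + 1) x).card : ℝ)⁻¹ ≤ B * ((𝒯.block m x).card : ℝ)⁻¹ := by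
        rw [← div_eq_mul_inv, le_div_iff₀ c1, inv_mul_le_iff₀ c2, mul_comm]
        exact (hdbl m x).trans_eq (by ring)
      rw [← mul_assoc]
      gcongr
    · rw [hτ2 x h, average_depth]
      push Not at h
      have := h 𝒯.depth
      simp only [p, average_depth, not_lt] at this
      nlinarith
  · have : ¬ ∃ n, p x n := by simpa [Ω] using hx
    rw [hτ2 x this, average_depth]
  · have hy' : ∃ n, p y n := by simpa [Ω] using hy
    simpa [Ω] using (hst y x hx).2.2 hy'
  · calc c * Ω.card = ∑ x ∈ Ω, c := by simp [mul_comm]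
      _ ≤ ∑ x ∈ Ω, 𝒯.average (fun y => ‖f y‖) (τ x) x := by
          refine Finset.sum_le_sum fun x hx => ?_
          have h : ∃ n, p x n := by simpa [Ω] using hx
          rw [hτ1 x h]
          exact (Nat.find_spec h).le
      _ ≤ ∑ x, 𝒯.average (fun y => ‖f y‖) (τ x) x := by
          refine Finset.sum_le_sum_of_subset_of_nonneg (Finset.subset_univ _) fun x _ _ => ?_
          exact (norm_nonneg _).trans (norm_average_le (f := f) (τ x) x)
      _ = ∑ x, ‖f x‖ := hstopping.sum_average _

variable (𝒯) in
open Classical in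
/-- Hörmander's condition for a kernel `K`, with regularity in the second variable. -/
def Hormander (K : Matrix X X ℂ) (D : ℝ) : Prop :=
  ∀ n y, ∑ x with x ∉ 𝒯.block n y, ‖K x y - 𝒯.average (K x) n y‖ ≤ D

open Classical in
/-- The part `f - 𝔼_τ f` of `f` with vanishing averages is mapped to a function that is summable
off the stopped set, by Hörmander's condition. -/
lemma Hormander.sum_mulVec_le {K : Matrix X X ℂ} {D : ℝ} (hH : 𝒯.Hormander K D)
    {τ : X → ℕ} (hτ : 𝒯.IsStopping τ) {Ω : Finset X} {f : X → ℂ}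
    (h1 : ∀ x ∉ Ω, 𝒯.average f (τ x) x = f x) (h2 : ∀ y ∈ Ω, 𝒯.block (τ y) y ⊆ Ω) :
    ∑ x with x ∉ Ω, ‖(K *ᵥ fun y => f y - 𝒯.average f (τ y) y) x‖ ≤ D * (2 * ∑ x, ‖f x‖) := by
  set b : X → ℂ := fun y => f y - 𝒯.average f (τ y) y with hb
  have hb0 : ∀ y ∉ Ω, b y = 0 := fun y hy => by simp [hb, h1 y hy]
  have hD : 0 ≤ D ∨ IsEmpty X := by
    by_cases h : IsEmpty X
    · exact Or.inr h
    · obtain ⟨y⟩ := not_isEmpty_iff.1 h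
      exact Or.inl ((Finset.sum_nonneg fun _ _ => norm_nonneg _).trans (hH 0 y))
  rcases hD with hD | hX
  swap
  · simp [Finset.univ_eq_empty]
  have hbavg : ∀ y, 𝒯.average b (τ y) y = 0 := by
    intro y
    have := hτ.average_average f y
    have h3 : 𝒯.average b (τ y) y = 𝒯.average f (τ y) y
        - 𝒯.average (fun y => 𝒯.average f (τ y) y) (τ y) y := by
      simp only [average, hb, Finset.sum_sub_distrib, smul_sub]
    rw [h3, this, sub_self]
  have hK : ∀ x, (K *ᵥ b) x = ∑ y, (K x y - 𝒯.average (K x) (τ y) y) * b y := by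
    intro x
    simp only [sub_mul, Finset.sum_sub_distrib]
    rw [hτ.sum_average_mul (K x) b]
    simp [hbavg, Matrix.mulVec, dotProduct]
  have hbsum : ∑ y, ‖b y‖ ≤ 2 * ∑ x, ‖f x‖ := by
    calc ∑ y, ‖b y‖ ≤ ∑ y, (‖f y‖ + 𝒯.average (fun y => ‖f y‖) (τ y) y) :=
          Finset.sum_le_sum fun y _ => (norm_sub_le _ _).trans
            (add_le_add le_rfl (norm_average_le _ _))
      _ = 2 * ∑ x, ‖f x‖ := by rw [Finset.sum_add_distrib, hτ.sum_average]; ring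
  calc ∑ x with x ∉ Ω, ‖(K *ᵥ b) x‖
      ≤ ∑ x with x ∉ Ω, ∑ y, ‖K x y - 𝒯.average (K x) (τ y) y‖ * ‖b y‖ := by
        refine Finset.sum_le_sum fun x _ => ?_
        rw [hK]
        refine (norm_sum_le _ _).trans (Finset.sum_le_sum fun y _ => (norm_mul_le _ _))
    _ = ∑ y, (∑ x with x ∉ Ω, ‖K x y - 𝒯.average (K x) (τ y) y‖) * ‖b y‖ := by
        rw [Finset.sum_comm]
        simp only [Finset.sum_mul]
    _ ≤ ∑ y, D * ‖b y‖ := by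
        refine Finset.sum_le_sum fun y _ => ?_
        by_cases hy : y ∈ Ω
        · refine mul_le_mul_of_nonneg_right (le_trans ?_ (hH (τ y) y)) (norm_nonneg _)
          refine Finset.sum_le_sum_of_subset_of_nonneg ?_ fun _ _ _ => norm_nonneg _
          intro x hx
          simp only [Finset.mem_filter, Finset.mem_univ, true_and] at hx ⊢
          exact fun h => hx (h2 y hy h)
        · simp [hb0 y hy]
    _ = D * ∑ y, ‖b y‖ := by rw [Finset.mul_sum]
    _ ≤ D * (2 * ∑ x, ‖f x‖) := by gcongr

/-- The weak type `(1, 1)` inequality for Calderón–Zygmund operators, by the Calderón–Zygmund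
decomposition. -/
theorem Hormander.weak_type {K : Matrix X X ℂ} {A B D : ℝ} (hA : 0 ≤ A) (hB : 1 ≤ B) (hD : 0 ≤ D)
    (hdbl : ∀ n x, ((𝒯.block n x).card : ℝ) ≤ B * (𝒯.block (n + 1) x).card)
    (hL2 : ∀ f : X → ℂ, ∑ x, ‖(K *ᵥ f) x‖ ^ 2 ≤ A * ∑ x, ‖f x‖ ^ 2)
    (hH : 𝒯.Hormander K D) (f : X → ℂ) {c : ℝ} (hc : 0 < c) :
    c * ((Finset.univ.filter fun x => c < ‖(K *ᵥ f) x‖).card : ℝ) ≤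
      (1 + 4 * A * B + 4 * D) * ∑ x, ‖f x‖ := by
  classical
  have hS : 0 ≤ ∑ x, ‖f x‖ := Finset.sum_nonneg fun _ _ => norm_nonneg _
  -- If the average of `|f|` over the whole space exceeds `c`, the trivial bound suffices.
  rcases lt_or_ge (c * Fintype.card X) (∑ x, ‖f x‖) with hlt | hf
  · calc c * ((Finset.univ.filter fun x => c < ‖(K *ᵥ f) x‖).card : ℝ)
        ≤ c * Fintype.card X := by
          gcongr
          exact_mod_cast Finset.card_le_univ _
      _ ≤ 1 * ∑ x, ‖f x‖ := by linarith
      _ ≤ _ := by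
          gcongr
          have : 0 ≤ 4 * A * B := by positivity
          linarith
  -- The good part `g` is bounded by `B * c` and is treated in `L²`; the bad part `b` has vanishing
  -- averages over the stopped blocks.
  obtain ⟨τ, Ω, hτ, hg, h1, h2, hΩ⟩ := exists_stopping hB hdbl f hc hf
  set g : X → ℂ := fun y => 𝒯.average f (τ y) y with hgdef
  set b : X → ℂ := fun y => f y - 𝒯.average f (τ y) y with hbdef
  have hfgb : f = g + b := by ext; simp [hgdef, hbdef]
  set S₁ := Finset.univ.filter fun x => (c / 2) ^ 2 < ‖(K *ᵥ g) x‖ ^ 2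
  set S₂ := (Finset.univ.filter fun x => x ∉ Ω).filter fun x => c / 2 < ‖(K *ᵥ b) x‖
  have hcov : (Finset.univ.filter fun x => c < ‖(K *ᵥ f) x‖) ⊆ Ω ∪ S₁ ∪ S₂ := by
    intro x hx
    simp only [Finset.mem_filter, Finset.mem_univ, true_and] at hx
    simp only [Finset.mem_union, S₁, S₂, Finset.mem_filter, Finset.mem_univ, true_and]
    by_contra hcon
    push Not at hcon
    obtain ⟨⟨h3, h4⟩, h5⟩ := hcon
    have h4' := abs_le_of_sq_le_sq' h4 (by positivity)
    have h6 := norm_add_le ((K *ᵥ g) x) ((K *ᵥ b) x)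
    rw [hfgb, Matrix.mulVec_add, Pi.add_apply] at hx
    linarith [h5 h3, h4'.2]
  have hgsum : ∑ x, ‖g x‖ ^ 2 ≤ B * c * ∑ x, ‖f x‖ := by
    rw [← hτ.sum_average fun x => ‖f x‖, Finset.mul_sum]
    refine Finset.sum_le_sum fun x _ => ?_
    rw [sq]
    exact mul_le_mul (hg x) (norm_average_le _ _) (norm_nonneg _) (by positivity)
  have e1 : (c / 2) ^ 2 * (S₁.card : ℝ) ≤ A * (B * c * ∑ x, ‖f x‖) :=
    (Finset.mul_card_filter_le_sum (fun _ _ => by positivity) _).trans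
      ((hL2 g).trans (mul_le_mul_of_nonneg_left hgsum hA))
  have e2 : (c / 2) * (S₂.card : ℝ) ≤ D * (2 * ∑ x, ‖f x‖) :=
    (Finset.mul_card_filter_le_sum (fun _ _ => by positivity) _).trans
      (hH.sum_mulVec_le hτ h1 h2)
  have e1' : c * (S₁.card : ℝ) ≤ 4 * A * B * ∑ x, ‖f x‖ := by
    have : c * (c * (S₁.card : ℝ)) ≤ c * (4 * A * B * ∑ x, ‖f x‖) := by nlinarith [e1]
    exact le_of_mul_le_mul_left this hc
  have hcard : ((Finset.univ.filter fun x => c < ‖(K *ᵥ f) x‖).card : ℝ) ≤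
      Ω.card + S₁.card + S₂.card := by
    exact_mod_cast (Finset.card_le_card hcov).trans ((Finset.card_union_le _ _).trans
      (Nat.add_le_add_right (Finset.card_union_le _ _) _))
  calc c * ((Finset.univ.filter fun x => c < ‖(K *ᵥ f) x‖).card : ℝ)
      ≤ c * (Ω.card + S₁.card + S₂.card) := by gcongr
    _ ≤ _ := by nlinarith [e1', e2, hΩ]

end BlockTree

/-! ### Marcinkiewicz interpolation and duality -/

/-- Layer-cake integral of a power below a threshold. -/
lemma integral_ite_lt_rpow {a s : ℝ} (ha : 0 ≤ a) (hs : -1 < s) :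
    IntegrableOn (fun c : ℝ => if c < a then c ^ s else 0) (Set.Ioi 0) ∧
      ∫ c in Set.Ioi (0 : ℝ), (if c < a then c ^ s else 0) = a ^ (s + 1) / (s + 1) := by
  have h1 : (fun c : ℝ => if c < a then c ^ s else 0) = (Set.Iio a).indicator fun c => c ^ s := by
    ext c; simp [Set.indicator_apply]
  have h2 : IntegrableOn (fun c : ℝ => c ^ s) (Set.Ioo 0 a) :=
    (intervalIntegrable_iff_integrableOn_Ioo_of_le ha).1
      (intervalIntegral.intervalIntegrable_rpow' hs)
  have h3 : Set.Iio a ∩ Set.Ioi (0 : ℝ) = Set.Ioo 0 a := by ext; simp [and_comm]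
  rw [h1]
  constructor
  · rw [IntegrableOn, integrable_indicator_iff measurableSet_Iio, IntegrableOn,
      Measure.restrict_restrict measurableSet_Iio, h3]
    exact h2
  · rw [integral_indicator measurableSet_Iio, Measure.restrict_restrict measurableSet_Iio, h3,
      ← integral_Ioc_eq_integral_Ioo, ← intervalIntegral.integral_of_le ha,
      integral_rpow (Or.inl hs), Real.zero_rpow (by linarith), sub_zero]

/-- Layer-cake integral of a power above a threshold. -/
lemma integral_ite_le_rpow {a p : ℝ} (ha : 0 ≤ a) (hp0 : 0 < p) (hp : p < 2) :
    IntegrableOn (fun c : ℝ => if c < a then 0 else a ^ 2 * c ^ (p - 3)) (Set.Ioi 0) ∧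
      ∫ c in Set.Ioi (0 : ℝ), (if c < a then 0 else a ^ 2 * c ^ (p - 3)) = a ^ p / (2 - p) := by
  rcases ha.eq_or_lt with rfl | ha
  · simp [Real.zero_rpow hp0.ne']
  have h1 : (fun c : ℝ => if c < a then 0 else a ^ 2 * c ^ (p - 3)) =
      (Set.Ici a).indicator fun c => a ^ 2 * c ^ (p - 3) := by
    ext c
    by_cases h : c < a
    · simp [h]
    · simp [h, not_lt.1 h]
  have h3 : Set.Ici a ∩ Set.Ioi (0 : ℝ) = Set.Ici a := by
    ext x; simp only [Set.mem_inter_iff, Set.mem_Ici, Set.mem_Ioi, and_iff_left_iff_imp]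
    exact fun h => ha.trans_le h
  have h2 : IntegrableOn (fun c : ℝ => c ^ (p - 3)) (Set.Ioi a) :=
    integrableOn_Ioi_rpow_of_lt (by linarith) ha
  rw [h1]
  constructor
  · rw [IntegrableOn, integrable_indicator_iff measurableSet_Ici, IntegrableOn,
      Measure.restrict_restrict measurableSet_Ici, h3]
    exact ((integrableOn_Ici_iff_integrableOn_Ioi).2 h2).const_mul _
  · rw [integral_indicator measurableSet_Ici, Measure.restrict_restrict measurableSet_Ici, h3,
      integral_Ici_eq_integral_Ioi, integral_const_mul, integral_Ioi_rpow_of_lt (by linarith) ha]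
    have e : a ^ p = a ^ 2 * a ^ (p - 3 + 1) := by
      rw [← Real.rpow_natCast, ← Real.rpow_add ha]; congr 1; push_cast; ring
    have : p - 3 + 1 = -(2 - p) := by ring
    rw [e, this]
    have : (2 - p) ≠ 0 := by linarith
    field_simp

/-- Marcinkiewicz interpolation between weak type `(1, 1)` and strong type `(2, 2)`. -/
theorem sum_mulVec_rpow_le_of_weak_type {X : Type*} [Fintype X] {K : Matrix X X ℂ} {A W p : ℝ}
    (hp1 : 1 < p) (hp2 : p < 2)
    (hL2 : ∀ f : X → ℂ, ∑ x, ‖(K *ᵥ f) x‖ ^ 2 ≤ A * ∑ x, ‖f x‖ ^ 2)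
    (hW : ∀ (f : X → ℂ) (c : ℝ), 0 < c →
      c * ((Finset.univ.filter fun x => c < ‖(K *ᵥ f) x‖).card : ℝ) ≤ W * ∑ x, ‖f x‖)
    (f : X → ℂ) :
    ∑ x, ‖(K *ᵥ f) x‖ ^ p ≤ p * (2 * W / (p - 1) + 4 * A / (2 - p)) * ∑ x, ‖f x‖ ^ p := by
  classical
  -- `F` integrates to `‖K f‖_p ^ p / p`. Splitting `f` at the height `c` bounds the distribution
  -- function of `K f` at `c` by the weak type inequality for the large part `f₁` and by Chebyshev's
  -- inequality for the small part `f₂`; these contributions integrate to multiples of `‖f‖_p ^ p`.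
  set F : ℝ → ℝ := fun c => ∑ x, (if c < ‖(K *ᵥ f) x‖ then c ^ (p - 1) else 0)
  set F₁ : ℝ → ℝ := fun c => ∑ x, ‖f x‖ * (if c < ‖f x‖ then c ^ (p - 2) else 0)
  set F₂ : ℝ → ℝ := fun c => ∑ x, (if c < ‖f x‖ then 0 else ‖f x‖ ^ 2 * c ^ (p - 3))
  have hFF : ∀ c ∈ Set.Ioi (0 : ℝ), F c ≤ 2 * W * F₁ c + 4 * A * F₂ c := by
    intro c hc
    have hc : 0 < c := hc
    set f₁ : X → ℂ := fun x => if c < ‖f x‖ then f x else 0 with hf₁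
    set f₂ : X → ℂ := fun x => if c < ‖f x‖ then 0 else f x with hf₂
    have hf : f = f₁ + f₂ := by
      ext x; by_cases h : c < ‖f x‖ <;> simp [hf₁, hf₂, h]
    have hcov : (Finset.univ.filter fun x => c < ‖(K *ᵥ f) x‖) ⊆
        (Finset.univ.filter fun x => c / 2 < ‖(K *ᵥ f₁) x‖) ∪
          (Finset.univ.filter fun x => (c / 2) ^ 2 < ‖(K *ᵥ f₂) x‖ ^ 2) := by
      intro x hx
      simp only [Finset.mem_filter, Finset.mem_univ, true_and, Finset.mem_union] at hx ⊢
      by_contra hcon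
      push Not at hcon
      have h4 := (abs_le_of_sq_le_sq' hcon.2 (by positivity)).2
      have h6 := norm_add_le ((K *ᵥ f₁) x) ((K *ᵥ f₂) x)
      rw [hf, Matrix.mulVec_add, Pi.add_apply] at hx
      linarith [hcon.1]
    have hcard : ((Finset.univ.filter fun x => c < ‖(K *ᵥ f) x‖).card : ℝ) ≤
        (Finset.univ.filter fun x => c / 2 < ‖(K *ᵥ f₁) x‖).card +
          (Finset.univ.filter fun x => (c / 2) ^ 2 < ‖(K *ᵥ f₂) x‖ ^ 2).card := by
      exact_mod_cast (Finset.card_le_card hcov).trans (Finset.card_union_le _ _)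
    have e1 := hW f₁ (c / 2) (by positivity)
    have e2 := (Finset.mul_card_filter_le_sum (s := Finset.univ)
      (F := fun x => ‖(K *ᵥ f₂) x‖ ^ 2) (fun _ _ => by positivity) ((c / 2) ^ 2)).trans (hL2 f₂)
    have hF : F c = c ^ (p - 1) *
        ((Finset.univ.filter fun x => c < ‖(K *ᵥ f) x‖).card : ℝ) := by
      simp [F, Finset.sum_ite, mul_comm]
    have hF1 : F₁ c = c ^ (p - 2) * ∑ x, ‖f₁ x‖ := by
      simp only [F₁, Finset.mul_sum]
      refine Finset.sum_congr rfl fun x _ => ?_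
      by_cases h : c < ‖f x‖ <;> simp [hf₁, h, mul_comm]
    have hF2 : F₂ c = c ^ (p - 3) * ∑ x, ‖f₂ x‖ ^ 2 := by
      simp only [F₂, Finset.mul_sum]
      refine Finset.sum_congr rfl fun x _ => ?_
      by_cases h : c < ‖f x‖ <;> simp [hf₂, h, mul_comm]
    have p1 : c ^ (p - 1) = c ^ (p - 2) * c := by
      rw [← Real.rpow_add_one hc.ne']; congr 1; ring
    have p2 : c ^ (p - 1) = c ^ (p - 3) * c ^ 2 := by
      rw [← Real.rpow_natCast, ← Real.rpow_add hc]; congr 1; push_cast; ring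
    have hp3 : 0 ≤ c ^ (p - 3) := by positivity
    have hp2' : 0 ≤ c ^ (p - 2) := by positivity
    rw [hF, hF1, hF2]
    set N₁ : ℝ := ((Finset.univ.filter fun x => c / 2 < ‖(K *ᵥ f₁) x‖).card : ℝ)
    set N₂ : ℝ := ((Finset.univ.filter fun x => (c / 2) ^ 2 < ‖(K *ᵥ f₂) x‖ ^ 2).card : ℝ)
    calc _ ≤ c ^ (p - 1) * (N₁ + N₂) := by gcongr
      _ = c ^ (p - 2) * (2 * (c / 2 * N₁)) + c ^ (p - 3) * (4 * ((c / 2) ^ 2 * N₂)) := by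
        rw [mul_add]; congr 1
        · rw [p1]; ring
        · rw [p2]; ring
      _ ≤ c ^ (p - 2) * (2 * (W * ∑ x, ‖f₁ x‖)) + c ^ (p - 3) * (4 * (A * ∑ x, ‖f₂ x‖ ^ 2)) := by
        gcongr
      _ = _ := by ring
  have iF : IntegrableOn F (Set.Ioi 0) := integrable_finsetSum _ fun x _ =>
    (integral_ite_lt_rpow (norm_nonneg _) (by linarith)).1
  have iF1 : IntegrableOn F₁ (Set.Ioi 0) := integrable_finsetSum _ fun x _ =>
    (integral_ite_lt_rpow (norm_nonneg _) (by linarith)).1.const_mul _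
  have iF2 : IntegrableOn F₂ (Set.Ioi 0) := integrable_finsetSum _ fun x _ =>
    (integral_ite_le_rpow (norm_nonneg _) (by linarith) hp2).1
  have vF : ∫ c in Set.Ioi 0, F c = ∑ x, ‖(K *ᵥ f) x‖ ^ p / p := by
    rw [integral_finsetSum _ fun x _ =>
      (integral_ite_lt_rpow (norm_nonneg _) (by linarith)).1]
    refine Finset.sum_congr rfl fun x _ => ?_
    rw [(integral_ite_lt_rpow (norm_nonneg _) (by linarith)).2, sub_add_cancel]
  have vF1 : ∫ c in Set.Ioi 0, F₁ c = ∑ x, ‖f x‖ ^ p / (p - 1) := by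
    rw [integral_finsetSum _ fun x _ =>
      (integral_ite_lt_rpow (norm_nonneg _) (by linarith)).1.const_mul _]
    refine Finset.sum_congr rfl fun x _ => ?_
    rw [integral_const_mul, (integral_ite_lt_rpow (norm_nonneg _) (by linarith)).2,
      show p - 2 + 1 = p - 1 by ring]
    rcases (norm_nonneg (f x)).eq_or_lt with h | h
    · rw [← h, Real.zero_rpow (by linarith : p ≠ 0)]; simp
    · rw [← mul_div_assoc, mul_comm, ← Real.rpow_add_one h.ne', sub_add_cancel]
  have vF2 : ∫ c in Set.Ioi 0, F₂ c = ∑ x, ‖f x‖ ^ p / (2 - p) := by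
    rw [integral_finsetSum _ fun x _ =>
      (integral_ite_le_rpow (norm_nonneg _) (by linarith) hp2).1]
    refine Finset.sum_congr rfl fun x _ => ?_
    rw [(integral_ite_le_rpow (norm_nonneg _) (by linarith) hp2).2]
  have key := setIntegral_mono_on iF ((iF1.const_mul (2 * W)).add (iF2.const_mul (4 * A)))
    measurableSet_Ioi hFF
  simp only [Pi.add_apply] at key
  rw [integral_add (iF1.const_mul (2 * W)) (iF2.const_mul (4 * A)), integral_const_mul,
    integral_const_mul, vF, vF1, vF2, ← Finset.sum_div, ← Finset.sum_div, ← Finset.sum_div,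
    div_le_iff₀ (by linarith)] at key
  refine key.trans_eq ?_
  ring

/-- Duality: a strong type inequality for `K` with exponent `q` gives one for the transpose with the
conjugate exponent `p`. -/
theorem sum_transpose_mulVec_rpow_le {X : Type*} [Fintype X] {K : Matrix X X ℂ} {p q C : ℝ}
    (hpq : p.HolderConjugate q) (hC : 0 ≤ C)
    (hK : ∀ h : X → ℂ, ∑ x, ‖(K *ᵥ h) x‖ ^ q ≤ C * ∑ x, ‖h x‖ ^ q) (f : X → ℂ) :
    ∑ x, ‖(Kᵀ *ᵥ f) x‖ ^ p ≤ C ^ (p / q) * ∑ x, ‖f x‖ ^ p := by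
  have hp := hpq.pos
  have hq := hpq.symm.pos
  set u := Kᵀ *ᵥ f with hu
  set S := ∑ x, ‖u x‖ ^ p with hS
  set F := ∑ x, ‖f x‖ ^ p with hF
  have hS0 : 0 ≤ S := Finset.sum_nonneg fun _ _ => by positivity
  have hF0 : 0 ≤ F := Finset.sum_nonneg fun _ _ => by positivity
  -- The function `h` is extremal in Hölder's inequality for `u`. Where `u x = 0`, the factor
  -- `star (u x)` vanishes, so the value of `0 ^ (p - 2)` is irrelevant.
  set h : X → ℂ := fun x => star (u x) * ((‖u x‖ ^ (p - 2) : ℝ) : ℂ) with hh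
  have hne : ∀ x, ‖u x‖ ≠ 0 → 0 < ‖u x‖ := fun x hx => lt_of_le_of_ne (norm_nonneg _) hx.symm
  have huh : ∀ x, u x * h x = ((‖u x‖ ^ p : ℝ) : ℂ) := by
    intro x
    by_cases hx : u x = 0
    · simp [hx, Real.zero_rpow hp.ne']
    · have h0 := hne x (norm_ne_zero_iff.2 hx)
      have : u x * star (u x) = ((‖u x‖ ^ 2 : ℝ) : ℂ) := by
        rw [← starRingEnd_apply, Complex.mul_conj']; norm_cast
      rw [hh]
      dsimp only
      rw [← mul_assoc, this, ← Complex.ofReal_mul, ← Real.rpow_natCast, ← Real.rpow_add h0]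
      congr 2; push_cast; ring
  have hhq : ∀ x, ‖h x‖ ^ q = ‖u x‖ ^ p := by
    intro x
    by_cases hx : u x = 0
    · simp [hh, hx, Real.zero_rpow hp.ne', Real.zero_rpow hq.ne']
    · have h0 := hne x (norm_ne_zero_iff.2 hx)
      have h1 : ‖h x‖ = ‖u x‖ ^ (p - 1) := by
        rw [hh]
        dsimp only
        rw [norm_mul, norm_star, Complex.norm_real, Real.norm_of_nonneg (by positivity),
          mul_comm, ← Real.rpow_add_one h0.ne']
        congr 1; ring
      rw [h1, ← Real.rpow_mul h0.le, hpq.sub_one_mul_conj]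
  have hpair : ∑ x, u x * h x = ∑ x, f x * (K *ᵥ h) x := by
    have := Matrix.dotProduct_mulVec f K h
    rw [← Matrix.mulVec_transpose] at this
    exact this.symm
  have h1 : S ≤ F ^ (1 / p) * (C * S) ^ (1 / q) := by
    calc S = ‖∑ x, u x * h x‖ := by
          simp_rw [huh]
          rw [← Complex.ofReal_sum, Complex.norm_real, Real.norm_of_nonneg hS0]
      _ ≤ ∑ x, ‖f x‖ * ‖(K *ᵥ h) x‖ := by
          rw [hpair]
          exact (norm_sum_le _ _).trans_eq (by simp)
      _ ≤ F ^ (1 / p) * (∑ x, ‖(K *ᵥ h) x‖ ^ q) ^ (1 / q) :=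
          Real.inner_le_Lp_mul_Lq_of_nonneg _ hpq (fun _ _ => norm_nonneg _)
            fun _ _ => norm_nonneg _
      _ ≤ F ^ (1 / p) * (C * S) ^ (1 / q) := by
          have := hK h
          simp_rw [hhq] at this
          gcongr
  rcases hS0.eq_or_lt with h0 | h0
  · rw [← h0]; positivity
  have h2 : S ^ (1 / p) ≤ F ^ (1 / p) * C ^ (1 / q) := by
    have e : S = S ^ (1 / p) * S ^ (1 / q) := by
      rw [← Real.rpow_add h0]
      have := hpq.inv_add_inv_eq_one
      rw [one_div, one_div, this, Real.rpow_one]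
    rw [Real.mul_rpow hC hS0, ← mul_assoc] at h1
    nth_rewrite 1 [e] at h1
    exact le_of_mul_le_mul_right h1 (by positivity)
  have h3 := Real.rpow_le_rpow (by positivity) h2 hp.le
  rw [← Real.rpow_mul hS0, Real.mul_rpow (by positivity) (by positivity), ← Real.rpow_mul hF0,
    ← Real.rpow_mul hC, one_div_mul_cancel hp.ne', Real.rpow_one, Real.rpow_one] at h3
  calc S ≤ _ := h3
    _ = _ := by rw [mul_comm]; congr 2; field_simp

universe v

/-- Calderón–Zygmund theorem on finite block trees: an `L²`-bounded kernel satisfying Hörmander's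
condition in both variables is bounded on `L^p` for `1 < p < ∞`, with a constant depending only on
`p` and the constants in the hypotheses. -/
theorem BlockTree.exists_sum_mulVec_rpow_le {A B D p : ℝ} (hA : 0 ≤ A) (hB : 1 ≤ B) (hD : 0 ≤ D)
    (hp : 1 < p) :
    ∃ C : ℝ, 0 ≤ C ∧ ∀ {X : Type v} [Fintype X] (𝒯 : BlockTree X) (K : Matrix X X ℂ),
      (∀ n x, ((𝒯.block n x).card : ℝ) ≤ B * (𝒯.block (n + 1) x).card) →
      (∀ f : X → ℂ, ∑ x, ‖(K *ᵥ f) x‖ ^ 2 ≤ A * ∑ x, ‖f x‖ ^ 2) →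
      𝒯.Hormander K D → 𝒯.Hormander Kᵀ D →
      ∀ f : X → ℂ, ∑ x, ‖(K *ᵥ f) x‖ ^ p ≤ C * ∑ x, ‖f x‖ ^ p := by
  set W : ℝ := 1 + 4 * A * B + 4 * D
  have hW : 0 ≤ W := by positivity
  rcases lt_trichotomy p 2 with h2 | rfl | h2
  · have : 0 < p - 1 := by linarith
    have : 0 < 2 - p := by linarith
    refine ⟨p * (2 * W / (p - 1) + 4 * A / (2 - p)), by positivity, ?_⟩
    intro X _ 𝒯 K hdbl hL2 hH _ f
    exact sum_mulVec_rpow_le_of_weak_type hp h2 hL2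
      (fun f c hc => hH.weak_type hA hB hD hdbl hL2 f hc) f
  · refine ⟨A, hA, ?_⟩
    intro X _ 𝒯 K _ hL2 _ _ f
    simpa using hL2 f
  · set q := p.conjExponent with hqdef
    have hpq : p.HolderConjugate q := Real.HolderConjugate.conjExponent hp
    have hq1 : 1 < q := hpq.symm.lt
    have hq2 : q < 2 := by
      have := hpq.inv_add_inv_eq_one
      by_contra hcon
      push Not at hcon
      have i1 : p⁻¹ < 2⁻¹ := by gcongr
      have i2 : q⁻¹ ≤ 2⁻¹ := by gcongr
      linarith
    have : 0 < q - 1 := by linarith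
    have : 0 < 2 - q := by linarith
    have hC : 0 ≤ q * (2 * W / (q - 1) + 4 * A / (2 - q)) := by positivity
    refine ⟨(q * (2 * W / (q - 1) + 4 * A / (2 - q))) ^ (p / q), by positivity, ?_⟩
    intro X _ 𝒯 K hdbl hL2 _ hH f
    have hL2' : ∀ f : X → ℂ, ∑ x, ‖(Kᵀ *ᵥ f) x‖ ^ 2 ≤ A * ∑ x, ‖f x‖ ^ 2 := by
      intro f
      have h22 : (2 : ℝ).HolderConjugate 2 := Real.HolderConjugate.two_two
      have := sum_transpose_mulVec_rpow_le h22 hA (K := K) (by simpa using hL2) f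
      simpa using this
    have := sum_transpose_mulVec_rpow_le hpq hC (K := Kᵀ)
      (sum_mulVec_rpow_le_of_weak_type hq1 hq2 hL2'
        (fun f c hc => hH.weak_type hA hB hD hdbl hL2' f hc)) f
    simpa using this

/-! ### Normal chains in finite groups and convolution kernels -/

/-- A finite chain of normal subgroups `Q = N_0 ⊋ N_1 ⊋ ⋯ ⊋ N_k = 1` of a finite group, the finite
model of the filtration of a compact Vilenkin group. -/
structure NormalChain (Q : Type*) [Group Q] where
  /-- The subgroups `N_n`. -/
  subgroup : ℕ → Subgroup Q
  /-- The length `k` of the chain. -/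
  depth : ℕ
  normal : ∀ n, (subgroup n).Normal
  antitone : Antitone subgroup
  zero_eq_top : subgroup 0 = ⊤
  depth_eq_bot : subgroup depth = ⊥
  two_mul_index_le : ∀ n < depth, 2 * (subgroup n).index ≤ (subgroup (n + 1)).index

namespace NormalChain

variable {Q : Type*} [Group Q] [Fintype Q] (𝒩 : NormalChain Q)

/-- The normalized measure of `N_n`. -/
noncomputable def vol (n : ℕ) : ℝ := ((𝒩.subgroup n).index : ℝ)⁻¹

open Classical in
/-- The largest `n ≤ k` with `x ∈ N_n`, where `k` is the length of the chain. It equals `k` exactly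
at the identity. -/
noncomputable def level (x : Q) : ℕ := Nat.findGreatest (fun n => x ∈ 𝒩.subgroup n) 𝒩.depth

open Classical in
/-- The partitions into cosets of the subgroups `N_n`. -/
noncomputable def tree : BlockTree Q where
  block n x := Finset.univ.filter fun y => x⁻¹ * y ∈ 𝒩.subgroup n
  depth := 𝒩.depth
  mem_block n x := by simp
  block_eq {n x y} h := by
    ext z
    simp only [Finset.mem_filter, Finset.mem_univ, true_and] at h ⊢
    constructor
    · intro hz
      simpa [mul_assoc] using mul_mem h hz
    · intro hz
      simpa [mul_assoc] using mul_mem (inv_mem h) hz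
  block_succ_subset n x y := by
    simp only [Finset.mem_filter, Finset.mem_univ, true_and]
    exact fun h => 𝒩.antitone n.le_succ h
  block_zero x := by simp [𝒩.zero_eq_top]
  block_depth x := by
    ext y
    simp [𝒩.depth_eq_bot, inv_mul_eq_one, eq_comm]

variable {𝒩}

lemma mem_block {n : ℕ} {x y : Q} : y ∈ 𝒩.tree.block n x ↔ x⁻¹ * y ∈ 𝒩.subgroup n := by
  simp [tree]

lemma mem_block_one {n : ℕ} {y : Q} : y ∈ 𝒩.tree.block n 1 ↔ y ∈ 𝒩.subgroup n := by
  simp [tree]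

lemma sum_block {E : Type*} [AddCommMonoid E] (f : Q → E) (n : ℕ) (x : Q) :
    ∑ y ∈ 𝒩.tree.block n x, f y = ∑ h ∈ 𝒩.tree.block n 1, f (x * h) := by
  refine Finset.sum_nbij' (fun y => x⁻¹ * y) (fun h => x * h) ?_ ?_ ?_ ?_ ?_ <;>
    simp [mem_block]

lemma sum_block_inv {E : Type*} [AddCommMonoid E] (f : Q → E) (n : ℕ) :
    ∑ h ∈ 𝒩.tree.block n 1, f h⁻¹ = ∑ h ∈ 𝒩.tree.block n 1, f h := by
  refine Finset.sum_nbij' (fun y => y⁻¹) (fun h => h⁻¹) ?_ ?_ ?_ ?_ ?_ <;>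
    simp [mem_block]

/-- Left and right cosets of a normal subgroup agree. -/
lemma sum_block_left {E : Type*} [AddCommMonoid E] (f : Q → E) (n : ℕ) (x : Q) :
    ∑ y ∈ 𝒩.tree.block n x, f y = ∑ h ∈ 𝒩.tree.block n 1, f (h * x) := by
  have hn := 𝒩.normal n
  refine Finset.sum_nbij' (fun y => y * x⁻¹) (fun h => h * x) ?_ ?_ ?_ ?_ ?_ <;>
    simp only [mem_block, inv_one, one_mul, inv_mul_cancel_right, mul_inv_cancel_right,
      implies_true]
  · exact fun y hy => hn.mem_comm hy
  · intro y hy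
    rw [← mul_assoc]
    simpa using hn.conj_mem y hy x⁻¹

lemma card_block (n : ℕ) (x : Q) :
    ((𝒩.tree.block n x).card : ℝ) = Fintype.card Q * 𝒩.vol n := by
  have h1 : (𝒩.tree.block n x).card = (𝒩.tree.block n 1).card := by
    have := sum_block (𝒩 := 𝒩) (fun _ => 1) n x
    simpa using this
  have h2 : (𝒩.tree.block n 1).card = Nat.card (𝒩.subgroup n) := by
    classical
    rw [Nat.card_eq_fintype_card, Fintype.card_subtype]
    congr 1; ext; simp [mem_block_one]
  have h3 := (𝒩.subgroup n).card_mul_index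
  have h4 : ((𝒩.subgroup n).index : ℝ) ≠ 0 := by
    exact_mod_cast (𝒩.subgroup n).index_ne_zero_of_finite
  rw [h1, h2, vol, ← Nat.card_eq_fintype_card, ← h3]
  push_cast
  field_simp

lemma vol_pos (n : ℕ) : 0 < 𝒩.vol n := by
  have : (𝒩.subgroup n).index ≠ 0 := (𝒩.subgroup n).index_ne_zero_of_finite
  unfold vol
  positivity

lemma vol_le_mul_pow {m n : ℕ} (hnm : n ≤ m) (hm : m ≤ 𝒩.depth) :
    𝒩.vol m ≤ 𝒩.vol n * (1 / 2) ^ (m - n) := by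
  induction m, hnm using Nat.le_induction with
  | base => simp
  | succ m hnm ih =>
    have h := 𝒩.two_mul_index_le m hm
    have ih := ih (by omega)
    have h1 : (0 : ℝ) < (𝒩.subgroup m).index := by
      exact_mod_cast Nat.pos_of_ne_zero (𝒩.subgroup m).index_ne_zero_of_finite
    have h2 : 𝒩.vol (m + 1) ≤ 𝒩.vol m * (1 / 2) := by
      have e : ((𝒩.subgroup m).index : ℝ)⁻¹ * (1 / 2) =
          (2 * ((𝒩.subgroup m).index : ℝ))⁻¹ := by rw [mul_inv]; ring
      unfold vol
      rw [e]
      exact inv_anti₀ (by positivity) (by exact_mod_cast h)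
    rw [Nat.sub_add_comm hnm, pow_succ]
    nlinarith

lemma vol_antitone {m n : ℕ} (hnm : n ≤ m) (hm : m ≤ 𝒩.depth) : 𝒩.vol m ≤ 𝒩.vol n := by
  refine (vol_le_mul_pow hnm hm).trans ?_
  have : ((1 : ℝ) / 2) ^ (m - n) ≤ 1 := pow_le_one₀ (by norm_num) (by norm_num)
  have := 𝒩.vol_pos n
  nlinarith

omit [Fintype Q] in
lemma level_le (x : Q) : 𝒩.level x ≤ 𝒩.depth := by
  classical exact Nat.findGreatest_le (P := fun n => x ∈ 𝒩.subgroup n) 𝒩.depth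

omit [Fintype Q] in
lemma mem_subgroup_iff {m : ℕ} (hm : m ≤ 𝒩.depth) {x : Q} :
    x ∈ 𝒩.subgroup m ↔ m ≤ 𝒩.level x := by
  classical
  constructor
  · intro h
    exact Nat.le_findGreatest (P := fun n => x ∈ 𝒩.subgroup n) hm h
  · intro h
    refine 𝒩.antitone h ?_
    have h0 : x ∈ 𝒩.subgroup 0 := by simp [𝒩.zero_eq_top]
    exact Nat.findGreatest_spec (P := fun n => x ∈ 𝒩.subgroup n) (Nat.zero_le 𝒩.depth) h0

omit [Fintype Q] in
lemma mem_subgroup_level (x : Q) : x ∈ 𝒩.subgroup (𝒩.level x) :=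
  (mem_subgroup_iff (level_le x)).2 le_rfl

omit [Fintype Q] in
lemma level_inv (x : Q) : 𝒩.level x⁻¹ = 𝒩.level x := by
  refine le_antisymm ?_ ?_
  · exact (mem_subgroup_iff (level_le _)).1 (by simpa using mem_subgroup_level (𝒩 := 𝒩) x⁻¹)
  · exact (mem_subgroup_iff (level_le _)).1 (by simpa using mem_subgroup_level (𝒩 := 𝒩) x)

omit [Fintype Q] in
/-- The ultrametric property. -/
lemma level_mul_of_lt {x y : Q} (h : 𝒩.level x < 𝒩.level y) : 𝒩.level (x * y) = 𝒩.level x := by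
  refine le_antisymm ?_ ?_
  · by_contra hcon
    push Not at hcon
    have hd : 𝒩.level x + 1 ≤ 𝒩.depth := h.trans_le (level_le y)
    have h1 := (mem_subgroup_iff hd).2 hcon
    have h2 := (mem_subgroup_iff hd).2 h
    have h3 := (mem_subgroup_iff hd).1 ((Subgroup.mul_mem_cancel_right _ h2).1 h1)
    omega
  · refine (mem_subgroup_iff (level_le x)).1 (mul_mem (mem_subgroup_level x) ?_)
    exact (mem_subgroup_iff (level_le x)).2 h.le

omit [Fintype Q] in
lemma level_mul_of_gt {x y : Q} (h : 𝒩.level y < 𝒩.level x) : 𝒩.level (x * y) = 𝒩.level y := by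
  rw [← level_inv, mul_inv_rev, level_mul_of_lt (by simpa [level_inv] using h), level_inv]

/-- The normalized sum of `ρ` over a finite set of group elements. -/
noncomputable def mean (s : Finset Q) (ρ : Q → ℝ) : ℝ := (Fintype.card Q : ℝ)⁻¹ * ∑ z ∈ s, ρ z

lemma card_pos : (0 : ℝ) < Fintype.card Q := by exact_mod_cast Fintype.card_pos

/-- The shell of elements of level `n`; for `n < k` it is `N_n \ N_{n+1}`. -/
noncomputable def shell (𝒩 : NormalChain Q) (n : ℕ) : Finset Q :=
  Finset.univ.filter fun x => 𝒩.level x = n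

lemma mem_shell {n : ℕ} {x : Q} : x ∈ 𝒩.shell n ↔ 𝒩.level x = n := by simp [shell]

lemma mean_mono {s t : Finset Q} {ρ : Q → ℝ} (h : s ⊆ t) (hρ : ∀ z, 0 ≤ ρ z) :
    mean s ρ ≤ mean t ρ := by
  unfold mean
  have := Finset.sum_le_sum_of_subset_of_nonneg h fun z _ _ => hρ z
  gcongr

/-- The normalized measure of a set contained in `N_n`. -/
lemma mean_one_le {n : ℕ} {s : Finset Q} (h : ∀ z ∈ s, z ∈ 𝒩.subgroup n) :
    mean s (fun _ => 1) ≤ 𝒩.vol n := by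
  have h1 : s ⊆ 𝒩.tree.block n 1 := fun z hz => mem_block_one.2 (h z hz)
  have h2 : (s.card : ℝ) ≤ (𝒩.tree.block n 1).card := by exact_mod_cast Finset.card_le_card h1
  rw [card_block] at h2
  have := card_pos (Q := Q)
  unfold mean
  rw [inv_mul_le_iff₀ this]
  simpa using h2

/-- Hölder's inequality for a normalized sum; the first factor is the normalized measure of the
set. -/
lemma mean_le_rpow_mul {t : ℝ} (ht : 1 < t) (s : Finset Q) {ρ : Q → ℝ} (hρ : ∀ z, 0 ≤ ρ z) :
    mean s ρ ≤ mean s (fun _ => 1) ^ (1 - 1 / t) * mean s (fun z => ρ z ^ t) ^ (1 / t) := by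
  have hM := card_pos (Q := Q)
  have hpq : t.HolderConjugate t.conjExponent := Real.HolderConjugate.conjExponent ht
  have hq : 1 - 1 / t = 1 / t.conjExponent := by
    have := hpq.inv_add_inv_eq_one
    rw [one_div, one_div]; linarith
  have h := Real.inner_le_Lp_mul_Lq_of_nonneg s hpq (f := ρ) (g := fun _ => 1)
    (fun _ _ => hρ _) fun _ _ => zero_le_one
  simp only [mul_one, Real.one_rpow] at h
  have hs1 : (0 : ℝ) ≤ ∑ i ∈ s, (1 : ℝ) := Finset.sum_nonneg fun _ _ => zero_le_one
  have hs2 : 0 ≤ ∑ i ∈ s, ρ i ^ t := Finset.sum_nonneg fun _ _ => Real.rpow_nonneg (hρ _) _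
  unfold mean
  rw [Real.mul_rpow (by positivity) hs1, Real.mul_rpow (by positivity) hs2]
  have e : (Fintype.card Q : ℝ)⁻¹ =
      (Fintype.card Q : ℝ)⁻¹ ^ (1 - 1 / t) * (Fintype.card Q : ℝ)⁻¹ ^ (1 / t) := by
    rw [← Real.rpow_add (by positivity), sub_add_cancel, Real.rpow_one]
  calc _ ≤ (Fintype.card Q : ℝ)⁻¹ * _ := mul_le_mul_of_nonneg_left h (by positivity)
    _ = _ := by nth_rewrite 1 [e]; rw [hq]; ring

/-- The mean distance of `r` to its averages over cosets of `N_l` is controlled by the mean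
differences of `r` and its translates by elements of `N_l`. -/
lemma mean_sub_average_le {r : Q → ℂ} {l : ℕ} {s : Finset Q} {D : ℝ}
    (h : ∀ y ∈ 𝒩.subgroup l, mean s (fun z => ‖r (z * y⁻¹) - r z‖) ≤ D) :
    mean s (fun z => ‖r z - 𝒩.tree.average r l z‖) ≤ D := by
  have hM := card_pos (Q := Q)
  set N := 𝒩.tree.block l 1 with hN
  have hc : (0 : ℝ) < N.card := 𝒩.tree.card_block_pos l 1
  have hcz : ∀ z, ((𝒩.tree.block l z).card : ℝ) = N.card := fun z => by
    rw [hN, card_block, card_block]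
  have h1 : ∀ z, ‖r z - 𝒩.tree.average r l z‖ ≤
      (N.card : ℝ)⁻¹ * ∑ y ∈ N, ‖r (z * y⁻¹) - r z‖ := by
    intro z
    have e : r z - 𝒩.tree.average r l z = -((N.card : ℝ)⁻¹ • ∑ y ∈ N, (r (z * y⁻¹) - r z)) := by
      rw [BlockTree.average, hcz, sum_block, ← sum_block_inv (fun y => r (z * y)),
        Finset.sum_sub_distrib, Finset.sum_const, smul_sub, ← Nat.cast_smul_eq_nsmul ℝ, smul_smul,
        inv_mul_cancel₀ hc.ne', one_smul, neg_sub]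
    rw [e, norm_neg, norm_smul, norm_inv, Real.norm_natCast]
    gcongr
    exact norm_sum_le _ _
  calc mean s (fun z => ‖r z - 𝒩.tree.average r l z‖)
      ≤ mean s (fun z => (N.card : ℝ)⁻¹ * ∑ y ∈ N, ‖r (z * y⁻¹) - r z‖) := by
        unfold mean; gcongr with z; exact h1 z
    _ = (N.card : ℝ)⁻¹ * ∑ y ∈ N, mean s (fun z => ‖r (z * y⁻¹) - r z‖) := by
        unfold mean
        rw [← Finset.mul_sum, ← Finset.mul_sum, Finset.sum_comm]; ring
    _ ≤ (N.card : ℝ)⁻¹ * ∑ y ∈ N, D := by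
        gcongr with y hy
        exact h y (mem_block_one.1 hy)
    _ = D := by rw [Finset.sum_const, nsmul_eq_mul]; field_simp

/-- The matrix of the convolution operator `f ↦ f * r` for the normalized counting measure. -/
noncomputable def convMatrix (r : Q → ℂ) : Matrix Q Q ℂ :=
  Matrix.of fun x y => (Fintype.card Q : ℂ)⁻¹ * r (y⁻¹ * x)

lemma convMatrix_apply (r : Q → ℂ) (x y : Q) :
    convMatrix r x y = (Fintype.card Q : ℂ)⁻¹ * r (y⁻¹ * x) := rfl

lemma average_const_mul (c : ℂ) (f : Q → ℂ) (n : ℕ) (x : Q) :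
    𝒩.tree.average (fun y => c * f y) n x = c * 𝒩.tree.average f n x := by
  simp only [BlockTree.average, ← Finset.mul_sum, mul_smul_comm]

lemma average_inv_mul (r : Q → ℂ) (n : ℕ) (x y : Q) :
    𝒩.tree.average (fun z => r (z⁻¹ * x)) n y = 𝒩.tree.average r n (y⁻¹ * x) := by
  simp only [BlockTree.average, card_block]
  rw [sum_block (fun z => r (z⁻¹ * x)) n y, sum_block_left r n (y⁻¹ * x),
    ← sum_block_inv fun h => r (h * (y⁻¹ * x))]
  simp [mul_assoc]

lemma average_mul (r : Q → ℂ) (n : ℕ) (x y : Q) :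
    𝒩.tree.average (fun z => r (x⁻¹ * z)) n y = 𝒩.tree.average r n (x⁻¹ * y) := by
  simp only [BlockTree.average, card_block]
  rw [sum_block (fun z => r (x⁻¹ * z)) n y, sum_block r n (x⁻¹ * y)]
  simp [mul_assoc]

open Classical in
/-- Hörmander's condition for right translations of the convolution kernel gives it in both
variables, because `N_l` is normal and the condition can be expressed by averages over its
cosets. -/
lemma hormander_convMatrix {r : Q → ℂ} {D : ℝ} (hD : 0 ≤ D)
    (h : ∀ l ≤ 𝒩.depth, ∀ y ∈ 𝒩.subgroup l,
      mean (Finset.univ.filter fun z => z ∉ 𝒩.subgroup l) (fun z => ‖r (z * y⁻¹) - r z‖) ≤ D) :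
    𝒩.tree.Hormander (convMatrix r) D ∧ 𝒩.tree.Hormander (convMatrix r)ᵀ D := by
  have hM := card_pos (Q := Q)
  have key : ∀ l, mean (Finset.univ.filter fun z => z ∉ 𝒩.subgroup l)
      (fun z => ‖r z - 𝒩.tree.average r l z‖) ≤ D := by
    intro l
    rcases le_or_gt l 𝒩.depth with hl | hl
    · exact mean_sub_average_le (h l hl)
    · have h1 : ∀ z, 𝒩.tree.block l z = {z} := fun z =>
        Finset.Subset.antisymm (𝒩.tree.block_depth z ▸ 𝒩.tree.block_anti hl.le z)
          (Finset.singleton_subset_iff.2 (𝒩.tree.mem_block l z))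
      simpa [mean, BlockTree.average, h1] using hD
  have hnorm : ∀ a b : ℂ, ‖(Fintype.card Q : ℂ)⁻¹ * a - (Fintype.card Q : ℂ)⁻¹ * b‖ =
      (Fintype.card Q : ℝ)⁻¹ * ‖a - b‖ := fun a b => by
    rw [← mul_sub, norm_mul, norm_inv, Complex.norm_natCast]
  constructor
  · intro n y
    refine le_trans (le_of_eq ?_) (key n)
    have e : ∀ x, 𝒩.tree.average (convMatrix r x) n y =
        (Fintype.card Q : ℂ)⁻¹ * 𝒩.tree.average r n (y⁻¹ * x) := fun x => by
      rw [← average_inv_mul, ← average_const_mul]; rfl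
    simp only [e, convMatrix_apply, hnorm]
    rw [mean, ← Finset.mul_sum]
    congr 1
    refine Finset.sum_nbij' (fun x => y⁻¹ * x) (fun z => y * z) ?_ ?_ ?_ ?_ ?_ <;>
      simp [mem_block]
  · intro n y
    refine le_trans (le_of_eq ?_) (key n)
    have e : ∀ x, 𝒩.tree.average ((convMatrix r)ᵀ x) n y =
        (Fintype.card Q : ℂ)⁻¹ * 𝒩.tree.average r n (x⁻¹ * y) := fun x => by
      rw [← average_mul, ← average_const_mul]; rfl
    simp only [e, Matrix.transpose_apply, convMatrix_apply, hnorm]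
    rw [mean, ← Finset.mul_sum]
    congr 1
    refine Finset.sum_nbij' (fun x => x⁻¹ * y) (fun z => y * z⁻¹) ?_ ?_ ?_ ?_ ?_
    · simp only [Finset.mem_filter, Finset.mem_univ, true_and, mem_block]
      intro x hx hx'
      exact hx (by simpa using inv_mem hx')
    · simp only [Finset.mem_filter, Finset.mem_univ, true_and, mem_block]
      intro x hx hx'
      exact hx (by simpa using hx')
    all_goals simp

/-- `L²`-boundedness of the convolution operator bounds the averages of its kernel, which are the
images of the normalized indicator functions of the subgroups. -/
lemma norm_average_le {r : Q → ℂ} {A : ℝ} (hA : 0 ≤ A)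
    (hL2 : ∀ f : Q → ℂ, ∑ x, ‖(convMatrix r *ᵥ f) x‖ ^ 2 ≤ A * ∑ x, ‖f x‖ ^ 2) (n : ℕ) (u : Q) :
    ‖𝒩.tree.average r n u‖ ≤ √A / 𝒩.vol n := by
  classical
  have hM := card_pos (Q := Q)
  have hv := 𝒩.vol_pos n
  set N := 𝒩.tree.block n 1
  have hcN : (N.card : ℝ) = Fintype.card Q * 𝒩.vol n := card_block n 1
  set f : Q → ℂ := fun y => if y ∈ N then ((𝒩.vol n : ℝ) : ℂ)⁻¹ else 0 with hf
  have hT : ∀ x, (convMatrix r *ᵥ f) x = 𝒩.tree.average r n x := by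
    intro x
    simp only [Matrix.mulVec, dotProduct, convMatrix, Matrix.of_apply, hf, mul_ite, mul_zero]
    rw [Finset.sum_ite_mem, Finset.univ_inter, BlockTree.average, card_block, sum_block_left r n x,
      ← sum_block_inv fun h => r (h * x), Complex.real_smul, Finset.mul_sum]
    refine Finset.sum_congr rfl fun h _ => ?_
    push_cast
    rw [mul_inv]; ring
  have h1 := hL2 f
  simp only [hT] at h1
  have h2 : ∑ x, ‖f x‖ ^ 2 = Fintype.card Q / 𝒩.vol n := by
    have : ∀ x, ‖f x‖ ^ 2 = if x ∈ N then (𝒩.vol n)⁻¹ ^ 2 else 0 := fun x => by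
      by_cases h : x ∈ N <;> simp [hf, h]
    simp only [this]
    rw [Finset.sum_ite_mem, Finset.univ_inter, Finset.sum_const, nsmul_eq_mul, hcN]
    field_simp
  have h3 : (Fintype.card Q * 𝒩.vol n) * ‖𝒩.tree.average r n u‖ ^ 2 ≤
      ∑ x, ‖𝒩.tree.average r n x‖ ^ 2 := by
    calc _ = ∑ x ∈ 𝒩.tree.block n u, ‖𝒩.tree.average r n x‖ ^ 2 := by
          have e : ∀ x ∈ 𝒩.tree.block n u, ‖𝒩.tree.average r n x‖ ^ 2 =
              ‖𝒩.tree.average r n u‖ ^ 2 := fun x hx => by rw [BlockTree.average_congr r hx]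
          rw [Finset.sum_congr rfl e, Finset.sum_const, nsmul_eq_mul, card_block]
      _ ≤ _ := Finset.sum_le_sum_of_subset_of_nonneg (Finset.subset_univ _)
          fun _ _ _ => by positivity
  have h4 : ‖𝒩.tree.average r n u‖ ^ 2 ≤ (√A / 𝒩.vol n) ^ 2 := by
    rw [div_pow, Real.sq_sqrt hA, le_div_iff₀ (by positivity)]
    have h5 := h3.trans (h1.trans_eq (by rw [h2]))
    have h6 : Fintype.card Q * (‖𝒩.tree.average r n u‖ ^ 2 * 𝒩.vol n ^ 2) ≤
        Fintype.card Q * A := by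
      calc _ = (Fintype.card Q * 𝒩.vol n * ‖𝒩.tree.average r n u‖ ^ 2) * 𝒩.vol n := by ring
        _ ≤ (A * (Fintype.card Q / 𝒩.vol n)) * 𝒩.vol n := by gcongr
        _ = _ := by field_simp
    exact le_of_mul_le_mul_left h6 hM
  exact (abs_le_of_sq_le_sq' h4 (by positivity)).2

end NormalChain

/-! ### Schur's test and the shell bound -/

lemma Finset.sum_pow_le_of_injOn {ι : Type*} {s : Finset ι} {g : ι → ℕ} (hg : Set.InjOn g s)
    {a : ℝ} (h0 : 0 ≤ a) (h1 : a < 1) : ∑ i ∈ s, a ^ g i ≤ (1 - a)⁻¹ := by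
  classical
  rw [← Finset.sum_image (f := fun n => a ^ n) hg, ← tsum_geometric_of_lt_one h0 h1]
  exact (summable_geometric_of_lt_one h0 h1).sum_le_tsum _ fun _ _ => by positivity

/-- Schur's test on `L^p(w)` with a test function `h`. -/
lemma sum_weight_mul_rpow_le {X : Type*} [Fintype X] {κ : X → X → ℝ} {w h : X → ℝ}
    {p q C₁ C₂ : ℝ} (hpq : p.HolderConjugate q) (hκ : ∀ x y, 0 ≤ κ x y) (hw : ∀ x, 0 ≤ w x)
    (hh : ∀ x, 0 < h x) (hC₁ : 0 ≤ C₁)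
    (h1 : ∀ x, ∑ y, κ x y * h y ^ q ≤ C₁ * h x ^ q)
    (h2 : ∀ y, ∑ x, κ x y * (h x ^ p * w x) ≤ C₂ * (h y ^ p * w y))
    {g : X → ℝ} (hg : ∀ x, 0 ≤ g x) :
    ∑ x, w x * (∑ y, κ x y * g y) ^ p ≤ C₁ ^ (p / q) * C₂ * ∑ x, w x * g x ^ p := by
  have hp := hpq.pos
  have hq := hpq.symm.pos
  have key : ∀ x, (∑ y, κ x y * g y) ^ p ≤
      C₁ ^ (p / q) * h x ^ p * ∑ y, κ x y * ((h y ^ p)⁻¹ * g y ^ p) := by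
    intro x
    have e1 : ∀ y, κ x y * g y = (κ x y ^ (1 / p) * ((h y)⁻¹ * g y)) * (κ x y ^ (1 / q) * h y) := by
      intro y
      have : κ x y = κ x y ^ (1 / p) * κ x y ^ (1 / q) := by
        rcases (hκ x y).eq_or_lt with h0 | h0
        · rw [← h0, Real.zero_rpow (by positivity)]; simp
        · rw [← Real.rpow_add h0, one_div, one_div, hpq.inv_add_inv_eq_one, Real.rpow_one]
      have hy := (hh y).ne'
      calc κ x y * g y = κ x y ^ (1 / p) * κ x y ^ (1 / q) * g y := by rw [← this]
        _ = _ := by field_simp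
    have n1 : ∀ y, 0 ≤ κ x y ^ (1 / p) * ((h y)⁻¹ * g y) := fun y =>
      mul_nonneg (Real.rpow_nonneg (hκ x y) _) (mul_nonneg (inv_nonneg.2 (hh y).le) (hg y))
    have n2 : ∀ y, 0 ≤ κ x y ^ (1 / q) * h y := fun y =>
      mul_nonneg (Real.rpow_nonneg (hκ x y) _) (hh y).le
    have e2 : ∀ y, (κ x y ^ (1 / p) * ((h y)⁻¹ * g y)) ^ p =
        κ x y * ((h y ^ p)⁻¹ * g y ^ p) := fun y => by
      rw [Real.mul_rpow (Real.rpow_nonneg (hκ x y) _)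
        (mul_nonneg (inv_nonneg.2 (hh y).le) (hg y)), ← Real.rpow_mul (hκ x y),
        one_div_mul_cancel hp.ne', Real.rpow_one, Real.mul_rpow (inv_nonneg.2 (hh y).le) (hg y),
        Real.inv_rpow (hh y).le]
    have e3 : ∀ y, (κ x y ^ (1 / q) * h y) ^ q = κ x y * h y ^ q := fun y => by
      rw [Real.mul_rpow (Real.rpow_nonneg (hκ x y) _) (hh y).le, ← Real.rpow_mul (hκ x y),
        one_div_mul_cancel hq.ne', Real.rpow_one]
    have holder := Real.inner_le_Lp_mul_Lq_of_nonneg Finset.univ hpq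
      (fun y _ => n1 y) (fun y _ => n2 y)
    simp only [← e1, e2, e3] at holder
    set I := ∑ y, κ x y * ((h y ^ p)⁻¹ * g y ^ p)
    have hI : 0 ≤ I := Finset.sum_nonneg fun y _ => mul_nonneg (hκ x y)
      (mul_nonneg (inv_nonneg.2 (Real.rpow_nonneg (hh y).le _)) (Real.rpow_nonneg (hg y) _))
    have hJ : 0 ≤ ∑ y, κ x y * h y ^ q := Finset.sum_nonneg fun y _ => mul_nonneg (hκ x y)
      (Real.rpow_nonneg (hh y).le _)
    have hL : 0 ≤ ∑ y, κ x y * g y := Finset.sum_nonneg fun y _ => mul_nonneg (hκ x y) (hg y)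
    have hhx := hh x
    calc (∑ y, κ x y * g y) ^ p ≤ (I ^ (1 / p) * (C₁ * h x ^ q) ^ (1 / q)) ^ p := by
          refine Real.rpow_le_rpow hL (holder.trans ?_) hp.le
          gcongr
          exact h1 x
      _ = _ := by
          rw [Real.mul_rpow (by positivity) (by positivity), ← Real.rpow_mul hI,
            one_div_mul_cancel hp.ne', Real.rpow_one, Real.mul_rpow hC₁ (by positivity),
            ← Real.rpow_mul hhx.le, mul_one_div_cancel hq.ne', Real.rpow_one,
            Real.mul_rpow (by positivity) hhx.le, ← Real.rpow_mul hC₁]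
          rw [show 1 / q * p = p / q by ring]
          ring
  calc ∑ x, w x * (∑ y, κ x y * g y) ^ p
      ≤ ∑ x, w x * (C₁ ^ (p / q) * h x ^ p * ∑ y, κ x y * ((h y ^ p)⁻¹ * g y ^ p)) := by
        gcongr with x _
        · exact hw x
        · exact key x
    _ = C₁ ^ (p / q) * ∑ y, (∑ x, κ x y * (h x ^ p * w x)) * ((h y ^ p)⁻¹ * g y ^ p) := by
        simp only [Finset.mul_sum, Finset.sum_mul]
        rw [Finset.sum_comm]
        refine Finset.sum_congr rfl fun y _ => Finset.sum_congr rfl fun x _ => ?_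
        ring
    _ ≤ C₁ ^ (p / q) * ∑ y, (C₂ * (h y ^ p * w y)) * ((h y ^ p)⁻¹ * g y ^ p) := by
        gcongr with y _
        · exact mul_nonneg (inv_nonneg.2 (Real.rpow_nonneg (hh y).le _)) (Real.rpow_nonneg (hg y) _)
        · exact h2 y
    _ = _ := by
        rw [mul_assoc, Finset.mul_sum (a := C₂)]
        congr 1
        refine Finset.sum_congr rfl fun y _ => ?_
        have : h y ^ p ≠ 0 := (Real.rpow_pos_of_pos (hh y) p).ne'
        field_simp

namespace NormalChain

variable {Q : Type*} [Group Q] [Fintype Q] {𝒩 : NormalChain Q}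

/-- The mean of `ρ` over subsets of the shells is controlled by the relative size of the subset;
for `θ = 1 - 1 / t` this is the form in which an `L^t` bound on the shells is used. -/
def ShellBound (𝒩 : NormalChain Q) (ρ : Q → ℝ) (θ D : ℝ) : Prop :=
  ∀ n < 𝒩.depth, ∀ s ⊆ 𝒩.shell n, mean s ρ ≤ D * (mean s (fun _ => 1) / 𝒩.vol n) ^ θ

omit [Group Q] in
lemma mean_image {s : Finset Q} {φ : Q → Q} (hφ : Function.Injective φ) [DecidableEq Q]
    (ρ : Q → ℝ) : mean (s.image φ) ρ = mean s fun z => ρ (φ z) := by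
  rw [mean, mean, Finset.sum_image hφ.injOn]

omit [Group Q] in
lemma mean_nonneg {s : Finset Q} {ρ : Q → ℝ} (hρ : ∀ z, 0 ≤ ρ z) : 0 ≤ mean s ρ :=
  mul_nonneg (by positivity) (Finset.sum_nonneg fun z _ => hρ z)

lemma ShellBound.comp_inv {ρ : Q → ℝ} {θ D : ℝ} (h : 𝒩.ShellBound ρ θ D) :
    𝒩.ShellBound (fun z => ρ z⁻¹) θ D := by
  classical
  intro n hn s hs
  have h1 := h n hn (s.image fun z => z⁻¹) (by
    intro z hz
    obtain ⟨y, hy, rfl⟩ := Finset.mem_image.1 hz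
    rw [mem_shell, level_inv]
    exact mem_shell.1 (hs hy))
  rwa [mean_image inv_injective, mean_image inv_injective] at h1

lemma vol_ratio_rpow_le {m n : ℕ} (hnm : n ≤ m) (hm : m ≤ 𝒩.depth) {β a : ℝ}
    (hβ : (1 / 2 : ℝ) ^ β ≤ a) (hβ0 : 0 ≤ β) : (𝒩.vol m / 𝒩.vol n) ^ β ≤ a ^ (m - n) := by
  have h1 := 𝒩.vol_pos n
  have h2 := 𝒩.vol_pos m
  calc (𝒩.vol m / 𝒩.vol n) ^ β ≤ ((1 / 2 : ℝ) ^ (m - n)) ^ β := by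
        refine Real.rpow_le_rpow (by positivity) ?_ hβ0
        rw [div_le_iff₀ h1, mul_comm]
        exact vol_le_mul_pow hnm hm
    _ = ((1 / 2 : ℝ) ^ β) ^ (m - n) := by
        rw [← Real.rpow_natCast, ← Real.rpow_natCast, ← Real.rpow_mul (by norm_num),
          ← Real.rpow_mul (by norm_num), mul_comm]
    _ ≤ a ^ (m - n) := by gcongr

/-- The off-diagonal part of a kernel with the shell bound maps the power `|y| ^ (-β)`,
`0 < β < θ`, to a multiple of itself: the contribution of the shell of level `m` decays
geometrically in the distance of `m` to the level of `x`. -/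
lemma ShellBound.sum_offDiag_le {ρ : Q → ℝ} {θ D β : ℝ} (hD : 0 ≤ D)
    (h : 𝒩.ShellBound ρ θ D) (hβ : 0 < β) (hβθ : β < θ) (x : Q) :
    mean (Finset.univ.filter fun y => 𝒩.level y ≠ 𝒩.level x)
        (fun y => ρ (y⁻¹ * x) * 𝒩.vol (𝒩.level y) ^ (-β)) ≤
      D * (2 * (1 - (1 / 2 : ℝ) ^ min β (θ - β))⁻¹) * 𝒩.vol (𝒩.level x) ^ (-β) := by
  classical
  set a : ℝ := (1 / 2 : ℝ) ^ min β (θ - β)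
  have ha0 : 0 ≤ a := by positivity
  have ha1 : a < 1 := Real.rpow_lt_one (by norm_num) (by norm_num) (lt_min hβ (by linarith))
  set n := 𝒩.level x with hn
  have hnk : n ≤ 𝒩.depth := level_le x
  have hvn := 𝒩.vol_pos n
  -- The contribution of one shell.
  have shell_le : ∀ m ∈ (Finset.range (𝒩.depth + 1)).filter (· ≠ n),
      mean (𝒩.shell m) (fun y => ρ (y⁻¹ * x) * 𝒩.vol (𝒩.level y) ^ (-β)) ≤
        D * 𝒩.vol n ^ (-β) * ((if m < n then a ^ (n - m) else 0) +
          if m < n then 0 else a ^ (m - n)) := by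
    intro m hm
    rw [Finset.mem_filter, Finset.mem_range] at hm
    obtain ⟨hmk, hmn⟩ := hm
    have hmk : m ≤ 𝒩.depth := by omega
    have hvm := 𝒩.vol_pos m
    have hinj : Function.Injective fun y : Q => y⁻¹ * x := fun y z hyz => by simpa using hyz
    have e1 : mean (𝒩.shell m) (fun y => ρ (y⁻¹ * x) * 𝒩.vol (𝒩.level y) ^ (-β)) =
        mean ((𝒩.shell m).image fun y => y⁻¹ * x) ρ * 𝒩.vol m ^ (-β) := by
      rw [mean_image hinj, mean, mean, mul_assoc, Finset.sum_mul]
      congr 1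
      refine Finset.sum_congr rfl fun y hy => ?_
      rw [mem_shell.1 hy]
    have hcard : mean ((𝒩.shell m).image fun y => y⁻¹ * x) (fun _ => 1) ≤ 𝒩.vol m := by
      rw [mean_image hinj]
      exact mean_one_le fun z hz => mem_shell.1 hz ▸ mem_subgroup_level z
    have hcard0 : 0 ≤ mean ((𝒩.shell m).image fun y => y⁻¹ * x) (fun _ => 1) :=
      mean_nonneg fun _ => zero_le_one
    have hθ : 0 ≤ θ := by linarith
    rw [e1]
    rcases lt_or_gt_of_ne hmn with hlt | hgt
    · rw [if_pos hlt, if_pos hlt, add_zero]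
      have h1 := h m (by omega) ((𝒩.shell m).image fun y => y⁻¹ * x) (by
        intro z hz
        obtain ⟨y, hy, rfl⟩ := Finset.mem_image.1 hz
        rw [mem_shell] at hy ⊢
        rw [level_mul_of_lt (by rw [level_inv, hy]; exact hlt), level_inv, hy])
      have h2 : mean ((𝒩.shell m).image fun y => y⁻¹ * x) ρ ≤ D := by
        refine h1.trans (mul_le_of_le_one_right hD ?_)
        refine Real.rpow_le_one (by positivity) ?_ hθ
        rwa [div_le_one hvm]
      have h3 : 𝒩.vol m ^ (-β) = 𝒩.vol n ^ (-β) * (𝒩.vol n / 𝒩.vol m) ^ β := by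
        rw [Real.div_rpow hvn.le hvm.le, Real.rpow_neg hvn.le, Real.rpow_neg hvm.le]
        have := (Real.rpow_pos_of_pos hvn β).ne'
        field_simp
      rw [h3]
      have h4 : (𝒩.vol n / 𝒩.vol m) ^ β ≤ a ^ (n - m) := vol_ratio_rpow_le hlt.le hnk
        (Real.rpow_le_rpow_of_exponent_ge (by norm_num) (by norm_num) (min_le_left _ _)) hβ.le
      rw [mul_assoc D]
      gcongr
    · rw [if_neg (by omega), if_neg (by omega), zero_add]
      have h1 := h n (by omega) ((𝒩.shell m).image fun y => y⁻¹ * x) (by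
        intro z hz
        obtain ⟨y, hy, rfl⟩ := Finset.mem_image.1 hz
        rw [mem_shell] at hy ⊢
        rw [level_mul_of_gt (by rw [level_inv, hy]; exact hgt)])
      have h2 : mean ((𝒩.shell m).image fun y => y⁻¹ * x) ρ ≤ D * (𝒩.vol m / 𝒩.vol n) ^ θ := by
        refine h1.trans ?_
        gcongr
      have h3 : (𝒩.vol m / 𝒩.vol n) ^ θ * 𝒩.vol m ^ (-β) =
          𝒩.vol n ^ (-β) * (𝒩.vol m / 𝒩.vol n) ^ (θ - β) := by
        rw [Real.div_rpow hvm.le hvn.le, Real.div_rpow hvm.le hvn.le, Real.rpow_sub hvm,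
          Real.rpow_sub hvn, Real.rpow_neg hvn.le, Real.rpow_neg hvm.le]
        have := (Real.rpow_pos_of_pos hvn β).ne'
        have := (Real.rpow_pos_of_pos hvm β).ne'
        have := (Real.rpow_pos_of_pos hvn θ).ne'
        field_simp
      have h4 : (𝒩.vol m / 𝒩.vol n) ^ (θ - β) ≤ a ^ (m - n) := vol_ratio_rpow_le hgt.le hmk
        (Real.rpow_le_rpow_of_exponent_ge (by norm_num) (by norm_num) (min_le_right _ _))
        (by linarith)
      calc _ ≤ D * (𝒩.vol m / 𝒩.vol n) ^ θ * 𝒩.vol m ^ (-β) := by gcongr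
        _ = D * 𝒩.vol n ^ (-β) * (𝒩.vol m / 𝒩.vol n) ^ (θ - β) := by
            rw [mul_assoc, h3, mul_assoc]
        _ ≤ _ := by gcongr
  have hsplit : mean (Finset.univ.filter fun y => 𝒩.level y ≠ n)
      (fun y => ρ (y⁻¹ * x) * 𝒩.vol (𝒩.level y) ^ (-β)) =
      ∑ m ∈ (Finset.range (𝒩.depth + 1)).filter (· ≠ n),
        mean (𝒩.shell m) (fun y => ρ (y⁻¹ * x) * 𝒩.vol (𝒩.level y) ^ (-β)) := by
    unfold mean
    rw [← Finset.mul_sum]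
    congr 1
    rw [← Finset.sum_fiberwise_of_maps_to (g := 𝒩.level)
      (t := (Finset.range (𝒩.depth + 1)).filter (· ≠ n))]
    · refine Finset.sum_congr rfl fun m hm => Finset.sum_congr ?_ fun _ _ => rfl
      rw [Finset.mem_filter] at hm
      ext y
      simp only [Finset.mem_filter, Finset.mem_univ, true_and, mem_shell]
      exact ⟨fun h => h.2, fun h => ⟨h ▸ hm.2, h⟩⟩
    · intro y hy
      simp only [Finset.mem_filter, Finset.mem_univ, true_and, Finset.mem_range] at hy ⊢
      exact ⟨Nat.lt_succ_of_le (level_le y), hy⟩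
  rw [hsplit]
  refine (Finset.sum_le_sum shell_le).trans ?_
  rw [← Finset.mul_sum, Finset.sum_add_distrib]
  have g1 : ∑ m ∈ (Finset.range (𝒩.depth + 1)).filter (· ≠ n),
      (if m < n then a ^ (n - m) else 0) ≤ (1 - a)⁻¹ := by
    rw [← Finset.sum_filter]
    refine Finset.sum_pow_le_of_injOn ?_ ha0 ha1
    intro i hi j hj hij
    simp only [Finset.coe_filter, Finset.mem_filter, Set.mem_ofPred_eq] at hi hj hij
    omega
  have g2 : ∑ m ∈ (Finset.range (𝒩.depth + 1)).filter (· ≠ n),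
      (if m < n then 0 else a ^ (m - n)) ≤ (1 - a)⁻¹ := by
    have : ∀ m, (if m < n then 0 else a ^ (m - n)) = if ¬ m < n then a ^ (m - n) else 0 :=
      fun m => by rw [ite_not]
    simp only [this]
    rw [← Finset.sum_filter]
    refine Finset.sum_pow_le_of_injOn ?_ ha0 ha1
    intro i hi j hj hij
    simp only [Finset.coe_filter, Finset.mem_filter, Set.mem_ofPred_eq] at hi hj hij
    omega
  have hc : 0 ≤ D * 𝒩.vol n ^ (-β) := by positivity
  calc _ ≤ D * 𝒩.vol n ^ (-β) * ((1 - a)⁻¹ + (1 - a)⁻¹) := by gcongr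
    _ = _ := by ring

end NormalChain

/-! ### Regularity of the kernel and weighted bounds -/

namespace NormalChain

variable {Q : Type*} [Group Q] [Fintype Q] {𝒩 : NormalChain Q}

/-- The condition `H(t)`, `t > 1`, on a finite chain. -/
def TranslationBound (𝒩 : NormalChain Q) (r : Q → ℂ) (t ε D : ℝ) : Prop :=
  ∀ n l, n < l → l ≤ 𝒩.depth → ∀ y ∈ 𝒩.subgroup l,
    mean (𝒩.shell n) (fun z => ‖r (z * y⁻¹) - r z‖ ^ t) ^ (1 / t) ≤
      D * (𝒩.vol n ^ (-(ε + (1 - 1 / t))) * 𝒩.vol l ^ ε)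

lemma TranslationBound.mean_le {r : Q → ℂ} {t ε D : ℝ} (h : 𝒩.TranslationBound r t ε D)
    (ht : 1 < t) {n l : ℕ} (hnl : n < l) (hl : l ≤ 𝒩.depth) {y : Q} (hy : y ∈ 𝒩.subgroup l)
    {s : Finset Q} (hs : s ⊆ 𝒩.shell n) :
    mean s (fun z => ‖r (z * y⁻¹) - r z‖) ≤
      D * ((mean s (fun _ => 1) / 𝒩.vol n) ^ (1 - 1 / t) * (𝒩.vol l / 𝒩.vol n) ^ ε) := by
  have h1 := mean_le_rpow_mul ht s (ρ := fun z => ‖r (z * y⁻¹) - r z‖) fun _ => norm_nonneg _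
  have hvn := 𝒩.vol_pos n
  have hvl := 𝒩.vol_pos l
  have hs0 : 0 ≤ mean s fun _ => 1 := mean_nonneg fun _ => zero_le_one
  have h2 : mean s (fun z => ‖r (z * y⁻¹) - r z‖ ^ t) ^ (1 / t) ≤
      mean (𝒩.shell n) (fun z => ‖r (z * y⁻¹) - r z‖ ^ t) ^ (1 / t) :=
    Real.rpow_le_rpow (mean_nonneg fun _ => by positivity)
      (mean_mono hs fun _ => by positivity) (by positivity)
  refine h1.trans ((mul_le_mul_of_nonneg_left (h2.trans (h n l hnl hl y hy))
    (Real.rpow_nonneg hs0 _)).trans_eq ?_)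
  rw [Real.div_rpow hs0 hvn.le, Real.div_rpow hvl.le hvn.le, neg_add, Real.rpow_add hvn,
    Real.rpow_neg hvn.le, Real.rpow_neg hvn.le]
  field_simp

open Classical in
/-- `H(t)` implies `H(1)`. -/
lemma TranslationBound.mean_compl_le {r : Q → ℂ} {t ε D : ℝ} (h : 𝒩.TranslationBound r t ε D)
    (ht : 1 < t) (hε : 0 < ε) (hD : 0 ≤ D) {l : ℕ} (hl : l ≤ 𝒩.depth) {y : Q}
    (hy : y ∈ 𝒩.subgroup l) :
    mean (Finset.univ.filter fun z => z ∉ 𝒩.subgroup l) (fun z => ‖r (z * y⁻¹) - r z‖) ≤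
      D * (1 - (1 / 2 : ℝ) ^ ε)⁻¹ := by
  have ha1 : (1 / 2 : ℝ) ^ ε < 1 := Real.rpow_lt_one (by norm_num) (by norm_num) hε
  have hθ : 0 ≤ 1 - 1 / t := by
    rw [sub_nonneg, div_le_one (by linarith)]; exact ht.le
  have hsplit : mean (Finset.univ.filter fun z => z ∉ 𝒩.subgroup l)
      (fun z => ‖r (z * y⁻¹) - r z‖) =
      ∑ n ∈ Finset.range l, mean (𝒩.shell n) (fun z => ‖r (z * y⁻¹) - r z‖) := by
    unfold mean
    rw [← Finset.mul_sum]
    congr 1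
    have hmem : ∀ z : Q, z ∉ 𝒩.subgroup l ↔ 𝒩.level z < l := fun z => by
      rw [mem_subgroup_iff hl, not_le]
    rw [← Finset.sum_fiberwise_of_maps_to (g := 𝒩.level) (t := Finset.range l)]
    · refine Finset.sum_congr rfl fun m hm => Finset.sum_congr ?_ fun _ _ => rfl
      rw [Finset.mem_range] at hm
      ext z
      simp only [Finset.mem_filter, Finset.mem_univ, true_and, mem_shell, hmem]
      exact ⟨fun h => h.2, fun h => ⟨h ▸ hm, h⟩⟩
    · intro z hz
      simpa [hmem] using hz
  rw [hsplit]
  calc _ ≤ ∑ n ∈ Finset.range l, D * ((1 / 2 : ℝ) ^ ε) ^ (l - n) := by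
        refine Finset.sum_le_sum fun n hn => ?_
        rw [Finset.mem_range] at hn
        have hvn := 𝒩.vol_pos n
        have hvl := 𝒩.vol_pos l
        refine (h.mean_le ht hn hl hy subset_rfl).trans (mul_le_mul_of_nonneg_left ?_ hD)
        have h1 : (mean (𝒩.shell n) (fun _ => 1) / 𝒩.vol n) ^ (1 - 1 / t) ≤ 1 := by
          refine Real.rpow_le_one (div_nonneg (mean_nonneg fun _ => zero_le_one) hvn.le) ?_ hθ
          rw [div_le_one hvn]
          exact mean_one_le fun z hz => mem_shell.1 hz ▸ mem_subgroup_level z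
        have h2 : (𝒩.vol l / 𝒩.vol n) ^ ε ≤ ((1 / 2 : ℝ) ^ ε) ^ (l - n) :=
          vol_ratio_rpow_le hn.le hl le_rfl hε.le
        exact (mul_le_of_le_one_left (by positivity) h1).trans h2
    _ ≤ _ := by
        rw [← Finset.mul_sum]
        refine mul_le_mul_of_nonneg_left (Finset.sum_pow_le_of_injOn ?_ (by positivity) ha1) hD
        intro i hi j hj hij
        simp only [Finset.coe_range, Set.mem_Iio] at hi hj hij
        omega

/-- `H(t)` and `L²`-boundedness imply the size condition on shells: on the shell of level `n`, the
kernel differs little from its averages over cosets of `N_{n+1}`, which are bounded by a multiple of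
`1 / |N_{n+1}|`. -/
lemma TranslationBound.shellBound {r : Q → ℂ} {t ε D A B : ℝ} (h : 𝒩.TranslationBound r t ε D)
    (ht : 1 < t) (hε : 0 < ε) (hD : 0 ≤ D) (hA : 0 ≤ A) (hB : 0 ≤ B)
    (hdbl : ∀ n < 𝒩.depth, 𝒩.vol n ≤ B * 𝒩.vol (n + 1))
    (hL2 : ∀ f : Q → ℂ, ∑ x, ‖(convMatrix r *ᵥ f) x‖ ^ 2 ≤ A * ∑ x, ‖f x‖ ^ 2) :
    𝒩.ShellBound (fun z => ‖r z‖) (1 - 1 / t) (D + √A * B) := by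
  intro n hn s hs
  have hθ : 0 ≤ 1 - 1 / t := by
    rw [sub_nonneg, div_le_one (by linarith)]; exact ht.le
  have hθ1 : 1 - 1 / t ≤ 1 := by
    have : 0 < 1 / t := by positivity
    linarith
  have hvn := 𝒩.vol_pos n
  have hvn1 := 𝒩.vol_pos (n + 1)
  set m := mean s fun _ => 1 with hm
  have hm0 : 0 ≤ m := mean_nonneg fun _ => zero_le_one
  have hm1 : m / 𝒩.vol n ≤ 1 := by
    rw [div_le_one hvn]
    exact mean_one_le fun z hz => mem_shell.1 (hs hz) ▸ mem_subgroup_level z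
  have h1 : mean s (fun z => ‖r z - 𝒩.tree.average r (n + 1) z‖) ≤
      D * (m / 𝒩.vol n) ^ (1 - 1 / t) := by
    refine mean_sub_average_le fun y hy => (h.mean_le ht n.lt_succ_self hn hy hs).trans ?_
    refine mul_le_mul_of_nonneg_left (mul_le_of_le_one_right (by positivity) ?_) hD
    refine Real.rpow_le_one (by positivity) ?_ hε.le
    rw [div_le_one hvn]
    exact vol_antitone n.le_succ hn
  have h2 : mean s (fun z => ‖𝒩.tree.average r (n + 1) z‖) ≤
      √A * B * (m / 𝒩.vol n) ^ (1 - 1 / t) := by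
    calc mean s (fun z => ‖𝒩.tree.average r (n + 1) z‖)
        ≤ mean s (fun _ => √A / 𝒩.vol (n + 1)) := by
          unfold mean
          gcongr with z
          exact norm_average_le hA hL2 _ _
      _ = m * (√A / 𝒩.vol (n + 1)) := by
          rw [hm, mean, mean, mul_assoc, Finset.sum_mul]; simp
      _ ≤ m * (√A * (B / 𝒩.vol n)) := by
          rw [div_eq_mul_inv]
          gcongr
          rw [le_div_iff₀ hvn, inv_mul_le_iff₀ hvn1, mul_comm]
          exact hdbl n hn
      _ = √A * B * (m / 𝒩.vol n) := by ring
      _ ≤ _ := by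
          gcongr
          exact Real.self_le_rpow_of_le_one (by positivity) hm1 hθ1
  calc mean s (fun z => ‖r z‖)
      ≤ mean s (fun z => ‖r z - 𝒩.tree.average r (n + 1) z‖) +
          mean s (fun z => ‖𝒩.tree.average r (n + 1) z‖) := by
        unfold mean
        rw [← mul_add, ← Finset.sum_add_distrib]
        gcongr with z
        exact norm_le_norm_sub_add _ _
    _ ≤ _ := by rw [add_mul]; exact add_le_add h1 h2

/-- An `L^p`-bounded convolution operator whose kernel has the shell bound is bounded on `L^p` with
the power weight `|x| ^ α`, `-θ < α < (p - 1) θ`: on each shell the weight is constant, and the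
interaction between different shells is controlled by Schur's test. -/
theorem ShellBound.weighted_bound {r : Q → ℂ} {θ D C p q σ α : ℝ}
    (h : 𝒩.ShellBound (fun z => ‖r z‖) θ D) (hD : 0 ≤ D) (hpq : p.HolderConjugate q)
    (hσ0 : 0 < σ) (hσ1 : σ * (q / p) < θ) (hσ2 : α < σ) (hσ3 : σ < α + θ)
    (hC : ∀ f : Q → ℂ, ∑ x, ‖(convMatrix r *ᵥ f) x‖ ^ p ≤ C * ∑ x, ‖f x‖ ^ p)
    (f : Q → ℂ) :
    ∑ x, 𝒩.vol (𝒩.level x) ^ α * ‖(convMatrix r *ᵥ f) x‖ ^ p ≤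
      2 ^ (p - 1) * (C + (D * (2 * (1 - (1 / 2 : ℝ) ^ min (σ * (q / p)) (θ - σ * (q / p)))⁻¹)) ^
          (p / q) * (D * (2 * (1 - (1 / 2 : ℝ) ^ min (σ - α) (θ - (σ - α)))⁻¹))) *
        ∑ x, 𝒩.vol (𝒩.level x) ^ α * ‖f x‖ ^ p := by
  classical
  have hp := hpq.pos
  have hq := hpq.symm.pos
  have hM := card_pos (Q := Q)
  set C₁ := D * (2 * (1 - (1 / 2 : ℝ) ^ min (σ * (q / p)) (θ - σ * (q / p)))⁻¹)
  set C₂ := D * (2 * (1 - (1 / 2 : ℝ) ^ min (σ - α) (θ - (σ - α)))⁻¹)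
  set w : Q → ℝ := fun x => 𝒩.vol (𝒩.level x) ^ α with hw
  have hv : ∀ x, 0 < 𝒩.vol (𝒩.level x) := fun x => 𝒩.vol_pos _
  have hw0 : ∀ x, 0 ≤ w x := fun x => Real.rpow_nonneg (hv x).le _
  set κ : Q → Q → ℝ := fun x y =>
    if 𝒩.level y ≠ 𝒩.level x then (Fintype.card Q : ℝ)⁻¹ * ‖r (y⁻¹ * x)‖ else 0 with hκ
  have hκ0 : ∀ x y, 0 ≤ κ x y := fun x y => by
    simp only [hκ]; split_ifs <;> positivity
  set H : Q → ℝ := fun x => 𝒩.vol (𝒩.level x) ^ (-(σ / p)) with hH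
  have hHq : ∀ x, H x ^ q = 𝒩.vol (𝒩.level x) ^ (-(σ * (q / p))) := fun x => by
    simp only [hH]
    rw [← Real.rpow_mul (hv x).le]; congr 1; ring
  have hHp : ∀ x, H x ^ p * w x = 𝒩.vol (𝒩.level x) ^ (-(σ - α)) := fun x => by
    simp only [hH, hw]
    rw [← Real.rpow_mul (hv x).le, ← Real.rpow_add (hv x)]; congr 1; field_simp; ring
  have hσq : 0 < σ * (q / p) := by positivity
  have hC₁ : 0 ≤ C₁ := by
    have : (1 / 2 : ℝ) ^ min (σ * (q / p)) (θ - σ * (q / p)) < 1 :=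
      Real.rpow_lt_one (by norm_num) (by norm_num) (lt_min hσq (by linarith))
    have : 0 < 1 - (1 / 2 : ℝ) ^ min (σ * (q / p)) (θ - σ * (q / p)) := by linarith
    positivity
  -- The two conditions of Schur's test.
  have s1 : ∀ x, ∑ y, κ x y * H y ^ q ≤ C₁ * H x ^ q := by
    intro x
    refine le_trans (le_of_eq ?_) ((h.sum_offDiag_le hD hσq hσ1 x).trans_eq (by rw [hHq]))
    rw [mean, Finset.sum_filter, Finset.mul_sum]
    refine Finset.sum_congr rfl fun y _ => ?_
    by_cases hy : 𝒩.level y = 𝒩.level x <;> simp [hκ, hy, hHq, mul_assoc]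
  have s2 : ∀ y, ∑ x, κ x y * (H x ^ p * w x) ≤ C₂ * (H y ^ p * w y) := by
    intro y
    refine le_trans (le_of_eq ?_)
      ((h.comp_inv.sum_offDiag_le hD (β := σ - α) (by linarith) (by linarith) y).trans_eq
        (by rw [hHp]))
    rw [mean, Finset.sum_filter, Finset.mul_sum]
    refine Finset.sum_congr rfl fun x _ => ?_
    by_cases hx : 𝒩.level x = 𝒩.level y
    · simp [hκ, hx]
    · simp [hκ, hx, Ne.symm hx, hHp, mul_assoc]
  have hoff := sum_weight_mul_rpow_le hpq hκ0 hw0 (fun x => Real.rpow_pos_of_pos (hv x) _) hC₁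
    s1 s2 (g := fun y => ‖f y‖) fun _ => norm_nonneg _
  -- The diagonal part, on each shell separately.
  set fl : ℕ → Q → ℂ := fun n y => if 𝒩.level y = n then f y else 0 with hfl
  have hdiag : ∑ x, w x * ‖(convMatrix r *ᵥ fl (𝒩.level x)) x‖ ^ p ≤
      C * ∑ x, w x * ‖f x‖ ^ p := by
    have hmaps : ∀ x ∈ (Finset.univ : Finset Q), 𝒩.level x ∈ Finset.range (𝒩.depth + 1) :=
      fun x _ => Finset.mem_range.2 (Nat.lt_succ_of_le (level_le x))
    rw [← Finset.sum_fiberwise_of_maps_to hmaps, ← Finset.sum_fiberwise_of_maps_to hmaps,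
      Finset.mul_sum]
    refine Finset.sum_le_sum fun n _ => ?_
    calc _ = 𝒩.vol n ^ α * ∑ x with 𝒩.level x = n, ‖(convMatrix r *ᵥ fl n) x‖ ^ p := by
          rw [Finset.mul_sum]
          refine Finset.sum_congr rfl fun x hx => ?_
          simp only [hw, (Finset.mem_filter.1 hx).2]
      _ ≤ 𝒩.vol n ^ α * ∑ x, ‖(convMatrix r *ᵥ fl n) x‖ ^ p := by
          have := 𝒩.vol_pos n
          gcongr
          exact Finset.subset_univ _
      _ ≤ 𝒩.vol n ^ α * (C * ∑ x, ‖fl n x‖ ^ p) := by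
          have := 𝒩.vol_pos n
          gcongr
          exact hC _
      _ = _ := by
          have : ∀ x, ‖fl n x‖ ^ p = if 𝒩.level x = n then ‖f x‖ ^ p else 0 := fun x => by
            by_cases hx : 𝒩.level x = n <;> simp [hfl, hx, Real.zero_rpow hp.ne']
          simp only [this]
          rw [← Finset.sum_filter, mul_left_comm, Finset.mul_sum]
          congr 1
          refine Finset.sum_congr rfl fun x hx => ?_
          simp only [hw, (Finset.mem_filter.1 hx).2]
  have hpt : ∀ x, ‖(convMatrix r *ᵥ f) x‖ ^ p ≤ 2 ^ (p - 1) *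
      (‖(convMatrix r *ᵥ fl (𝒩.level x)) x‖ ^ p + (∑ y, κ x y * ‖f y‖) ^ p) := by
    intro x
    have e : (convMatrix r *ᵥ f) x = (convMatrix r *ᵥ fl (𝒩.level x)) x +
        ∑ y, if 𝒩.level y ≠ 𝒩.level x then convMatrix r x y * f y else 0 := by
      simp only [Matrix.mulVec, dotProduct]
      rw [← Finset.sum_add_distrib]
      refine Finset.sum_congr rfl fun y _ => ?_
      by_cases hy : 𝒩.level y = 𝒩.level x <;> simp [hfl, hy]
    have e2 : ‖∑ y, if 𝒩.level y ≠ 𝒩.level x then convMatrix r x y * f y else 0‖ ≤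
        ∑ y, κ x y * ‖f y‖ := by
      refine (norm_sum_le _ _).trans (Finset.sum_le_sum fun y _ => ?_)
      by_cases hy : 𝒩.level y = 𝒩.level x <;> simp [hκ, hy, convMatrix_apply]
    have h3 : 0 ≤ ∑ y, κ x y * ‖f y‖ :=
      Finset.sum_nonneg fun y _ => mul_nonneg (hκ0 x y) (norm_nonneg _)
    have h4 : ‖(convMatrix r *ᵥ f) x‖ ≤
        ‖(convMatrix r *ᵥ fl (𝒩.level x)) x‖ + ∑ y, κ x y * ‖f y‖ := by
      rw [e]; exact (norm_add_le _ _).trans (add_le_add le_rfl e2)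
    refine (Real.rpow_le_rpow (norm_nonneg _) h4 hp.le).trans ?_
    have := NNReal.rpow_add_le_mul_rpow_add_rpow ⟨_, norm_nonneg
      ((convMatrix r *ᵥ fl (𝒩.level x)) x)⟩ ⟨_, h3⟩ hpq.lt.le
    exact_mod_cast this
  calc ∑ x, w x * ‖(convMatrix r *ᵥ f) x‖ ^ p
      ≤ ∑ x, w x * (2 ^ (p - 1) *
          (‖(convMatrix r *ᵥ fl (𝒩.level x)) x‖ ^ p + (∑ y, κ x y * ‖f y‖) ^ p)) := by
        gcongr with x _
        · exact hw0 x
        · exact hpt x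
    _ = 2 ^ (p - 1) * (∑ x, w x * ‖(convMatrix r *ᵥ fl (𝒩.level x)) x‖ ^ p +
          ∑ x, w x * (∑ y, κ x y * ‖f y‖) ^ p) := by
        rw [← Finset.sum_add_distrib, Finset.mul_sum]
        exact Finset.sum_congr rfl fun x _ => by ring
    _ ≤ 2 ^ (p - 1) * (C * ∑ x, w x * ‖f x‖ ^ p + C₁ ^ (p / q) * C₂ * ∑ x, w x * ‖f x‖ ^ p) := by
        gcongr
    _ = _ := by ring

/-- A convolution operator satisfying the `L²` bound and `H(1)` is bounded on `L^p`, `1 < p < ∞`,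
with a constant that depends neither on the group nor on the chain. The set of summation in `H(1)`
is written as `Set.toFinite`, so that no decidability instance occurs in the statement. -/
lemma exists_unweighted_bound {A B D p : ℝ} (hA : 0 ≤ A) (hB : 1 ≤ B) (hD : 0 ≤ D) (hp : 1 < p) :
    ∃ C : ℝ, 0 ≤ C ∧ ∀ {Q : Type v} [Group Q] [Fintype Q] (𝒩 : NormalChain Q) (r : Q → ℂ),
      (∀ n < 𝒩.depth, 𝒩.vol n ≤ B * 𝒩.vol (n + 1)) →
      (∀ f : Q → ℂ, ∑ x, ‖(convMatrix r *ᵥ f) x‖ ^ 2 ≤ A * ∑ x, ‖f x‖ ^ 2) →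
      (∀ l ≤ 𝒩.depth, ∀ y ∈ 𝒩.subgroup l, mean (Set.toFinite {z | z ∉ 𝒩.subgroup l}).toFinset
        (fun z => ‖r (z * y⁻¹) - r z‖) ≤ D) →
      ∀ f : Q → ℂ, ∑ x, ‖(convMatrix r *ᵥ f) x‖ ^ p ≤ C * ∑ x, ‖f x‖ ^ p := by
  classical
  obtain ⟨C, hC, H⟩ := BlockTree.exists_sum_mulVec_rpow_le.{v} hA hB hD hp
  refine ⟨C, hC, ?_⟩
  intro Q _ _ 𝒩 r hdbl hL2 hH
  have hhor := hormander_convMatrix (𝒩 := 𝒩) (r := r) hD (by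
    intro l hl y hy
    convert hH l hl y hy using 2
    ext; simp)
  refine H 𝒩.tree (convMatrix r) (fun n x => ?_) hL2 hhor.1 hhor.2
  rw [card_block, card_block]
  have hM := card_pos (Q := Q)
  have hv := 𝒩.vol_pos n
  rcases lt_or_ge n 𝒩.depth with hn | hn
  · rw [mul_left_comm]
    gcongr
    exact hdbl n hn
  · have : 𝒩.vol (n + 1) = 𝒩.vol n := by
      have h1 : 𝒩.subgroup n = ⊥ := le_bot_iff.1 (𝒩.depth_eq_bot ▸ 𝒩.antitone hn)
      have h2 : 𝒩.subgroup (n + 1) = ⊥ :=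
        le_bot_iff.1 (𝒩.depth_eq_bot ▸ 𝒩.antitone (hn.trans n.le_succ))
      rw [vol, vol, h1, h2]
    rw [this]
    exact le_mul_of_one_le_left (by positivity) hB

/-- A convolution operator satisfying the `L²` bound and `H(t)`, `t > 1`, is bounded on `L^p` with
the weight `|x| ^ α`, with a constant that depends neither on the group nor on the chain. -/
lemma exists_weighted_bound {A B D p t ε α : ℝ} (hA : 0 ≤ A) (hB : 1 ≤ B) (hD : 0 ≤ D)
    (hp : 1 < p) (ht : 1 < t) (hε : 0 < ε) (hα1 : -(1 - 1 / t) < α)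
    (hα2 : α < (p - 1) * (1 - 1 / t)) :
    ∃ C : ℝ, 0 ≤ C ∧ ∀ {Q : Type v} [Group Q] [Fintype Q] (𝒩 : NormalChain Q) (r : Q → ℂ),
      (∀ n < 𝒩.depth, 𝒩.vol n ≤ B * 𝒩.vol (n + 1)) →
      (∀ f : Q → ℂ, ∑ x, ‖(convMatrix r *ᵥ f) x‖ ^ 2 ≤ A * ∑ x, ‖f x‖ ^ 2) →
      𝒩.TranslationBound r t ε D →
      ∀ f : Q → ℂ, ∑ x, 𝒩.vol (𝒩.level x) ^ α * ‖(convMatrix r *ᵥ f) x‖ ^ p ≤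
        C * ∑ x, 𝒩.vol (𝒩.level x) ^ α * ‖f x‖ ^ p := by
  classical
  have hε1 : (1 / 2 : ℝ) ^ ε < 1 := Real.rpow_lt_one (by norm_num) (by norm_num) hε
  have hD' : 0 ≤ D * (1 - (1 / 2 : ℝ) ^ ε)⁻¹ := by
    have : 0 < 1 - (1 / 2 : ℝ) ^ ε := by linarith
    positivity
  obtain ⟨C, -, H⟩ := exists_unweighted_bound.{v} hA hB hD' hp
  set θ := 1 - 1 / t with hθ
  have hθ0 : 0 < θ := by
    rw [hθ, sub_pos, div_lt_one (by linarith)]; exact ht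
  set q := p.conjExponent with hqdef
  have hpq : p.HolderConjugate q := Real.HolderConjugate.conjExponent hp
  -- The exponent of the test function in Schur's test lies in the intersection of the intervals
  -- `(0, (p - 1) θ)` and `(α, α + θ)`.
  obtain ⟨σ, hσ1, hσ2⟩ := exists_between (show max 0 α < min ((p - 1) * θ) (α + θ) by
    refine max_lt (lt_min (mul_pos (by linarith) hθ0) (by linarith)) (lt_min hα2 (by linarith)))
  rw [max_lt_iff] at hσ1
  rw [lt_min_iff] at hσ2
  have hσq : σ * (q / p) < θ := by
    have : q / p = (p - 1)⁻¹ := by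
      rw [hqdef, Real.conjExponent]
      have : p ≠ 0 := by linarith
      have : p - 1 ≠ 0 := by linarith
      field_simp
    rw [this, ← div_eq_mul_inv, div_lt_iff₀ (by linarith), mul_comm]
    exact hσ2.1
  refine ⟨max 0 (2 ^ (p - 1) * (C + ((D + √A * B) * (2 * (1 - (1 / 2 : ℝ) ^
    min (σ * (q / p)) (θ - σ * (q / p)))⁻¹)) ^ (p / q) * ((D + √A * B) *
      (2 * (1 - (1 / 2 : ℝ) ^ min (σ - α) (θ - (σ - α)))⁻¹)))), le_max_left _ _, ?_⟩
  intro Q _ _ 𝒩 r hdbl hL2 hT f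
  have hC := H 𝒩 r hdbl hL2 (fun l hl y hy => by
    convert hT.mean_compl_le ht hε hD hl hy using 2
    ext; simp)
  have hS := hT.shellBound ht hε hD hA (by linarith) hdbl hL2
  refine (hS.weighted_bound (by positivity) hpq hσ1.1 hσq hσ1.2 hσ2.2 hC f).trans ?_
  refine mul_le_mul_of_nonneg_right (le_max_right _ _) ?_
  exact Finset.sum_nonneg fun x _ => mul_nonneg (Real.rpow_nonneg (𝒩.vol_pos _).le _)
    (by positivity)

end NormalChain

/-! ### Schur's lemma and Schur orthogonality -/

namespace UnitaryRep

variable {G : Type*} [Group G] [TopologicalSpace G]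

lemma mat_mul (π : UnitaryRep G) (x y : G) : π.mat (x * y) = π.mat x * π.mat y := by
  simp [mat]

lemma mat_one (π : UnitaryRep G) : π.mat 1 = 1 := by simp [mat]

lemma conjTranspose_mul_mat (π : UnitaryRep G) (x : G) : (π.mat x)ᴴ * π.mat x = 1 :=
  Matrix.mem_unitaryGroup_iff'.1 (π.toHom x).2

lemma mat_mul_conjTranspose (π : UnitaryRep G) (x : G) : π.mat x * (π.mat x)ᴴ = 1 :=
  Matrix.mem_unitaryGroup_iff.1 (π.toHom x).2

lemma mat_inv (π : UnitaryRep G) (x : G) : π.mat x⁻¹ = (π.mat x)ᴴ := by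
  have h : π.mat x⁻¹ * π.mat x = 1 := by rw [← mat_mul, inv_mul_cancel, mat_one]
  calc π.mat x⁻¹ = π.mat x⁻¹ * (π.mat x * (π.mat x)ᴴ) := by rw [mat_mul_conjTranspose, mul_one]
    _ = (π.mat x)ᴴ := by rw [← mul_assoc, h, one_mul]

lemma continuous_mat (π : UnitaryRep G) : Continuous π.mat :=
  continuous_subtype_val.comp π.continuous_toHom

lemma continuous_mat_apply (π : UnitaryRep G) (i j : Fin π.dim) :
    Continuous fun x => π.mat x i j :=
  (continuous_apply j).comp ((continuous_apply i).comp π.continuous_mat)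

/-- Schur's lemma: a matrix commuting with an irreducible representation is scalar. -/
lemma IsIrreducible.eq_smul_one {π : UnitaryRep G} (hπ : π.IsIrreducible)
    {M : Matrix (Fin π.dim) (Fin π.dim) ℂ} (hM : ∀ x, π.mat x * M = M * π.mat x) :
    ∃ c : ℂ, M = c • (1 : Matrix (Fin π.dim) (Fin π.dim) ℂ) := by
  have : Nonempty (Fin π.dim) := ⟨⟨0, hπ.1⟩⟩
  obtain ⟨c, hc⟩ := Module.End.exists_eigenvalue (Matrix.toLin' M)
  refine ⟨c, ?_⟩
  rcases hπ.2 (Module.End.eigenspace (Matrix.toLin' M) c) (fun x v hv => by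
    rw [Module.End.mem_eigenspace_iff, Matrix.toLin'_apply] at hv ⊢
    rw [Matrix.mulVec_mulVec, ← hM, ← Matrix.mulVec_mulVec, hv, Matrix.mulVec_smul]) with h | h
  · exact absurd h hc
  · refine Matrix.toLin'.injective (LinearMap.ext fun v => ?_)
    have hv : v ∈ Module.End.eigenspace (Matrix.toLin' M) c := h ▸ Submodule.mem_top
    rw [Module.End.mem_eigenspace_iff] at hv
    simpa using hv

/-- Schur's lemma: a nonzero intertwiner between irreducible representations is a multiple of a
unitary intertwiner. -/
lemma IsIrreducible.exists_isIntertwiner {π π' : UnitaryRep G} (hπ : π.IsIrreducible)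
    (hπ' : π'.IsIrreducible) {A : Matrix (Fin π'.dim) (Fin π.dim) ℂ}
    (hA : ∀ x, π'.mat x * A = A * π.mat x) (hA0 : A ≠ 0) :
    ∃ U, IsIntertwiner π π' U := by
  have hA' : ∀ x, π.mat x * Aᴴ = Aᴴ * π'.mat x := fun x => by
    have := congrArg Matrix.conjTranspose (hA x⁻¹)
    simpa [Matrix.conjTranspose_mul, mat_inv] using this.symm
  obtain ⟨c, hc⟩ := hπ.eq_smul_one (M := Aᴴ * A) fun x => by
    rw [← Matrix.mul_assoc, hA', Matrix.mul_assoc, hA, Matrix.mul_assoc]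
  obtain ⟨c', hc'⟩ := hπ'.eq_smul_one (M := A * Aᴴ) fun x => by
    rw [← Matrix.mul_assoc, hA, Matrix.mul_assoc, hA', Matrix.mul_assoc]
  -- `A * Aᴴ * A` computed in two ways.
  have hcc : c = c' := by
    have h1 : c • A = c' • A := by
      calc c • A = A * (Aᴴ * A) := by rw [hc]; simp
        _ = c' • A := by rw [← Matrix.mul_assoc, hc']; simp
    by_contra hne
    exact hA0 (by
      have : (c - c') • A = 0 := by rw [sub_smul, h1, sub_self]
      exact (smul_eq_zero.1 this).resolve_left (sub_ne_zero.2 hne))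
  -- The scalar is the squared norm of a column of `A`, hence nonnegative.
  obtain ⟨i, j, hij⟩ : ∃ i j, A i j ≠ 0 := by
    by_contra hcon
    push Not at hcon
    exact hA0 (Matrix.ext hcon)
  have hcval : c = ((∑ k, ‖A k j‖ ^ 2 : ℝ) : ℂ) := by
    have := congrFun (congrFun hc j) j
    simp only [Matrix.mul_apply, Matrix.conjTranspose_apply, Matrix.smul_apply,
      Matrix.one_apply_eq, smul_eq_mul, mul_one] at this
    rw [← this]
    push_cast
    refine Finset.sum_congr rfl fun k _ => ?_
    rw [← starRingEnd_apply, Complex.conj_mul']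
  set s : ℝ := ∑ k, ‖A k j‖ ^ 2
  have hs : 0 < s := by
    refine Finset.sum_pos' (fun _ _ => by positivity) ⟨i, Finset.mem_univ _, ?_⟩
    have : 0 < ‖A i j‖ := norm_pos_iff.2 hij
    positivity
  have hs' : (((√s)⁻¹ : ℝ) : ℂ) * (((√s)⁻¹ : ℝ) : ℂ) * (s : ℂ) = 1 := by
    rw [← Complex.ofReal_mul, ← Complex.ofReal_mul, ← mul_inv, Real.mul_self_sqrt hs.le,
      inv_mul_cancel₀ hs.ne', Complex.ofReal_one]
  set b : ℂ := (((√s)⁻¹ : ℝ) : ℂ) with hb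
  have hbstar : star b = b := by rw [hb, ← starRingEnd_apply, Complex.conj_ofReal]
  have hU2 : (b • A) * (b • A)ᴴ = 1 := by
    rw [Matrix.conjTranspose_smul, hbstar, Matrix.smul_mul, Matrix.mul_smul, hc', ← hcc, hcval,
      smul_smul, smul_smul, hs', one_smul]
  refine ⟨b • A, ?_, hU2, fun x => ?_⟩
  · rw [Matrix.conjTranspose_smul, hbstar, Matrix.smul_mul, Matrix.mul_smul, hc, hcval,
      smul_smul, smul_smul, hs', one_smul]
  · rw [Matrix.smul_mul, ← hA, ← Matrix.mul_smul, Matrix.mul_assoc, hU2, mul_one]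

variable [IsTopologicalGroup G] [CompactSpace G] [MeasurableSpace G] [BorelSpace G]
  (μ : Measure G) [μ.IsHaarMeasure] [IsProbabilityMeasure μ]

omit [IsTopologicalGroup G] [IsProbabilityMeasure μ] in
lemma integrable_mat_mul_star (π π' : UnitaryRep G) (i j k l) :
    Integrable (fun x => π'.mat x i j * star (π.mat x k l)) μ :=
  Continuous.integrable_of_hasCompactSupport
    ((π'.continuous_mat_apply i j).mul (π.continuous_mat_apply k l).star)
    (HasCompactSupport.of_compactSpace _)

omit [IsProbabilityMeasure μ] in
/-- The matrix `∫ π'(x) E_{jl} π(x)* dx` intertwines `π` and `π'`. -/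
lemma mat_mul_integral (π π' : UnitaryRep G) (j l) (y : G) :
    π'.mat y * (Matrix.of fun i k => ∫ x, π'.mat x i j * star (π.mat x k l) ∂μ) =
      (Matrix.of fun i k => ∫ x, π'.mat x i j * star (π.mat x k l) ∂μ) * π.mat y := by
  ext i k
  simp only [Matrix.mul_apply, Matrix.of_apply]
  have h1 : ∑ m, π'.mat y i m * ∫ x, π'.mat x m j * star (π.mat x k l) ∂μ =
      ∫ x, π'.mat (y * x) i j * star (π.mat x k l) ∂μ := by
    simp_rw [← integral_const_mul]
    rw [← integral_finsetSum _ fun m _ => (integrable_mat_mul_star μ π π' _ _ _ _).const_mul _]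
    refine integral_congr_ae (.of_forall fun x => ?_)
    simp only [mat_mul, Matrix.mul_apply, Finset.sum_mul, mul_assoc]
  have h2 : ∑ m, (∫ x, π'.mat x i j * star (π.mat x m l) ∂μ) * π.mat y m k =
      ∫ x, π'.mat x i j * star (π.mat (y⁻¹ * x) k l) ∂μ := by
    simp_rw [← integral_mul_const]
    rw [← integral_finsetSum _ fun m _ => (integrable_mat_mul_star μ π π' _ _ _ _).mul_const _]
    refine integral_congr_ae (.of_forall fun x => ?_)
    simp only [mat_mul, Matrix.mul_apply, mat_inv, Matrix.conjTranspose_apply, star_sum,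
      star_mul, star_star, Finset.mul_sum]
    refine Finset.sum_congr rfl fun m _ => by ring
  rw [h1, h2, ← integral_mul_left_eq_self (fun x => π'.mat x i j * star (π.mat (y⁻¹ * x) k l)) y]
  simp

omit [IsProbabilityMeasure μ] in
/-- Schur orthogonality for inequivalent representations. -/
lemma integral_mat_mul_star_of_not_equiv {π π' : UnitaryRep G} (hπ : π.IsIrreducible)
    (hπ' : π'.IsIrreducible) (h : ¬ ∃ U, IsIntertwiner π π' U) (i j k l) :
    ∫ x, π'.mat x i j * star (π.mat x k l) ∂μ = 0 := by
  by_contra hne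
  refine h (hπ.exists_isIntertwiner hπ' (mat_mul_integral μ π π' j l) fun h0 => hne ?_)
  exact congrFun (congrFun h0 i) k

/-- Schur orthogonality for the coefficients of one representation. -/
lemma integral_mat_mul_star {π : UnitaryRep G} (hπ : π.IsIrreducible) (i j k l) :
    ∫ x, π.mat x i j * star (π.mat x k l) ∂μ =
      if i = k ∧ j = l then (π.dim : ℂ)⁻¹ else 0 := by
  obtain ⟨c, hc⟩ := hπ.eq_smul_one (mat_mul_integral μ π π j l)
  have hval : ∀ i k, ∫ x, π.mat x i j * star (π.mat x k l) ∂μ = if i = k then c else 0 := by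
    intro i k
    have := congrFun (congrFun hc i) k
    simpa [Matrix.one_apply] using this
  have htr : (π.dim : ℂ) * c = if j = l then 1 else 0 := by
    calc (π.dim : ℂ) * c = ∑ i, ∫ x, π.mat x i j * star (π.mat x i l) ∂μ := by
          simp only [hval]; simp
      _ = ∫ x, (1 : Matrix (Fin π.dim) (Fin π.dim) ℂ) l j ∂μ := by
          rw [← integral_finsetSum _ fun m _ => integrable_mat_mul_star μ π π _ _ _ _]
          refine integral_congr_ae (.of_forall fun x => ?_)
          dsimp only
          rw [← π.conjTranspose_mul_mat x, Matrix.mul_apply]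
          exact Finset.sum_congr rfl fun m _ => mul_comm _ _
      _ = _ := by simp [Matrix.one_apply, eq_comm]
  have hd : (π.dim : ℂ) ≠ 0 := by exact_mod_cast hπ.1.ne'
  rw [hval]
  by_cases hik : i = k <;> by_cases hjl : j = l
  · simp only [hik, hjl, and_self, if_true] at htr ⊢
    exact eq_inv_of_mul_eq_one_right htr
  · simp only [hik, hjl, and_false, if_true, if_false] at htr ⊢
    exact (mul_eq_zero.1 htr).resolve_left hd
  all_goals simp [hik]

end UnitaryRep

/-! ### The unitary dual and the Fourier transform -/

namespace UnitaryDual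

variable {G : Type*} [Group G] [TopologicalSpace G]

lemma isIrreducible_rep (ξ : UnitaryDual G) : ξ.rep.IsIrreducible := (Quotient.out ξ).2

lemma eq_of_isIntertwiner {ξ η : UnitaryDual G} (h : ∃ U, UnitaryRep.IsIntertwiner ξ.rep η.rep U) :
    ξ = η := by
  rw [← Quotient.out_eq ξ, ← Quotient.out_eq η]
  exact Quotient.sound h

/-- The normalized matrix coefficient `√d_ξ ξ_{ij}`, for `a = (ξ, i, j)`. -/
noncomputable def coeff (a : Σ ξ : UnitaryDual G, Fin ξ.rep.dim × Fin ξ.rep.dim) : C(G, ℂ) where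
  toFun x := (√(a.1.rep.dim : ℝ) : ℂ) * a.1.rep.mat x a.2.1 a.2.2
  continuous_toFun := continuous_const.mul (a.1.rep.continuous_mat_apply _ _)

lemma coeff_apply (ξ : UnitaryDual G) (i j : Fin ξ.rep.dim) (x : G) :
    coeff ⟨ξ, i, j⟩ x = (√(ξ.rep.dim : ℝ) : ℂ) * ξ.rep.mat x i j := rfl

variable [IsTopologicalGroup G] [CompactSpace G] [MeasurableSpace G] [BorelSpace G]
  (μ : Measure G) [μ.IsHaarMeasure] [IsProbabilityMeasure μ]

/-- The normalized matrix coefficients are orthonormal in `L²`. -/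
lemma orthonormal_coeff : Orthonormal ℂ
    fun a : Σ ξ : UnitaryDual G, Fin ξ.rep.dim × Fin ξ.rep.dim =>
      ContinuousMap.toLp 2 μ ℂ (coeff a) := by
  classical
  rw [orthonormal_iff_ite]
  rintro ⟨ξ, i, j⟩ ⟨η, k, l⟩
  rw [ContinuousMap.inner_toLp]
  have h1 : ∀ x, coeff ⟨η, k, l⟩ x * (starRingEnd ℂ) (coeff ⟨ξ, i, j⟩ x) =
      ((√(η.rep.dim : ℝ) : ℂ) * (√(ξ.rep.dim : ℝ) : ℂ)) *
        (η.rep.mat x k l * star (ξ.rep.mat x i j)) := fun x => by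
    rw [coeff_apply, coeff_apply, map_mul, Complex.conj_ofReal, starRingEnd_apply]; ring
  simp only [h1]
  rw [integral_const_mul]
  by_cases hξη : ξ = η
  · subst hξη
    rw [UnitaryRep.integral_mat_mul_star μ ξ.isIrreducible_rep, ← Complex.ofReal_mul,
      Real.mul_self_sqrt (by positivity)]
    have hd : (ξ.rep.dim : ℂ) ≠ 0 := by exact_mod_cast ξ.isIrreducible_rep.1.ne'
    by_cases h : k = i ∧ l = j
    · obtain ⟨rfl, rfl⟩ := h
      simp [hd]
    · rw [if_neg h, if_neg, mul_zero]
      intro h'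
      simp only [Sigma.mk.injEq, heq_eq_eq, Prod.mk.injEq, true_and] at h'
      exact h ⟨h'.1.symm, h'.2.symm⟩
  · rw [UnitaryRep.integral_mat_mul_star_of_not_equiv μ ξ.isIrreducible_rep η.isIrreducible_rep
      (fun h => hξη (eq_of_isIntertwiner h)), mul_zero, if_neg]
    exact fun h => hξη (congrArg Sigma.fst h)

omit [Group G] [IsTopologicalGroup G] [μ.IsHaarMeasure] in
lemma norm_toLp_sq (f : C(G, ℂ)) : ‖ContinuousMap.toLp 2 μ ℂ f‖ ^ 2 = ∫ x, ‖f x‖ ^ 2 ∂μ := by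
  rw [@norm_sq_eq_re_inner ℂ, ContinuousMap.inner_toLp]
  have : ∀ x, f x * (starRingEnd ℂ) (f x) = ((‖f x‖ ^ 2 : ℝ) : ℂ) := fun x => by
    rw [Complex.mul_conj']; norm_cast
  simp only [this]
  rw [integral_complex_ofReal]; simp

omit [IsTopologicalGroup G] [CompactSpace G] [BorelSpace G] [μ.IsHaarMeasure]
  [IsProbabilityMeasure μ] in
lemma groupFourier_apply (f : G → ℂ) (π : UnitaryRep G) (i j : Fin π.dim) :
    groupFourier μ f π i j = ∫ x, f x * star (π.mat x j i) ∂μ := rfl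

omit [IsTopologicalGroup G] [μ.IsHaarMeasure] in
lemma inner_coeff (f : C(G, ℂ)) (ξ : UnitaryDual G) (i j : Fin ξ.rep.dim) :
    inner ℂ (ContinuousMap.toLp 2 μ ℂ (coeff ⟨ξ, i, j⟩)) (ContinuousMap.toLp 2 μ ℂ f) =
      (√(ξ.rep.dim : ℝ) : ℂ) * groupFourier μ f ξ.rep j i := by
  rw [ContinuousMap.inner_toLp, groupFourier_apply, ← integral_const_mul]
  refine integral_congr_ae (.of_forall fun x => ?_)
  dsimp only
  rw [coeff_apply, map_mul, Complex.conj_ofReal, starRingEnd_apply]; ring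

/-- Bessel's inequality for the group Fourier transform. -/
lemma sum_groupFourier_sq_le (f : C(G, ℂ)) (F : Finset (UnitaryDual G)) :
    ∑ ξ ∈ F, (ξ.rep.dim : ℝ) * ∑ i, ∑ j, ‖groupFourier μ f ξ.rep i j‖ ^ 2 ≤
      ∫ x, ‖f x‖ ^ 2 ∂μ := by
  have h := (orthonormal_coeff μ).sum_inner_products_le (ContinuousMap.toLp 2 μ ℂ f)
    (s := F.sigma fun _ => Finset.univ)
  rw [norm_toLp_sq, Finset.sum_sigma] at h
  refine le_trans (le_of_eq (Finset.sum_congr rfl fun ξ _ => ?_)) h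
  rw [Fintype.sum_prod_type, Finset.sum_comm, Finset.mul_sum]
  refine Finset.sum_congr rfl fun i _ => ?_
  rw [Finset.mul_sum]
  refine Finset.sum_congr rfl fun j _ => ?_
  rw [inner_coeff, norm_mul, mul_pow, Complex.norm_real, Real.norm_of_nonneg (by positivity),
    Real.sq_sqrt (by positivity)]

/-- Parseval's identity for a finite Fourier series. -/
lemma integral_sum_trace_sq (F : Finset (UnitaryDual G))
    (φ : (π : UnitaryRep G) → Matrix (Fin π.dim) (Fin π.dim) ℂ) :
    ∫ x, ‖∑ ξ ∈ F, (ξ.rep.dim : ℂ) * (ξ.rep.mat x * φ ξ.rep).trace‖ ^ 2 ∂μ =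
      ∑ ξ ∈ F, (ξ.rep.dim : ℝ) * ∑ i, ∑ j, ‖φ ξ.rep i j‖ ^ 2 := by
  set c : (Σ ξ : UnitaryDual G, Fin ξ.rep.dim × Fin ξ.rep.dim) → ℂ :=
    fun a => (√(a.1.rep.dim : ℝ) : ℂ) * φ a.1.rep a.2.2 a.2.1 with hc
  set s : Finset (Σ ξ : UnitaryDual G, Fin ξ.rep.dim × Fin ξ.rep.dim) :=
    F.sigma fun _ => Finset.univ
  set g : C(G, ℂ) := ∑ a ∈ s, c a • coeff a with hg
  have hd : ∀ ξ : UnitaryDual G,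
      (√(ξ.rep.dim : ℝ) : ℂ) * (√(ξ.rep.dim : ℝ) : ℂ) = (ξ.rep.dim : ℂ) := fun ξ => by
    rw [← Complex.ofReal_mul, Real.mul_self_sqrt (by positivity)]; simp
  have h1 : ∀ x, g x = ∑ ξ ∈ F, (ξ.rep.dim : ℂ) * (ξ.rep.mat x * φ ξ.rep).trace := by
    intro x
    rw [hg, ContinuousMap.sum_apply, Finset.sum_sigma]
    refine Finset.sum_congr rfl fun ξ _ => ?_
    rw [Fintype.sum_prod_type, Matrix.trace, Finset.mul_sum]
    refine Finset.sum_congr rfl fun i _ => ?_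
    rw [Matrix.diag_apply, Matrix.mul_apply, Finset.mul_sum]
    refine Finset.sum_congr rfl fun j _ => ?_
    rw [ContinuousMap.smul_apply, coeff_apply, smul_eq_mul, ← hd]
    simp only [hc]
    ring
  have h2 := (orthonormal_coeff μ).inner_sum c c s
  have h3 : ∑ a ∈ s, c a • ContinuousMap.toLp 2 μ ℂ (coeff a) = ContinuousMap.toLp 2 μ ℂ g := by
    rw [hg, map_sum]; simp
  have h4 : ‖ContinuousMap.toLp 2 μ ℂ g‖ ^ 2 = ∑ a ∈ s, ‖c a‖ ^ 2 := by
    rw [@norm_sq_eq_re_inner ℂ, ← h3, h2, map_sum]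
    refine Finset.sum_congr rfl fun a _ => ?_
    rw [Complex.conj_mul']; norm_cast
  rw [norm_toLp_sq] at h4
  simp only [h1] at h4
  rw [h4, Finset.sum_sigma]
  refine Finset.sum_congr rfl fun ξ _ => ?_
  rw [Fintype.sum_prod_type, Finset.sum_comm, Finset.mul_sum]
  refine Finset.sum_congr rfl fun i _ => ?_
  rw [Finset.mul_sum]
  refine Finset.sum_congr rfl fun j _ => ?_
  simp only [hc]
  rw [norm_mul, mul_pow, Complex.norm_real, Real.norm_of_nonneg (by positivity),
    Real.sq_sqrt (by positivity)]

end UnitaryDual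

/-! ### Functions and representations of a given level -/

/-- Left multiplication by a matrix is bounded in the Hilbert–Schmidt norm by its operator norm. -/
lemma Matrix.sum_norm_mul_sq_le {n : ℕ} (S M : Matrix (Fin n) (Fin n) ℂ) {C : ℝ}
    (hC : ‖Matrix.toEuclideanCLM (𝕜 := ℂ) S‖ ≤ C) :
    ∑ i, ∑ j, ‖(S * M) i j‖ ^ 2 ≤ C ^ 2 * ∑ i, ∑ j, ‖M i j‖ ^ 2 := by
  rw [Finset.sum_comm, Finset.sum_comm (f := fun i j => ‖M i j‖ ^ 2), Finset.mul_sum]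
  refine Finset.sum_le_sum fun j _ => ?_
  have h := (Matrix.toEuclideanCLM (𝕜 := ℂ) S).le_of_opNorm_le hC (WithLp.toLp 2 fun i => M i j)
  have h2 := pow_le_pow_left₀ (norm_nonneg _) h 2
  rw [mul_pow, EuclideanSpace.norm_sq_eq, EuclideanSpace.norm_sq_eq] at h2
  simpa [Matrix.mulVec, dotProduct, Matrix.mul_apply] using h2

namespace VilenkinFiltration

variable {G : Type*} [Group G] [TopologicalSpace G] (V : VilenkinFiltration G)

/-- The functions that are invariant under right translations by elements of `G_l`. -/
def IsLevel (l : ℕ) (f : G → ℂ) : Prop := ∀ x, ∀ y ∈ V.subgroup l, f (x * y) = f x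

/-- The representation `π` is trivial on `G_k`. -/
def IsTrivialOn (k : ℕ) (π : UnitaryRep G) : Prop := ∀ y ∈ V.subgroup k, π.mat y = 1

variable {V}

lemma IsLevel.continuous [IsTopologicalGroup G] {l : ℕ} {f : G → ℂ} (hf : V.IsLevel l f) :
    Continuous f := by
  refine IsLocallyConstant.continuous ((IsLocallyConstant.iff_eventually_eq f).2 fun x => ?_)
  have h : {z | x⁻¹ * z ∈ V.subgroup l} ∈ nhds x :=
    ((V.isOpen l).preimage (continuous_const_mul x⁻¹)).mem_nhds (by simp [one_mem])
  filter_upwards [h] with z hz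
  simpa using hf x _ hz

lemma IsLevel.mono {l m : ℕ} (h : l ≤ m) {f : G → ℂ} (hf : V.IsLevel l f) : V.IsLevel m f :=
  fun x y hy => hf x y (V.strictAnti.antitone h hy)

/-- An irreducible representation that is nontrivial on the normal subgroup `G_k` has no nonzero
vector fixed by `G_k`. -/
lemma eq_zero_of_fixed {π : UnitaryRep G} (hπ : π.IsIrreducible) {k : ℕ}
    (hk : ¬ V.IsTrivialOn k π) {v : Fin π.dim → ℂ} (hv : ∀ y ∈ V.subgroup k, π.mat y *ᵥ v = v) :
    v = 0 := by
  let W : Submodule ℂ (Fin π.dim → ℂ) :=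
    { carrier := {v | ∀ y ∈ V.subgroup k, π.mat y *ᵥ v = v}
      add_mem' := fun {a b} ha hb y hy => by rw [Matrix.mulVec_add, ha y hy, hb y hy]
      zero_mem' := fun y _ => Matrix.mulVec_zero _
      smul_mem' := fun c a ha y hy => by rw [Matrix.mulVec_smul, ha y hy] }
  have hW : ∀ x : G, ∀ v ∈ W, π.mat x *ᵥ v ∈ W := by
    intro x v hv y hy
    have h1 : x⁻¹ * y * x ∈ V.subgroup k := by
      simpa using (V.normal k).conj_mem y hy x⁻¹
    have h2 := hv _ h1
    calc π.mat y *ᵥ (π.mat x *ᵥ v) = π.mat x *ᵥ (π.mat (x⁻¹ * y * x) *ᵥ v) := by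
          rw [Matrix.mulVec_mulVec, Matrix.mulVec_mulVec, ← π.mat_mul, ← π.mat_mul]
          congr 2; group
      _ = π.mat x *ᵥ v := by rw [h2]
  rcases hπ.2 W hW with h | h
  · have : v ∈ W := hv
    rw [h] at this
    simpa using this
  · refine absurd (fun y hy => ?_) hk
    refine Matrix.toLin'.injective (LinearMap.ext fun w => ?_)
    have hw : w ∈ W := h ▸ Submodule.mem_top
    simpa using hw y hy

variable [IsTopologicalGroup G] [CompactSpace G] [MeasurableSpace G] [BorelSpace G]
  (μ : Measure G) [μ.IsHaarMeasure] [IsProbabilityMeasure μ]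

omit [IsTopologicalGroup G] [IsProbabilityMeasure μ] in
lemma integrable_mul_star {f : G → ℂ} (hf : Continuous f) (π : UnitaryRep G) (i j) :
    Integrable (fun x => f x * star (π.mat x i j)) μ :=
  Continuous.integrable_of_hasCompactSupport (hf.mul (π.continuous_mat_apply i j).star)
    (HasCompactSupport.of_compactSpace _)

omit [IsProbabilityMeasure μ] in
/-- The Fourier transform of a function of level `k` lives on the representations trivial on
`G_k`. -/
lemma IsLevel.groupFourier_eq_zero {k : ℕ} {f : G → ℂ} (hf : V.IsLevel k f) {π : UnitaryRep G}
    (hπ : π.IsIrreducible) (hk : ¬ V.IsTrivialOn k π) : groupFourier μ f π = 0 := by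
  have hleft : ∀ y ∈ V.subgroup k, ∀ x, f (y * x) = f x := fun y hy x => by
    have h1 : x⁻¹ * y * x ∈ V.subgroup k := by simpa using (V.normal k).conj_mem y hy x⁻¹
    rw [← hf x _ h1]; congr 1; group
  ext j i
  have h := eq_zero_of_fixed hπ hk (v := fun i => star (groupFourier μ f π j i)) (fun y hy => by
    ext i
    have h1 : ∑ m, star (π.mat y i m) * groupFourier μ f π j m = groupFourier μ f π j i := by
      simp only [UnitaryDual.groupFourier_apply]
      simp_rw [← integral_const_mul]
      rw [← integral_finsetSum _ fun m _ =>
          (integrable_mul_star μ hf.continuous π _ _).const_mul _,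
        ← integral_mul_left_eq_self (fun x => f x * star (π.mat x i j)) y]
      refine integral_congr_ae (.of_forall fun x => ?_)
      dsimp only
      rw [hleft y hy, π.mat_mul, Matrix.mul_apply, star_sum, Finset.mul_sum]
      refine Finset.sum_congr rfl fun m _ => ?_
      rw [star_mul]
      ring
    have h2 := congrArg star h1
    simpa [Matrix.mulVec, dotProduct] using h2)
  simpa using congrFun h i

end VilenkinFiltration

/-! ### Multipliers on functions of a given level -/

namespace VilenkinFiltration

variable {G : Type*} [Group G] [TopologicalSpace G] {V : VilenkinFiltration G}
  [IsTopologicalGroup G] [CompactSpace G] [MeasurableSpace G] [BorelSpace G]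
  (μ : Measure G) [μ.IsHaarMeasure] [IsProbabilityMeasure μ]

omit [CompactSpace G] [IsTopologicalGroup G] in
lemma measurableSet_subgroup (n : ℕ) : MeasurableSet (V.subgroup n : Set G) :=
  (V.isOpen n).measurableSet

omit [CompactSpace G] [IsTopologicalGroup G] [BorelSpace G] in
lemma vol_pos (n : ℕ) : 0 < V.vol μ n :=
  ENNReal.toReal_pos ((V.isOpen n).measure_pos μ ⟨1, one_mem _⟩).ne' (measure_ne_top _ _)

omit [MeasurableSpace G] [BorelSpace G] [IsTopologicalGroup G] [CompactSpace G] in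
lemma isLevel_indicator (k : ℕ) (c : ℂ) :
    V.IsLevel k ((V.subgroup k : Set G).indicator fun _ => c) := by
  intro x y hy
  by_cases hx : x ∈ V.subgroup k
  · simp [Set.indicator, hx, mul_mem hx hy]
  · have : x * y ∉ V.subgroup k := fun h => hx ((Subgroup.mul_mem_cancel_right _ hy).1 h)
    simp [Set.indicator, hx, this]

omit [CompactSpace G] [IsTopologicalGroup G] in
lemma groupFourier_normIndicator {k : ℕ} {π : UnitaryRep G} (hk : V.IsTrivialOn k π) :
    groupFourier μ (V.normIndicator μ k) π = 1 := by
  ext i j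
  have h1 : ∀ x, V.normIndicator μ k x * star (π.mat x j i) =
      (V.subgroup k : Set G).indicator
        (fun _ => ((V.vol μ k : ℝ) : ℂ)⁻¹ * (1 : Matrix (Fin π.dim) (Fin π.dim) ℂ) i j) x := by
    intro x
    by_cases hx : x ∈ V.subgroup k
    · rw [normIndicator, Set.indicator_of_mem hx, Set.indicator_of_mem hx, hk x hx]
      simp [Matrix.one_apply, eq_comm]
    · simp [normIndicator, Set.indicator, hx]
  have hv : ((V.vol μ k : ℝ) : ℂ) ≠ 0 := by exact_mod_cast (vol_pos μ k).ne'
  rw [UnitaryDual.groupFourier_apply]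
  simp only [h1]
  rw [integral_indicator (measurableSet_subgroup k), setIntegral_const, Complex.real_smul,
    ← mul_assoc]
  change ((V.vol μ k : ℝ) : ℂ) * _ * _ = _
  rw [mul_inv_cancel₀ hv, one_mul]

include μ in
/-- Only finitely many classes of irreducible representations are trivial on `G_k`: by Bessel's
inequality for the normalized indicator function of `G_k`. -/
lemma finite_isTrivialOn (k : ℕ) : {ξ : UnitaryDual G | V.IsTrivialOn k ξ.rep}.Finite := by
  by_contra hinf
  let f : C(G, ℂ) := ⟨V.normIndicator μ k, (isLevel_indicator k _).continuous⟩
  obtain ⟨N, hN⟩ := exists_nat_gt (∫ x, ‖f x‖ ^ 2 ∂μ)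
  obtain ⟨F, hF, hcard⟩ := Set.Infinite.exists_subset_card_eq hinf N
  have h := UnitaryDual.sum_groupFourier_sq_le μ f F
  have h1 : (F.card : ℝ) ≤ ∑ ξ ∈ F,
      (ξ.rep.dim : ℝ) * ∑ i, ∑ j, ‖groupFourier μ f ξ.rep i j‖ ^ 2 := by
    rw [Finset.cast_card]
    refine Finset.sum_le_sum fun ξ hξ => ?_
    have hd : (1 : ℝ) ≤ ξ.rep.dim := by exact_mod_cast ξ.isIrreducible_rep.1
    have e : groupFourier μ f ξ.rep = 1 := groupFourier_normIndicator μ (hF hξ)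
    have : ∀ i j, ‖(1 : Matrix (Fin ξ.rep.dim) (Fin ξ.rep.dim) ℂ) i j‖ ^ 2 =
        if i = j then 1 else 0 := fun i j => by by_cases h : i = j <;> simp [Matrix.one_apply, h]
    simp only [e, this]
    simp only [Finset.sum_ite_eq, Finset.mem_univ, if_true, Finset.sum_const, Finset.card_univ,
      Fintype.card_fin, nsmul_eq_mul, mul_one]
    nlinarith
  rw [hcard] at h1
  linarith

variable (V) in
/-- The classes of irreducible representations that are trivial on `G_k`. -/
noncomputable def trivialOn (k : ℕ) : Finset (UnitaryDual G) :=
  (finite_isTrivialOn (V := V) μ k).toFinset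

lemma mem_trivialOn {k : ℕ} {ξ : UnitaryDual G} : ξ ∈ V.trivialOn μ k ↔ V.IsTrivialOn k ξ.rep := by
  simp [trivialOn]

lemma fourierMultiplier_eq_sum (σ : FourierSymbol G) {k : ℕ} {f : G → ℂ} (hf : V.IsLevel k f)
    (x : G) : fourierMultiplier μ σ f x = ∑ ξ ∈ V.trivialOn μ k,
      (ξ.rep.dim : ℂ) * (ξ.rep.mat x * (σ.toFun ξ.rep * groupFourier μ f ξ.rep)).trace := by
  refine tsum_eq_sum fun ξ hξ => ?_
  rw [mem_trivialOn] at hξ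
  simp [hf.groupFourier_eq_zero μ ξ.isIrreducible_rep hξ]

lemma truncKernel_eq_sum (σ : FourierSymbol G) (k : ℕ) (x : G) :
    V.truncKernel μ σ k x = ∑ ξ ∈ V.trivialOn μ k,
      (ξ.rep.dim : ℂ) * (ξ.rep.mat x * σ.toFun ξ.rep).trace := by
  have h : V.IsLevel k (V.normIndicator μ k) := isLevel_indicator k _
  rw [truncKernel, groupFourierInv, tsum_eq_sum (s := V.trivialOn μ k) fun ξ hξ => ?_]
  · refine Finset.sum_congr rfl fun ξ hξ => ?_
    rw [groupFourier_normIndicator μ ((mem_trivialOn μ).1 hξ), one_mul]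
  · rw [mem_trivialOn] at hξ
    simp [h.groupFourier_eq_zero μ ξ.isIrreducible_rep hξ]

lemma isLevel_truncKernel (σ : FourierSymbol G) (k : ℕ) :
    V.IsLevel k (V.truncKernel μ σ k) := by
  intro x y hy
  rw [truncKernel_eq_sum, truncKernel_eq_sum]
  refine Finset.sum_congr rfl fun ξ hξ => ?_
  rw [ξ.rep.mat_mul, (mem_trivialOn μ).1 hξ y hy, mul_one]

/-- On functions of level `k`, the Fourier multiplier is convolution with the truncated kernel. -/
lemma fourierMultiplier_eq_integral (σ : FourierSymbol G) {k : ℕ} {f : G → ℂ}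
    (hf : V.IsLevel k f) (x : G) :
    fourierMultiplier μ σ f x = ∫ y, f y * V.truncKernel μ σ k (y⁻¹ * x) ∂μ := by
  have hint : ∀ (ξ : UnitaryDual G) i j, Integrable (fun y => (ξ.rep.mat x * σ.toFun ξ.rep) i j *
      (f y * star (ξ.rep.mat y i j))) μ := fun ξ i j =>
    (integrable_mul_star μ hf.continuous ξ.rep i j).const_mul _
  have h1 : ∀ y, f y * V.truncKernel μ σ k (y⁻¹ * x) = ∑ ξ ∈ V.trivialOn μ k, (ξ.rep.dim : ℂ) *
      ∑ i, ∑ j, (ξ.rep.mat x * σ.toFun ξ.rep) i j * (f y * star (ξ.rep.mat y i j)) := by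
    intro y
    rw [truncKernel_eq_sum, Finset.mul_sum]
    refine Finset.sum_congr rfl fun ξ _ => ?_
    rw [mul_left_comm]
    congr 1
    rw [ξ.rep.mat_mul, ξ.rep.mat_inv, Matrix.mul_assoc, Matrix.trace_mul_comm, Matrix.trace,
      Finset.mul_sum]
    refine Finset.sum_congr rfl fun i _ => ?_
    rw [Matrix.diag_apply, Matrix.mul_apply, Finset.mul_sum]
    refine Finset.sum_congr rfl fun j _ => ?_
    rw [Matrix.conjTranspose_apply]
    ring
  simp only [h1]
  rw [fourierMultiplier_eq_sum μ σ hf, integral_finsetSum _ fun ξ _ => (integrable_finsetSum _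
    fun i _ => integrable_finsetSum _ fun j _ => hint ξ i j).const_mul _]
  refine Finset.sum_congr rfl fun ξ _ => ?_
  rw [integral_const_mul, integral_finsetSum _ fun i _ => integrable_finsetSum _
    fun j _ => hint ξ i j, ← Matrix.mul_assoc, Matrix.trace]
  congr 1
  refine Finset.sum_congr rfl fun i _ => ?_
  rw [integral_finsetSum _ fun j _ => hint ξ i j, Matrix.diag_apply, Matrix.mul_apply]
  refine Finset.sum_congr rfl fun j _ => ?_
  rw [integral_const_mul, UnitaryDual.groupFourier_apply]

lemma isLevel_fourierMultiplier (σ : FourierSymbol G) {k : ℕ} {f : G → ℂ}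
    (hf : V.IsLevel k f) : V.IsLevel k (fourierMultiplier μ σ f) := by
  intro x y hy
  simp only [fourierMultiplier_eq_integral μ σ hf, ← mul_assoc]
  simp only [isLevel_truncKernel μ σ k _ y hy]

/-- A bounded symbol gives a multiplier bounded on `L²`. -/
lemma integral_fourierMultiplier_sq_le {σ : FourierSymbol G} {C : ℝ}
    (hσ : ∀ π : UnitaryRep G, π.IsIrreducible →
      ‖Matrix.toEuclideanCLM (𝕜 := ℂ) (σ.toFun π)‖ ≤ C) {k : ℕ} {f : G → ℂ}
    (hf : V.IsLevel k f) :
    ∫ x, ‖fourierMultiplier μ σ f x‖ ^ 2 ∂μ ≤ C ^ 2 * ∫ x, ‖f x‖ ^ 2 ∂μ := by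
  simp only [fourierMultiplier_eq_sum μ σ hf]
  rw [UnitaryDual.integral_sum_trace_sq μ _ fun π => σ.toFun π * groupFourier μ f π]
  refine le_trans ?_ (mul_le_mul_of_nonneg_left (UnitaryDual.sum_groupFourier_sq_le μ
    ⟨f, hf.continuous⟩ (V.trivialOn μ k)) (sq_nonneg C))
  rw [Finset.mul_sum]
  refine Finset.sum_le_sum fun ξ _ => ?_
  rw [mul_left_comm]
  gcongr
  exact Matrix.sum_norm_mul_sq_le _ _ (hσ _ ξ.isIrreducible_rep)

end VilenkinFiltration

/-! ### Finite quotients of a compact Vilenkin group -/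

namespace VilenkinFiltration

variable {G : Type*} [Group G] [TopologicalSpace G] (V : VilenkinFiltration G)

instance (k : ℕ) : (V.subgroup k).Normal := V.normal k

lemma subgroup_zero : V.subgroup 0 = ⊤ := by
  refine top_le_iff.1 fun x _ => ?_
  have h : x ∈ ⋃ n, (V.subgroup n : Set G) := V.iUnion_eq ▸ Set.mem_univ x
  obtain ⟨n, hn⟩ := Set.mem_iUnion.1 h
  exact V.strictAnti.antitone (Nat.zero_le n) hn

variable [IsTopologicalGroup G] [CompactSpace G]

instance (k : ℕ) : Finite (G ⧸ V.subgroup k) := Subgroup.quotient_finite_of_isOpen _ (V.isOpen k)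

noncomputable instance (k : ℕ) : Fintype (G ⧸ V.subgroup k) := Fintype.ofFinite _

lemma index_pos (k : ℕ) : 0 < (V.subgroup k).index :=
  Nat.pos_of_ne_zero (Subgroup.finiteIndex_of_finite_quotient).index_ne_zero

/-- The chain of subgroups of the finite quotient `G / G_k` induced by the filtration. -/
noncomputable def chain (k : ℕ) : NormalChain (G ⧸ V.subgroup k) where
  subgroup n := (V.subgroup n).map (QuotientGroup.mk' (V.subgroup k))
  depth := k
  normal n := (V.normal n).map _ (QuotientGroup.mk'_surjective _)
  antitone _ _ h := Subgroup.map_mono (V.strictAnti.antitone h)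
  zero_eq_top := by
    rw [subgroup_zero, Subgroup.map_top_of_surjective _ (QuotientGroup.mk'_surjective _)]
  depth_eq_bot := by
    rw [Subgroup.map_eq_bot_iff, QuotientGroup.ker_mk']
  two_mul_index_le n hn := by
    have hs := QuotientGroup.mk'_surjective (V.subgroup k)
    have h1 := V.strictAnti.antitone hn.le
    have h2 := V.strictAnti.antitone (show n + 1 ≤ k from hn)
    rw [Subgroup.index_map_eq _ hs (by rwa [QuotientGroup.ker_mk']),
      Subgroup.index_map_eq _ hs (by rwa [QuotientGroup.ker_mk']),
      ← Subgroup.relIndex_mul_index (V.strictAnti.antitone n.le_succ)]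
    exact Nat.mul_le_mul_right _ (V.two_le_index n)

variable {V}

omit [IsTopologicalGroup G] [CompactSpace G] in
lemma mk_mem_chain {k n : ℕ} (hn : n ≤ k) (x : G) :
    (x : G ⧸ V.subgroup k) ∈ (V.chain k).subgroup n ↔ x ∈ V.subgroup n := by
  have h := Subgroup.comap_map_eq_self (f := QuotientGroup.mk' (V.subgroup k))
    (H := V.subgroup n) (by
      rw [QuotientGroup.ker_mk']; exact V.strictAnti.antitone hn)
  change x ∈ ((V.subgroup n).map (QuotientGroup.mk' (V.subgroup k))).comap
    (QuotientGroup.mk' (V.subgroup k)) ↔ _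
  rw [h]

omit [IsTopologicalGroup G] [CompactSpace G] in
lemma level_mk_eq_iff {k n : ℕ} (hn : n < k) (x : G) :
    (V.chain k).level (x : G ⧸ V.subgroup k) = n ↔ x ∈ V.shell n := by
  have h1 := NormalChain.mem_subgroup_iff (𝒩 := V.chain k) (m := n) hn.le
    (x := (x : G ⧸ V.subgroup k))
  have h2 := NormalChain.mem_subgroup_iff (𝒩 := V.chain k) (m := n + 1) hn
    (x := (x : G ⧸ V.subgroup k))
  rw [mk_mem_chain hn.le] at h1
  rw [mk_mem_chain hn] at h2
  change _ ↔ x ∈ V.subgroup n ∧ x ∉ V.subgroup (n + 1)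
  rw [h1, h2]
  omega

omit [IsTopologicalGroup G] [CompactSpace G] in
lemma vol_chain {k n : ℕ} (hn : n ≤ k) :
    (V.chain k).vol n = ((V.subgroup n).index : ℝ)⁻¹ := by
  have hs := QuotientGroup.mk'_surjective (V.subgroup k)
  rw [NormalChain.vol]
  congr 2
  exact Subgroup.index_map_eq _ hs
    (by rw [QuotientGroup.ker_mk']; exact V.strictAnti.antitone hn)

variable [MeasurableSpace G] [BorelSpace G]

/-- The integral of a function on a finite quotient. -/
lemma integral_comp_mk (ν : Measure G) [IsFiniteMeasure ν] {E : Type*} [NormedAddCommGroup E]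
    [NormedSpace ℝ E] [CompleteSpace E] {k : ℕ} (F : G ⧸ V.subgroup k → E) :
    ∫ x, F (x : G ⧸ V.subgroup k) ∂ν =
      ∑ q, ν.real ((fun x : G => (x : G ⧸ V.subgroup k)) ⁻¹' {q}) • F q := by
  let m : MeasurableSpace (G ⧸ V.subgroup k) := ⊤
  have : DiscreteTopology (G ⧸ V.subgroup k) := QuotientGroup.discreteTopology (V.isOpen k)
  have hmk : Measurable (fun x : G => (x : G ⧸ V.subgroup k)) := fun s _ =>
    (QuotientGroup.continuous_mk.isOpen_preimage s (isOpen_discrete s)).measurableSet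
  have hF : AEStronglyMeasurable F (ν.map fun x : G => (x : G ⧸ V.subgroup k)) :=
    (StronglyMeasurable.of_discrete).aestronglyMeasurable
  rw [← integral_map hmk.aemeasurable hF, integral_fintype .of_finite]
  refine Finset.sum_congr rfl fun q _ => ?_
  rw [map_measureReal_apply hmk (measurableSet_singleton q)]

omit [IsTopologicalGroup G] [CompactSpace G] [MeasurableSpace G] [BorelSpace G] in
lemma preimage_mk_singleton (k : ℕ) (a : G) :
    (fun x : G => (x : G ⧸ V.subgroup k)) ⁻¹' {(a : G ⧸ V.subgroup k)} =
      (fun x => a⁻¹ * x) ⁻¹' (V.subgroup k : Set G) := by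
  ext x
  simp only [Set.mem_preimage, Set.mem_singleton_iff, SetLike.mem_coe]
  rw [eq_comm, QuotientGroup.eq]

variable (μ : Measure G) [μ.IsHaarMeasure] [IsProbabilityMeasure μ]

omit [CompactSpace G] [IsProbabilityMeasure μ] in
lemma measure_preimage_mk (k : ℕ) (q : G ⧸ V.subgroup k) :
    μ ((fun x : G => (x : G ⧸ V.subgroup k)) ⁻¹' {q}) = μ (V.subgroup k : Set G) := by
  obtain ⟨a, rfl⟩ := QuotientGroup.mk_surjective q
  rw [preimage_mk_singleton, measure_preimage_mul]

lemma card_mul_vol (k : ℕ) : (Fintype.card (G ⧸ V.subgroup k) : ℝ) * V.vol μ k = 1 := by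
  have h := integral_comp_mk (V := V) μ (k := k) (fun _ => (1 : ℝ))
  simp only [Measure.real, measure_preimage_mk] at h
  simpa [vol, Measure.real] using h.symm

lemma vol_eq_inv_card (k : ℕ) : V.vol μ k = (Fintype.card (G ⧸ V.subgroup k) : ℝ)⁻¹ :=
  (inv_eq_of_mul_eq_one_right (card_mul_vol μ k)).symm

/-- The Haar integral of a function on a finite quotient is its mean. -/
lemma integral_comp_mk_haar {E : Type*} [NormedAddCommGroup E]
    [NormedSpace ℝ E] [CompleteSpace E] {k : ℕ} (F : G ⧸ V.subgroup k → E) :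
    ∫ x, F (x : G ⧸ V.subgroup k) ∂μ = (Fintype.card (G ⧸ V.subgroup k) : ℝ)⁻¹ • ∑ q, F q := by
  rw [integral_comp_mk, Finset.smul_sum, ← vol_eq_inv_card μ]
  refine Finset.sum_congr rfl fun q _ => ?_
  rw [Measure.real, measure_preimage_mk]; rfl

lemma vol_eq_vol_chain {k n : ℕ} (hn : n ≤ k) : (V.chain k).vol n = V.vol μ n := by
  rw [vol_chain hn, vol_eq_inv_card, Subgroup.index_eq_card, Nat.card_eq_fintype_card]

lemma vol_add_le (n m : ℕ) : V.vol μ (n + m) ≤ V.vol μ n * (1 / 2) ^ m := by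
  have h := NormalChain.vol_le_mul_pow (𝒩 := V.chain (n + m)) (n := n) (m := n + m) (by omega)
    (le_refl (n + m))
  rw [vol_eq_vol_chain μ le_rfl, vol_eq_vol_chain μ (by omega)] at h
  simpa using h

omit [IsTopologicalGroup G] [CompactSpace G] [BorelSpace G] [μ.IsHaarMeasure]
  [IsProbabilityMeasure μ] in
lemma modulus_of_mem_shell {n : ℕ} {x : G} (hx : x ∈ V.shell n) : V.modulus μ x = V.vol μ n := by
  have h : ∃ n, x ∈ V.shell n := ⟨n, hx⟩
  classical
  rw [modulus, dif_pos h]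
  congr 1
  rw [Nat.find_eq_iff]
  refine ⟨hx, fun m hm hxm => hxm.2 ?_⟩
  exact V.strictAnti.antitone (show m + 1 ≤ n from hm) hx.1

omit [CompactSpace G] [IsTopologicalGroup G] in
lemma measurableSet_shell (n : ℕ) : MeasurableSet (V.shell n) :=
  (measurableSet_subgroup n).diff (measurableSet_subgroup (n + 1))

omit [IsTopologicalGroup G] [CompactSpace G] [BorelSpace G] [μ.IsHaarMeasure]
  [IsProbabilityMeasure μ] in
lemma weighted_of_subset_shell (α : ℝ) {n : ℕ} {s : Set G} (hs : MeasurableSet s)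
    (h : s ⊆ V.shell n) : V.weighted μ α s = ENNReal.ofReal (V.vol μ n ^ α) * μ s := by
  rw [weighted, withDensity_apply _ hs, setLIntegral_congr_fun (g := fun _ =>
    ENNReal.ofReal (V.vol μ n ^ α)) hs (fun x hx => by rw [modulus_of_mem_shell μ (h hx)]),
    setLIntegral_const]

variable (V) in
include V in
/-- The identity is a null set, because the measures of the subgroups `G_m` tend to `0`. In
particular the value of `0 ^ α` does not influence the weighted measures. -/
lemma measure_singleton_one : μ {(1 : G)} = 0 := by
  have h : ∀ m : ℕ, μ.real {(1 : G)} ≤ (1 / 2 : ℝ) ^ m := fun m => by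
    have h0 : V.vol μ 0 ≤ 1 := measureReal_le_one
    have h1 := vol_add_le (V := V) μ 0 m
    rw [zero_add] at h1
    have h2 : μ.real {(1 : G)} ≤ V.vol μ m :=
      ENNReal.toReal_mono (measure_ne_top _ _) (measure_mono (by simp [one_mem]))
    calc _ ≤ V.vol μ 0 * (1 / 2) ^ m := h2.trans h1
      _ ≤ 1 * (1 / 2) ^ m := by gcongr
      _ = _ := one_mul _
  have h0 : μ.real {(1 : G)} ≤ 0 := ge_of_tendsto'
    (tendsto_pow_atTop_nhds_zero_of_lt_one (by norm_num) (by norm_num)) h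
  rw [← measureReal_eq_zero_iff]
  exact le_antisymm h0 measureReal_nonneg

omit [IsTopologicalGroup G] [CompactSpace G] [MeasurableSpace G] [BorelSpace G] in
lemma subgroup_subset_iUnion_shell (k : ℕ) :
    (V.subgroup k : Set G) ⊆ {1} ∪ ⋃ m, V.shell (k + m) := by
  classical
  intro x hx
  by_cases h1 : x = 1
  · exact Or.inl h1
  · right
    have h : ∃ n, x ∉ V.subgroup n := by
      by_contra hcon
      push Not at hcon
      have : x ∈ ⋂ n, (V.subgroup n : Set G) := Set.mem_iInter.2 hcon
      rw [V.iInter_eq] at this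
      exact h1 this
    have hk : k < Nat.find h := by
      by_contra hle
      exact Nat.find_spec h (V.strictAnti.antitone (not_lt.1 hle) hx)
    refine Set.mem_iUnion.2 ⟨Nat.find h - 1 - k, ?_, ?_⟩
    · have := Nat.find_min h (show Nat.find h - 1 < Nat.find h by omega)
      rw [show k + (Nat.find h - 1 - k) = Nat.find h - 1 by omega]
      simpa using this
    · rw [show k + (Nat.find h - 1 - k) + 1 = Nat.find h by omega]
      exact Nat.find_spec h

/-- For `α > -1` the weighted measure of `G_k` is comparable to `|G_k| ^ (1 + α)`: upper bound, by
summing a geometric series over the shells. -/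
lemma weighted_subgroup_le {α : ℝ} (hα : -1 < α) (k : ℕ) :
    V.weighted μ α (V.subgroup k : Set G) ≤
      ENNReal.ofReal ((1 - (1 / 2 : ℝ) ^ (1 + α))⁻¹ * (V.vol μ k ^ α * V.vol μ k)) := by
  set a : ℝ := (1 / 2 : ℝ) ^ (1 + α) with ha
  have ha0 : 0 ≤ a := by positivity
  have ha1 : a < 1 := Real.rpow_lt_one (by norm_num) (by norm_num) (by linarith)
  have hvk := vol_pos (V := V) μ k
  have hpow : ∀ n, V.vol μ n ^ α * V.vol μ n = V.vol μ n ^ (1 + α) := fun n => by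
    rw [add_comm, Real.rpow_add_one (vol_pos μ n).ne']
  have hshell : ∀ m, V.weighted μ α (V.shell (k + m)) ≤
      ENNReal.ofReal (V.vol μ k ^ (1 + α) * a ^ m) := by
    intro m
    have hvm := vol_pos (V := V) μ (k + m)
    rw [weighted_of_subset_shell μ α (measurableSet_shell _) subset_rfl]
    calc _ ≤ ENNReal.ofReal (V.vol μ (k + m) ^ α) * μ (V.subgroup (k + m) : Set G) := by
          gcongr; exact Set.sdiff_subset
      _ = ENNReal.ofReal (V.vol μ (k + m) ^ (1 + α)) := by
          rw [← hpow, ENNReal.ofReal_mul (by positivity), vol, ofReal_measureReal]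
      _ ≤ _ := by
          refine ENNReal.ofReal_le_ofReal ?_
          calc V.vol μ (k + m) ^ (1 + α) ≤ (V.vol μ k * (1 / 2) ^ m) ^ (1 + α) :=
                Real.rpow_le_rpow hvm.le (vol_add_le μ k m) (by linarith)
            _ = _ := by
                rw [Real.mul_rpow hvk.le (by positivity), ← Real.rpow_natCast,
                  ← Real.rpow_natCast, ← Real.rpow_mul (by norm_num),
                  ← Real.rpow_mul (by norm_num), mul_comm (m : ℝ)]
  have h1 : V.weighted μ α {1} = 0 :=
    withDensity_absolutelyContinuous μ _ (measure_singleton_one V μ)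
  calc V.weighted μ α (V.subgroup k : Set G)
      ≤ V.weighted μ α ({1} ∪ ⋃ m, V.shell (k + m)) :=
        measure_mono (subgroup_subset_iUnion_shell k)
    _ ≤ V.weighted μ α {1} + ∑' m, V.weighted μ α (V.shell (k + m)) :=
        (measure_union_le _ _).trans (add_le_add le_rfl (measure_iUnion_le _))
    _ ≤ ∑' m, ENNReal.ofReal (V.vol μ k ^ (1 + α) * a ^ m) := by
        rw [h1, zero_add]; exact ENNReal.tsum_le_tsum hshell
    _ = _ := by
        rw [← ENNReal.ofReal_tsum_of_nonneg (fun m => by positivity)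
          ((summable_geometric_of_lt_one ha0 ha1).mul_left _), tsum_mul_left,
          tsum_geometric_of_lt_one ha0 ha1, hpow, mul_comm]

lemma isFiniteMeasure_weighted {α : ℝ} (hα : -1 < α) : IsFiniteMeasure (V.weighted μ α) := by
  refine ⟨?_⟩
  have h := weighted_subgroup_le (V := V) μ hα 0
  rw [subgroup_zero, Subgroup.coe_top] at h
  exact h.trans_lt ENNReal.ofReal_lt_top

/-- The weighted measures of the cosets of `G_k` are comparable to their Haar measure multiplied by
the value of the weight on the corresponding shell. -/
lemma weighted_coset_bounds {α : ℝ} (hα : -1 < α) (k : ℕ) (q : G ⧸ V.subgroup k) :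
    1 / 2 * (V.vol μ k * (V.chain k).vol ((V.chain k).level q) ^ α) ≤
        (V.weighted μ α).real ((fun x : G => (x : G ⧸ V.subgroup k)) ⁻¹' {q}) ∧
      (V.weighted μ α).real ((fun x : G => (x : G ⧸ V.subgroup k)) ⁻¹' {q}) ≤
        (1 - (1 / 2 : ℝ) ^ (1 + α))⁻¹ *
          (V.vol μ k * (V.chain k).vol ((V.chain k).level q) ^ α) := by
  have hfin := isFiniteMeasure_weighted (V := V) μ hα
  have ha0 : 0 < (1 / 2 : ℝ) ^ (1 + α) := by positivity
  have ha1 : (1 / 2 : ℝ) ^ (1 + α) < 1 :=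
    Real.rpow_lt_one (by norm_num) (by norm_num) (by linarith)
  have hC : 1 ≤ (1 - (1 / 2 : ℝ) ^ (1 + α))⁻¹ := by
    rw [one_le_inv₀ (by linarith)]; linarith
  have hvk := vol_pos (V := V) μ k
  have hlev := NormalChain.level_le (𝒩 := V.chain k) q
  change _ ≤ k at hlev
  rw [vol_eq_vol_chain μ hlev]
  have hmeas : MeasurableSet ((fun x : G => (x : G ⧸ V.subgroup k)) ⁻¹' {q}) := by
    obtain ⟨a, rfl⟩ := QuotientGroup.mk_surjective q
    rw [preimage_mk_singleton]
    exact (measurableSet_subgroup k).preimage (measurable_const_mul a⁻¹)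
  rcases hlev.eq_or_lt with hk | hk
  · have hq : q = 1 := by
      have := NormalChain.mem_subgroup_level (𝒩 := V.chain k) q
      rw [hk] at this
      have h2 := (V.chain k).depth_eq_bot
      change (V.chain k).subgroup k = ⊥ at h2
      rw [h2] at this
      exact Subgroup.mem_bot.1 this
    have hset : (fun x : G => (x : G ⧸ V.subgroup k)) ⁻¹' {q} = (V.subgroup k : Set G) := by
      rw [hq, ← QuotientGroup.mk_one, preimage_mk_singleton]; simp
    rw [hset, hk]
    constructor
    · have h1 : V.weighted μ α (V.shell k) ≤ V.weighted μ α (V.subgroup k : Set G) :=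
        measure_mono Set.sdiff_subset
      rw [weighted_of_subset_shell μ α (measurableSet_shell _) subset_rfl] at h1
      have h2 := ENNReal.toReal_mono (measure_ne_top _ _) h1
      rw [ENNReal.toReal_mul, ENNReal.toReal_ofReal (by positivity)] at h2
      refine le_trans ?_ h2
      have h3 : μ.real (V.shell k) = V.vol μ k - V.vol μ (k + 1) :=
        measureReal_sdiff (V.strictAnti.antitone k.le_succ) (measurableSet_subgroup _)
      have h4 := vol_add_le (V := V) μ k 1
      change _ ≤ _ * μ.real (V.shell k)
      have h5 : 1 / 2 * V.vol μ k ≤ μ.real (V.shell k) := by rw [h3]; linarith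
      calc _ = V.vol μ k ^ α * (1 / 2 * V.vol μ k) := by ring
        _ ≤ _ := by gcongr
    · have h2 := ENNReal.toReal_mono ENNReal.ofReal_ne_top (weighted_subgroup_le (V := V) μ hα k)
      rw [ENNReal.toReal_ofReal (by
        have : 0 < 1 - (1 / 2 : ℝ) ^ (1 + α) := by linarith
        positivity)] at h2
      exact h2.trans_eq (by ring)
  · have hsub : (fun x : G => (x : G ⧸ V.subgroup k)) ⁻¹' {q} ⊆
        V.shell ((V.chain k).level q) := fun x hx => (level_mk_eq_iff hk x).1 (by
      rw [Set.mem_preimage, Set.mem_singleton_iff] at hx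
      rw [hx])
    have hvn := vol_pos (V := V) μ ((V.chain k).level q)
    have hval : (V.weighted μ α).real ((fun x : G => (x : G ⧸ V.subgroup k)) ⁻¹' {q}) =
        V.vol μ k * V.vol μ ((V.chain k).level q) ^ α := by
      rw [Measure.real, weighted_of_subset_shell μ α hmeas hsub, measure_preimage_mk,
        ENNReal.toReal_mul, ENNReal.toReal_ofReal (by positivity), mul_comm]; rfl
    rw [hval]
    have : 0 ≤ V.vol μ k * V.vol μ ((V.chain k).level q) ^ α := by positivity
    constructor <;> nlinarith

end VilenkinFiltration

/-! ### Transfer of the estimates from the finite quotients -/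

namespace VilenkinFiltration

variable {G : Type*} [Group G] [TopologicalSpace G] {V : VilenkinFiltration G}

variable (V) in
/-- The function on `G / G_k` induced by a function of level `k`. It is defined for all functions
by means of a choice of representatives of the cosets. -/
noncomputable def descend {E : Type*} (k : ℕ) (f : G → E) (q : G ⧸ V.subgroup k) : E := f q.out

lemma IsLevel.descend_mk {k : ℕ} {f : G → ℂ} (hf : V.IsLevel k f) (x : G) :
    V.descend k f (x : G ⧸ V.subgroup k) = f x := by
  obtain ⟨h, hh⟩ := QuotientGroup.mk_out_eq_mul (V.subgroup k) x
  rw [descend, hh]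
  exact hf x h h.2

lemma isLevel_comp_mk {k : ℕ} (F : G ⧸ V.subgroup k → ℂ) :
    V.IsLevel k fun x => F (x : G ⧸ V.subgroup k) := by
  intro x y hy
  have : ((x * y : G) : G ⧸ V.subgroup k) = x := by
    rw [eq_comm, QuotientGroup.eq]; simpa using hy
  simp only [this]

variable [IsTopologicalGroup G] [CompactSpace G] [MeasurableSpace G] [BorelSpace G]
  (μ : Measure G) [μ.IsHaarMeasure] [IsProbabilityMeasure μ] (σ : FourierSymbol G)

variable (V) in
/-- The truncated kernel as a function on `G / G_k`. -/
noncomputable def quotKernel (k : ℕ) : G ⧸ V.subgroup k → ℂ := V.descend k (V.truncKernel μ σ k)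

lemma quotKernel_mk (k : ℕ) (x : G) :
    V.quotKernel μ σ k (x : G ⧸ V.subgroup k) = V.truncKernel μ σ k x :=
  (isLevel_truncKernel μ σ k).descend_mk x

/-- On functions of level `k`, the multiplier is a convolution operator on `G / G_k`. -/
lemma IsLevel.fourierMultiplier_eq_mulVec {k : ℕ} {f : G → ℂ} (hf : V.IsLevel k f) (x : G) :
    fourierMultiplier μ σ f x =
      (NormalChain.convMatrix (V.quotKernel μ σ k) *ᵥ V.descend k f) (x : G ⧸ V.subgroup k) := by
  rw [fourierMultiplier_eq_integral μ σ hf]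
  have h : ∀ y : G, f y * V.truncKernel μ σ k (y⁻¹ * x) =
      (fun q : G ⧸ V.subgroup k => V.descend k f q * V.quotKernel μ σ k (q⁻¹ * x))
        (y : G ⧸ V.subgroup k) := fun y => by
    dsimp only
    rw [hf.descend_mk, ← QuotientGroup.mk_inv, ← QuotientGroup.mk_mul, quotKernel_mk]
  simp only [h]
  rw [integral_comp_mk_haar μ fun q : G ⧸ V.subgroup k =>
    V.descend k f q * V.quotKernel μ σ k (q⁻¹ * x)]
  simp only [Matrix.mulVec, dotProduct, NormalChain.convMatrix_apply]
  rw [Complex.real_smul, Finset.mul_sum]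
  refine Finset.sum_congr rfl fun q _ => ?_
  push_cast
  ring

variable {σ}

/-- A bounded symbol gives convolution matrices on the finite quotients that are uniformly bounded
on `L²`. -/
lemma sum_convMatrix_sq_le {C : ℝ} (hσ : ∀ π : UnitaryRep G, π.IsIrreducible →
    ‖Matrix.toEuclideanCLM (𝕜 := ℂ) (σ.toFun π)‖ ≤ C) (k : ℕ) (F : G ⧸ V.subgroup k → ℂ) :
    ∑ q, ‖(NormalChain.convMatrix (V.quotKernel μ σ k) *ᵥ F) q‖ ^ 2 ≤ C ^ 2 * ∑ q, ‖F q‖ ^ 2 := by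
  have hf := isLevel_comp_mk F
  have hd : V.descend k (fun x : G => F (x : G ⧸ V.subgroup k)) = F := by
    ext q
    obtain ⟨x, rfl⟩ := QuotientGroup.mk_surjective q
    exact hf.descend_mk x
  have h := integral_fourierMultiplier_sq_le μ hσ hf
  simp only [hf.fourierMultiplier_eq_mulVec μ σ, hd] at h
  rw [integral_comp_mk_haar μ fun q : G ⧸ V.subgroup k =>
      ‖(NormalChain.convMatrix (V.quotKernel μ σ k) *ᵥ F) q‖ ^ 2,
    integral_comp_mk_haar μ fun q : G ⧸ V.subgroup k => ‖F q‖ ^ 2, smul_eq_mul, smul_eq_mul,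
    mul_left_comm] at h
  have hM := NormalChain.card_pos (Q := G ⧸ V.subgroup k)
  exact le_of_mul_le_mul_left h (by positivity)

open Classical in
/-- The integral of a function on `G / G_k` over a subset of `G` given on `G / G_k`. -/
lemma setIntegral_comp_mk {k : ℕ} {s : Set G} (hs : MeasurableSet s)
    (p : G ⧸ V.subgroup k → Prop) (hp : ∀ x : G, p x ↔ x ∈ s) (F : G ⧸ V.subgroup k → ℝ) :
    ∫ x in s, F (x : G ⧸ V.subgroup k) ∂μ = NormalChain.mean (Finset.univ.filter p) F := by
  rw [← integral_indicator hs]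
  have h : ∀ x : G, s.indicator (fun x : G => F (x : G ⧸ V.subgroup k)) x =
      (fun q : G ⧸ V.subgroup k => if p q then F q else 0) x := fun x => by
    simp only [Set.indicator_apply, hp]
  simp only [h]
  rw [integral_comp_mk_haar μ fun q : G ⧸ V.subgroup k => if p q then F q else 0,
    NormalChain.mean, Finset.sum_filter, smul_eq_mul]

/-- The condition `H(t)`, `t > 1`, passes to the finite quotients. -/
lemma translationBound_quotKernel {t ε C : ℝ}
    (h : ∀ k n l : ℕ, n < l → ∀ y ∈ V.subgroup l,
      (∫ x in V.shell n,
        ‖V.truncKernel μ σ k (x * y⁻¹) - V.truncKernel μ σ k x‖ ^ t ∂μ) ^ (1 / t)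
      ≤ C * (V.vol μ n ^ (-(ε + (1 - 1 / t))) * V.vol μ l ^ ε)) (k : ℕ) :
    (V.chain k).TranslationBound (V.quotKernel μ σ k) t ε |C| := by
  classical
  intro n l hnl hl q hq
  change l ≤ k at hl
  obtain ⟨y, rfl⟩ := QuotientGroup.mk_surjective q
  rw [mk_mem_chain hl] at hq
  have h1 := h k n l hnl y hq
  have h2 : ∀ x : G, ‖V.truncKernel μ σ k (x * y⁻¹) - V.truncKernel μ σ k x‖ ^ t =
      (fun q : G ⧸ V.subgroup k =>
        ‖V.quotKernel μ σ k (q * (y : G ⧸ V.subgroup k)⁻¹) - V.quotKernel μ σ k q‖ ^ t) x :=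
    fun x => by
      dsimp only
      rw [← QuotientGroup.mk_inv, ← QuotientGroup.mk_mul, quotKernel_mk, quotKernel_mk]
  simp only [h2] at h1
  have e := setIntegral_comp_mk μ (measurableSet_shell n) (fun q => (V.chain k).level q = n)
    (fun x => level_mk_eq_iff (hnl.trans_le hl) x) (fun q =>
      ‖V.quotKernel μ σ k (q * (y : G ⧸ V.subgroup k)⁻¹) - V.quotKernel μ σ k q‖ ^ t)
  rw [e] at h1
  rw [vol_eq_vol_chain μ hl, vol_eq_vol_chain μ (hnl.le.trans hl)]
  have h3 := vol_pos (V := V) μ n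
  have h4 := vol_pos (V := V) μ l
  refine le_trans (le_of_eq ?_) (h1.trans (mul_le_mul_of_nonneg_right (le_abs_self C)
    (by positivity)))
  unfold NormalChain.shell
  congr

/-- The condition `H(1)` passes to the finite quotients. -/
lemma mean_quotKernel_compl_le {C : ℝ}
    (h : ∀ k l : ℕ, ∀ y ∈ V.subgroup l, ∫ x in (V.subgroup l : Set G)ᶜ,
      ‖V.truncKernel μ σ k (x * y⁻¹) - V.truncKernel μ σ k x‖ ∂μ ≤ C) (k : ℕ) :
    ∀ l ≤ (V.chain k).depth, ∀ y ∈ (V.chain k).subgroup l,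
      NormalChain.mean (Set.toFinite {z | z ∉ (V.chain k).subgroup l}).toFinset
        (fun z => ‖V.quotKernel μ σ k (z * y⁻¹) - V.quotKernel μ σ k z‖) ≤ |C| := by
  classical
  intro l hl q hq
  change l ≤ k at hl
  obtain ⟨y, rfl⟩ := QuotientGroup.mk_surjective q
  rw [mk_mem_chain hl] at hq
  have h1 := h k l y hq
  have h2 : ∀ x : G, ‖V.truncKernel μ σ k (x * y⁻¹) - V.truncKernel μ σ k x‖ =
      (fun q : G ⧸ V.subgroup k =>
        ‖V.quotKernel μ σ k (q * (y : G ⧸ V.subgroup k)⁻¹) - V.quotKernel μ σ k q‖) x :=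
    fun x => by
      dsimp only
      rw [← QuotientGroup.mk_inv, ← QuotientGroup.mk_mul, quotKernel_mk, quotKernel_mk]
  simp only [h2] at h1
  have e := setIntegral_comp_mk μ (measurableSet_subgroup l).compl
    (fun q => q ∉ (V.chain k).subgroup l) (fun x => by rw [mk_mem_chain hl]; rfl) (fun q =>
      ‖V.quotKernel μ σ k (q * (y : G ⧸ V.subgroup k)⁻¹) - V.quotKernel μ σ k q‖)
  rw [e] at h1
  refine le_trans (le_of_eq ?_) (h1.trans (le_abs_self C))
  congr 1
  ext; simp

omit [MeasurableSpace G] [BorelSpace G] in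
/-- For a filtration of bounded order, the chains in the finite quotients are doubling with a common
constant. -/
lemma vol_chain_le_mul {B : ℕ} (hV : ∀ n, (V.subgroup (n + 1)).relIndex (V.subgroup n) ≤ B)
    (k : ℕ) : ∀ n < (V.chain k).depth,
      (V.chain k).vol n ≤ (B : ℝ) * (V.chain k).vol (n + 1) := by
  intro n hn
  change n < k at hn
  rw [vol_chain hn.le, vol_chain hn]
  have h1 := Subgroup.relIndex_mul_index (V.strictAnti.antitone n.le_succ)
  have h2 : (V.subgroup (n + 1)).index ≤ B * (V.subgroup n).index := by
    rw [← h1]; exact Nat.mul_le_mul_right _ (hV n)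
  have h3 : (0 : ℝ) < (V.subgroup n).index := by exact_mod_cast V.index_pos n
  have h4 : (0 : ℝ) < (V.subgroup (n + 1)).index := by exact_mod_cast V.index_pos (n + 1)
  rw [← div_eq_mul_inv, le_div_iff₀ h4, inv_mul_le_iff₀ h3, mul_comm]
  exact_mod_cast h2

/-- Weighted bounds on the finite quotients give bounds for the multiplier on smooth functions. -/
lemma integral_fourierMultiplier_rpow_le {α p C : ℝ} (hα : -1 < α) (hC : 0 ≤ C)
    (h : ∀ (k : ℕ) (F : G ⧸ V.subgroup k → ℂ),
      ∑ q, (V.chain k).vol ((V.chain k).level q) ^ α *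
          ‖(NormalChain.convMatrix (V.quotKernel μ σ k) *ᵥ F) q‖ ^ p ≤
        C * ∑ q, (V.chain k).vol ((V.chain k).level q) ^ α * ‖F q‖ ^ p)
    {k : ℕ} {f : G → ℂ} (hf : V.IsLevel k f) :
    ∫ x, ‖fourierMultiplier μ σ f x‖ ^ p ∂(V.weighted μ α) ≤
      (1 - (1 / 2 : ℝ) ^ (1 + α))⁻¹ * C * 2 * ∫ x, ‖f x‖ ^ p ∂(V.weighted μ α) := by
  have hfin := isFiniteMeasure_weighted (V := V) μ hα
  have ha1 : (1 / 2 : ℝ) ^ (1 + α) < 1 :=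
    Real.rpow_lt_one (by norm_num) (by norm_num) (by linarith)
  have ha2 : 0 < 1 - (1 / 2 : ℝ) ^ (1 + α) := by linarith
  have hvk := vol_pos (V := V) μ k
  have hb := weighted_coset_bounds (V := V) μ hα k
  set b : (G ⧸ V.subgroup k) → ℝ := fun q => (V.chain k).vol ((V.chain k).level q) ^ α
  have e1 : ∀ x : G, ‖fourierMultiplier μ σ f x‖ ^ p = (fun q : G ⧸ V.subgroup k =>
      ‖(NormalChain.convMatrix (V.quotKernel μ σ k) *ᵥ V.descend k f) q‖ ^ p) x := fun x => by
    dsimp only; rw [hf.fourierMultiplier_eq_mulVec μ σ]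
  have e2 : ∀ x : G, ‖f x‖ ^ p =
      (fun q : G ⧸ V.subgroup k => ‖V.descend k f q‖ ^ p) x := fun x => by
    dsimp only; rw [hf.descend_mk]
  simp only [e1, e2]
  rw [integral_comp_mk _ fun q : G ⧸ V.subgroup k =>
      ‖(NormalChain.convMatrix (V.quotKernel μ σ k) *ᵥ V.descend k f) q‖ ^ p,
    integral_comp_mk _ fun q : G ⧸ V.subgroup k => ‖V.descend k f q‖ ^ p]
  simp only [smul_eq_mul]
  set K : ℝ := (1 - (1 / 2 : ℝ) ^ (1 + α))⁻¹
  have hK : 0 ≤ K := by positivity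
  calc _ ≤ ∑ q, (K * (V.vol μ k * b q)) *
        ‖(NormalChain.convMatrix (V.quotKernel μ σ k) *ᵥ V.descend k f) q‖ ^ p := by
        gcongr with q _
        exact (hb q).2
    _ = K * V.vol μ k * ∑ q, b q *
        ‖(NormalChain.convMatrix (V.quotKernel μ σ k) *ᵥ V.descend k f) q‖ ^ p := by
        rw [Finset.mul_sum]
        exact Finset.sum_congr rfl fun q _ => by ring
    _ ≤ K * V.vol μ k * (C * ∑ q, b q * ‖V.descend k f q‖ ^ p) := by
        gcongr
        exact h k _
    _ = K * C * 2 * ∑ q, (1 / 2 * (V.vol μ k * b q)) * ‖V.descend k f q‖ ^ p := by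
        simp only [Finset.mul_sum]
        exact Finset.sum_congr rfl fun q _ => by ring
    _ ≤ _ := by
        gcongr with q _
        exact (hb q).1

omit [CompactSpace G] [BorelSpace G] [MeasurableSpace G] in
variable (V) in
include V in
/-- The topology of `G` is pseudometrizable, being a group topology with a countable basis at the
identity. Finite Borel measures on `G` are therefore weakly regular. -/
lemma pseudoMetrizableSpace : TopologicalSpace.PseudoMetrizableSpace G := by
  let _ := IsTopologicalGroup.rightUniformSpace G
  have : (nhds (1 : G)).IsCountablyGenerated := V.hasBasis.isCountablyGenerated
  have : (uniformity G).IsCountablyGenerated := by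
    change (Filter.comap _ (nhds (1 : G))).IsCountablyGenerated
    infer_instance
  exact UniformSpace.pseudoMetrizableSpace

variable (V) in
/-- The space of smooth functions. -/
def smoothSubmodule : Submodule ℂ (G → ℂ) where
  carrier := V.smooth
  add_mem' := by
    rintro f g ⟨k, hk⟩ ⟨l, hl⟩
    exact ⟨max k l, fun x y hy => by
      rw [Pi.add_apply, Pi.add_apply, IsLevel.mono (le_max_left k l) hk x y hy,
        IsLevel.mono (le_max_right k l) hl x y hy]⟩
  zero_mem' := ⟨0, fun _ _ _ => rfl⟩
  smul_mem' := by
    rintro c f ⟨k, hk⟩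
    exact ⟨k, fun x y hy => by rw [Pi.smul_apply, Pi.smul_apply, hk x y hy]⟩

omit [MeasurableSpace G] [BorelSpace G] in
/-- Continuous functions are uniformly approximated by smooth functions. -/
lemma exists_isLevel_norm_sub_lt (g : C(G, ℂ)) {δ : ℝ} (hδ : 0 < δ) :
    ∃ k f, V.IsLevel k f ∧ ∀ x, ‖f x - g x‖ < δ := by
  have hG : ∃ k, ∀ x, ∀ y ∈ V.subgroup k, ‖g (x * y) - g x‖ < δ := by
    let _ := IsTopologicalGroup.leftUniformSpace G
    have hu := CompactSpace.uniformContinuous_of_continuous g.continuous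
    have h1 := hu (Metric.dist_mem_uniformity hδ)
    change _ ∈ Filter.comap (fun p : G × G => p.1⁻¹ * p.2) (nhds 1) at h1
    obtain ⟨k, -, hk⟩ := (V.hasBasis.comap _).mem_iff.1 h1
    refine ⟨k, fun x y hy => ?_⟩
    have h2 : (x, x * y) ∈ (fun p : G × G => p.1⁻¹ * p.2) ⁻¹' (V.subgroup k : Set G) := by
      simpa using hy
    have h3 := hk h2
    rw [norm_sub_rev]
    simpa [dist_eq_norm] using h3
  obtain ⟨k, hk⟩ := hG
  refine ⟨k, fun x => V.descend k g (x : G ⧸ V.subgroup k), isLevel_comp_mk _, fun x => ?_⟩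
  obtain ⟨h, hh⟩ := QuotientGroup.mk_out_eq_mul (V.subgroup k) x
  simp only [descend, hh]
  exact hk x h h.2

omit μ [μ.IsHaarMeasure] [IsProbabilityMeasure μ] in
lemma IsLevel.memLp {k : ℕ} {f : G → ℂ} (hf : V.IsLevel k f) (ν : Measure G) [IsFiniteMeasure ν]
    (p : ENNReal) : MemLp f p ν :=
  .of_bound hf.continuous.aestronglyMeasurable ‖(⟨f, hf.continuous⟩ : C(G, ℂ))‖
    (.of_forall fun x => ContinuousMap.norm_coe_le_norm (⟨f, hf.continuous⟩ : C(G, ℂ)) x)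

end VilenkinFiltration

/-! ### Extension by density -/

namespace VilenkinFiltration

variable {G : Type*} [Group G] [TopologicalSpace G] {V : VilenkinFiltration G}
  [IsTopologicalGroup G] [CompactSpace G] [MeasurableSpace G] [BorelSpace G]

/-- The embedding of the space of smooth functions into `L^p(ν)`. -/
noncomputable def smoothToLp (V : VilenkinFiltration G) (ν : Measure G) [IsFiniteMeasure ν]
    (p : ENNReal) : V.smoothSubmodule →ₗ[ℂ] Lp ℂ p ν where
  toFun f := (IsLevel.memLp f.2.choose_spec ν p).toLp f.1
  map_add' _ _ := rfl
  map_smul' _ _ := rfl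

/-- Smooth functions are dense in `L^p(ν)`, because they approximate continuous functions
uniformly. -/
lemma denseRange_smoothToLp (ν : Measure G) [IsFiniteMeasure ν] {p : ENNReal} [hp1 : Fact (1 ≤ p)]
    (hp : p ≠ ⊤) : DenseRange (smoothToLp V ν p) := by
  have := pseudoMetrizableSpace V
  have hd := ContinuousMap.toLp_denseRange ℂ ν ℂ hp
  refine Metric.denseRange_iff.2 fun F δ hδ => ?_
  obtain ⟨g, hg⟩ := hd.exists_dist_lt F (half_pos hδ)
  set K := ‖ContinuousMap.toLp (E := ℂ) p ν ℂ‖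
  have hK : 0 ≤ K := norm_nonneg _
  have hη : 0 < δ / 2 / (K + 1) := by positivity
  obtain ⟨k, f, hf, hfg⟩ := exists_isLevel_norm_sub_lt (V := V) g hη
  refine ⟨⟨f, k, hf⟩, ?_⟩
  have h1 : smoothToLp V ν p ⟨f, k, hf⟩ =
      ContinuousMap.toLp (E := ℂ) p ν ℂ ⟨f, hf.continuous⟩ := by
    refine Lp.ext ((MemLp.coeFn_toLp (IsLevel.memLp hf ν p)).trans ?_)
    exact (ContinuousMap.coeFn_toLp (𝕜 := ℂ) ν ⟨f, hf.continuous⟩).symm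
  have h2 : dist (ContinuousMap.toLp (E := ℂ) p ν ℂ g) (smoothToLp V ν p ⟨f, k, hf⟩) < δ / 2 := by
    rw [h1, dist_eq_norm, ← map_sub]
    refine (ContinuousLinearMap.le_opNorm _ _).trans_lt ?_
    have h3 : ‖g - ⟨f, hf.continuous⟩‖ ≤ δ / 2 / (K + 1) :=
      (ContinuousMap.norm_le _ hη.le).2 fun x => by
        rw [ContinuousMap.sub_apply, norm_sub_rev]; exact (hfg x).le
    calc _ ≤ K * (δ / 2 / (K + 1)) := by gcongr
      _ < (K + 1) * (δ / 2 / (K + 1)) := by gcongr; linarith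
      _ = δ / 2 := by field_simp
  calc _ ≤ _ := dist_triangle _ (ContinuousMap.toLp (E := ℂ) p ν ℂ g) _
    _ < δ := by linarith

omit [Group G] [TopologicalSpace G] [IsTopologicalGroup G] [CompactSpace G] [BorelSpace G] in
lemma norm_toLp_rpow {ν : Measure G} {r : ℝ} (hr : 0 < r) {f : G → ℂ}
    (hf : MemLp f (ENNReal.ofReal r) ν) : ‖hf.toLp f‖ ^ r = ∫ x, ‖f x‖ ^ r ∂ν := by
  rw [Lp.norm_toLp, hf.eLpNorm_eq_integral_rpow_norm (by simpa using hr) ENNReal.ofReal_ne_top,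
    ENNReal.toReal_ofReal hr.le, ENNReal.toReal_ofReal (by positivity), ← Real.rpow_mul
      (by positivity), inv_mul_cancel₀ hr.ne', Real.rpow_one]

variable (μ : Measure G) [μ.IsHaarMeasure] [IsProbabilityMeasure μ] (σ : FourierSymbol G)

variable (V) in
/-- The multiplier as a linear operator on smooth functions. -/
noncomputable def smoothMultiplier : V.smoothSubmodule →ₗ[ℂ] V.smoothSubmodule where
  toFun f := ⟨fourierMultiplier μ σ f.1, f.2.choose,
    isLevel_fourierMultiplier μ σ f.2.choose_spec⟩
  map_add' := by
    rintro ⟨f, k, hf⟩ ⟨g, l, hg⟩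
    ext x
    have hf' := IsLevel.mono (le_max_left k l) hf
    have hg' := IsLevel.mono (le_max_right k l) hg
    have hfg : V.IsLevel (max k l) (f + g) := fun x y hy => by
      rw [Pi.add_apply, Pi.add_apply, hf' x y hy, hg' x y hy]
    change fourierMultiplier μ σ (f + g) x = fourierMultiplier μ σ f x + fourierMultiplier μ σ g x
    rw [hf'.fourierMultiplier_eq_mulVec μ σ, hg'.fourierMultiplier_eq_mulVec μ σ,
      hfg.fourierMultiplier_eq_mulVec μ σ, ← Pi.add_apply, ← Matrix.mulVec_add]
    rfl
  map_smul' := by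
    rintro c ⟨f, k, hf⟩
    ext x
    have hcf : V.IsLevel k (c • f) := fun x y hy => by
      rw [Pi.smul_apply, Pi.smul_apply, hf x y hy]
    change fourierMultiplier μ σ (c • f) x = c • fourierMultiplier μ σ f x
    rw [IsLevel.fourierMultiplier_eq_mulVec μ σ hf, hcf.fourierMultiplier_eq_mulVec μ σ,
      ← Pi.smul_apply, ← Matrix.mulVec_smul]
    rfl

variable {σ}

/-- An a priori estimate on smooth functions extends to the whole space by density. -/
lemma isBoundedMultiplier_of_integral_le {r C : ℝ} (hr : 1 ≤ r) (hC : 0 ≤ C) (ν : Measure G)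
    [IsFiniteMeasure ν] (h : ∀ (k : ℕ) (f : G → ℂ), V.IsLevel k f →
      ∫ x, ‖fourierMultiplier μ σ f x‖ ^ r ∂ν ≤ C * ∫ x, ‖f x‖ ^ r ∂ν) :
    V.IsBoundedMultiplier μ σ r ν := by
  have hr0 : 0 < r := by linarith
  have : Fact (1 ≤ ENNReal.ofReal r) := ⟨by simpa using hr⟩
  have hd := denseRange_smoothToLp (V := V) ν (p := ENNReal.ofReal r) ENNReal.ofReal_ne_top
  set e := smoothToLp V ν (ENNReal.ofReal r)
  set T := e ∘ₗ V.smoothMultiplier μ σ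
  have hT : ∀ f, ‖T f‖ ≤ C ^ r⁻¹ * ‖e f‖ := by
    rintro ⟨f, k, hf⟩
    have h1 : ‖T ⟨f, k, hf⟩‖ ^ r ≤ C * ‖e ⟨f, k, hf⟩‖ ^ r := by
      have h2 : ‖T ⟨f, k, hf⟩‖ ^ r = ∫ x, ‖fourierMultiplier μ σ f x‖ ^ r ∂ν :=
        norm_toLp_rpow hr0 (IsLevel.memLp (isLevel_fourierMultiplier μ σ hf) ν _)
      have h3 : ‖e ⟨f, k, hf⟩‖ ^ r = ∫ x, ‖f x‖ ^ r ∂ν := norm_toLp_rpow hr0 (IsLevel.memLp hf ν _)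
      rw [h2, h3]
      exact h k f hf
    rwa [← Real.rpow_le_rpow_iff (norm_nonneg _) (by positivity) hr0,
      Real.mul_rpow (by positivity) (norm_nonneg _), ← Real.rpow_mul hC, inv_mul_cancel₀ hr0.ne',
      Real.rpow_one]
  refine ⟨(T.extendOfNorm e).toLinearMap,
    ⟨C ^ r⁻¹, LinearMap.norm_extendOfNorm_apply_le hd _ hT⟩, ?_⟩
  rintro f ⟨k, hf⟩
  refine ⟨IsLevel.memLp hf ν _, ?_⟩
  have h1 : T.extendOfNorm e (e ⟨f, k, hf⟩) = T ⟨f, k, hf⟩ :=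
    LinearMap.extendOfNorm_eq hd ⟨_, hT⟩ _
  change (T.extendOfNorm e (e ⟨f, k, hf⟩) : G → ℂ) =ᵐ[ν] _
  rw [h1]
  exact MemLp.coeFn_toLp (IsLevel.memLp (isLevel_fourierMultiplier μ σ hf) ν _)

/-- Uniform weighted bounds on the finite quotients imply boundedness of the multiplier. -/
lemma isBoundedMultiplier_weighted {r α C : ℝ} (hr : 1 ≤ r) (hα : -1 < α) (hC : 0 ≤ C)
    (h : ∀ (k : ℕ) (F : G ⧸ V.subgroup k → ℂ),
      ∑ q, (V.chain k).vol ((V.chain k).level q) ^ α *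
          ‖(NormalChain.convMatrix (V.quotKernel μ σ k) *ᵥ F) q‖ ^ r ≤
        C * ∑ q, (V.chain k).vol ((V.chain k).level q) ^ α * ‖F q‖ ^ r) :
    V.IsBoundedMultiplier μ σ r (V.weighted μ α) := by
  have := isFiniteMeasure_weighted (V := V) μ hα
  have ha : (1 / 2 : ℝ) ^ (1 + α) < 1 :=
    Real.rpow_lt_one (by norm_num) (by norm_num) (by linarith)
  have hK : 0 ≤ (1 - (1 / 2 : ℝ) ^ (1 + α))⁻¹ := inv_nonneg.2 (by linarith)
  exact isBoundedMultiplier_of_integral_le μ hr (by positivity) _ fun k f hf =>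
    integral_fourierMultiplier_rpow_le μ hα hC h hf

omit [IsTopologicalGroup G] [CompactSpace G] [BorelSpace G] [μ.IsHaarMeasure]
  [IsProbabilityMeasure μ] in
lemma weighted_zero : V.weighted μ 0 = μ := by
  simp [weighted]

end VilenkinFiltration

theorem mainTheorem1 {G : Type*} [Group G] [TopologicalSpace G] [IsTopologicalGroup G]
    [CompactSpace G] [T2Space G] [TotallyDisconnectedSpace G]
    [MeasurableSpace G] [BorelSpace G]
    (μ : MeasureTheory.Measure G) [μ.IsHaarMeasure] [MeasureTheory.IsProbabilityMeasure μ]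
    (V : VilenkinFiltration G) (hV : V.IsOrderBounded)
    (σ : FourierSymbol G) (hσ : σ.IsBounded) :
    (∀ t α₀ : ℝ, 1 ≤ t → V.ConditionH μ σ t →
      -(1 - 1 / t) < α₀ → α₀ < 1 - 1 / t →
      V.IsBoundedMultiplier μ σ 2 (V.weighted μ α₀) →
      ∀ r α : ℝ, 1 < r → -|α₀| ≤ α → α ≤ (r - 1) * |α₀| →
        V.IsBoundedMultiplier μ σ r (V.weighted μ α)) ∧
    (V.ConditionH μ σ 1 →
      ∀ r : ℝ, 1 < r → V.IsBoundedMultiplier μ σ r μ) := by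
  obtain ⟨B, hB⟩ := hV
  obtain ⟨C, hC⟩ := hσ
  have hdbl : ∀ k, ∀ n < (V.chain k).depth,
      (V.chain k).vol n ≤ max (B : ℝ) 1 * (V.chain k).vol (n + 1) := fun k n hn =>
    (VilenkinFiltration.vol_chain_le_mul hB k n hn).trans
      (mul_le_mul_of_nonneg_right (le_max_left _ _) (NormalChain.vol_pos _).le)
  have hL2 := VilenkinFiltration.sum_convMatrix_sq_le (V := V) μ hC
  constructor
  · intro t α₀ _ hH h1 h2 _ r α hr hα1 hα2
    have habs : |α₀| < 1 - 1 / t := abs_lt.2 ⟨h1, h2⟩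
    rcases hH with ⟨ht, ε, hε, D, hD⟩ | ⟨rfl, -⟩
    · have ht' : 0 < 1 / t := by positivity
      obtain ⟨K, hK, H⟩ := NormalChain.exists_weighted_bound (α := α) (sq_nonneg C)
        (le_max_right (B : ℝ) 1) (abs_nonneg D) hr ht hε (by linarith)
        (hα2.trans_lt (mul_lt_mul_of_pos_left habs (by linarith)))
      exact VilenkinFiltration.isBoundedMultiplier_weighted μ hr.le (by linarith) hK fun k =>
        H (V.chain k) _ (hdbl k) (hL2 k) (VilenkinFiltration.translationBound_quotKernel μ hD k)
    · -- The range of `α₀` is empty for `t = 1`.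
      have := abs_nonneg α₀
      norm_num at habs
      linarith
  · rintro (⟨h, -⟩ | ⟨-, D, hD⟩) r hr
    · exact absurd h (lt_irrefl 1)
    · obtain ⟨K, hK, H⟩ := NormalChain.exists_unweighted_bound (sq_nonneg C)
        (le_max_right (B : ℝ) 1) (abs_nonneg D) hr
      have key : V.IsBoundedMultiplier μ σ r (V.weighted μ 0) :=
        VilenkinFiltration.isBoundedMultiplier_weighted μ hr.le (by norm_num) hK fun k F => by
          simpa only [Real.rpow_zero, one_mul] using H (V.chain k) (V.quotKernel μ σ k) (hdbl k)
            (hL2 k) (VilenkinFiltration.mean_quotKernel_compl_le μ hD k) F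
      rwa [VilenkinFiltration.weighted_zero] at key
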